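/- **Definitions.** A binary sequence $A=a_1,\dots,a_m$ has terms in $\{\pm1\}$; put $A(z)=a_1+a_2z+\cdots+a_mz^{m-1}$ and $N(A)=A(z)A(z^{-1})$. $BS(m,n)$ is the set of base sequences: quadruples $(A;B;C;D)$ of binary sequences, $A,B$ of length $m$ and $C,D$ of length $n$, with $N(A)+N(B)+N(C)+N(D)=2(m+n)$. Two members of $BS(n+1,n)$ are *equivalent* if one is obtained from the other by finitely many of the following transformations: negate one of $A,B,C,D$; reverse one of $A,B,C,D$; interchange $A$ and $B$; interchange $C$ and $D$; alternate all four sequences (replace each $x_i$ by $(-1)^{i-1}x_i$); in the pair $(C;D)$, negate simultaneously every quad $\begin{bmatrix}c_i&c_{n+1-i}\\ d_i&d_{n+1-i}\end{bmatrix}$, $i\le n/2$, equal to $\begin{bmatrix}+&-\\-&+\end{bmatrix}$ or $\begin{bmatrix}-&+\\+&-\end{bmatrix}$, leaving all other terms unchanged. $H(N)$ is the set of Hadamard matrices of order $N$; $A,B\in H(N)$ are *equivalent* if $B=PAQ$ for some signed permutation matrices $P,Q$. For a binary sequence $X$ let $Z_X$ be the circulant matrix with first row $X$, and let $R$ be the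 matrix with ones on the back-diagonal and zeros elsewhere. To $(A;B;C;D)\in BS(m,n)$ assign $(M;U;V;W)=(A,C;\,A,-C;\,B,D;\,B,-D)$ (the comma denotes concatenation), and then the matrix of order $4(m+n)$ $$\begin{bmatrix} Z_0 & Z_1R & Z_2R & Z_3R\\ -Z_1R & Z_0 & -RZ_3 & RZ_2\\ -Z_2R & RZ_3 & Z_0 & -RZ_1\\ -Z_3R & -RZ_2 & RZ_1 & Z_0\end{bmatrix},\qquad (Z_0,Z_1,Z_2,Z_3)=(Z_M,Z_U,Z_V,Z_W).$$ Members of $BS(8,7)$ are encoded as $p_1p_2p_3p_4;\,q_1q_2q_3q_4$, where $p_i$ is the label of the quad $\begin{bmatrix}a_i&a_{9-i}\\ b_i&b_{9-i}\end{bmatrix}$ $(1\le i\le4)$, $q_i$ is the label of the quad $\begin{bmatrix}c_i&c_{8-i}\\ d_i&d_{8-i}\end{bmatrix}$ $(1\le i\le3)$, and $q_4$ is the label of the central column $\begin{bmatrix}c_4\\ d_4\end{bmatrix}$. The quad labels are $$0=\begin{bmatrix}+&+\\+&-\end{bmatrix},\ 1=\begin{bmatrix}+&+\\+&+\end{bmatrix},\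 2=\begin{bmatrix}+&+\\-&-\end{bmatrix},\ 3=\begin{bmatrix}-&+\\-&+\end{bmatrix},\ 4=\begin{bmatrix}+&-\\-&+\end{bmatrix},$$ $$5=\begin{bmatrix}-&+\\+&-\end{bmatrix},\ 6=\begin{bmatrix}+&-\\+&-\end{bmatrix},\ 7=\begin{bmatrix}-&-\\+&+\end{bmatrix},\ 8=\begin{bmatrix}-&-\\-&-\end{bmatrix},$$ and the central column labels are $0=\begin{bmatrix}+\\+\end{bmatrix}$, $1=\begin{bmatrix}+\\-\end{bmatrix}$, $2=\begin{bmatrix}-\\+\end{bmatrix}$, $3=\begin{bmatrix}-\\-\end{bmatrix}$. **Theorem.** The construction maps $BS(8,7)$ into $H(60)$. The set $BS(8,7)$ has exactly $17$ equivalence classes, and the Hadamard matrices constructed from all of $BS(8,7)$ form exactly $558$ equivalence classes of $H(60)$ (that is, they meet exactly $558$ classes). Nonequivalent base sequences in $BS(8,7)$ always yield nonequivalent Hadamard matrices. Moreover, each equivalence class $\mathcal E$ of $BS(8,7)$ has exactly one representative in the following table, and $\#\mathcal E$ and the number #Had. of equivalence classes of $H(60)$ constructed from $\mathcal E$ are as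 listed: $$\begin{array}{rcrr} & AB;\,CD & \#\mathcal E & \text{Had.}\\ \hline 1 & 0165;\,6123 & 2048 & 32\\ 2 & 0165;\,6141 & 4096 & 64\\ 3 & 0166;\,6122 & 2048 & 32\\ 4 & 0173;\,6161 & 2048 & 32\\ 5 & 0173;\,6411 & 4096 & 64\\ 6 & 0183;\,6121 & 2048 & 32\\ 7 & 0613;\,1623 & 2048 & 32\\ 8 & 0614;\,1641 & 4096 & 64\\ 9 & 0615;\,1263 & 2048 & 32\\ 10 & 0615;\,1272 & 512 & 8\\ 11 & 0616;\,1262 & 2048 & 32\\ 12 & 0618;\,1261 & 2048 & 32\\ 13 & 0635;\,1621 & 1024 & 16\\ 14 & 0638;\,1620 & 2048 & 32\\ 15 & 0641;\,1622 & 2048 & 32\\ 16 & 0646;\,1222 & 256 & 6\\ 17 & 0646;\,1260 & 1024 & 16 \end{array}$$ -/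

import Mathlib

open Matrix

/-! ### Base sequences -/

/-- Quadruples `(A; B; C; D)` of binary sequences, `A` and `B` of length `m`, `C` and `D` of
length `n`. Terms are indexed from `0`. -/
@[ext]
structure BinaryQuad (m n : ℕ) where
  A : Fin m → ℤˣ
  B : Fin m → ℤˣ
  C : Fin n → ℤˣ
  D : Fin n → ℤˣ

/-- The polynomial `A(z) = a₁ + a₂ z + ⋯ + a_m z ^ (m - 1)` of a binary sequence. -/
noncomputable def seqPoly {m : ℕ} (a : Fin m → ℤˣ) : LaurentPolynomial ℤ :=
  ∑ i : Fin m, LaurentPolynomial.C ((a i : ℤˣ) : ℤ) * LaurentPolynomial.T ((i : ℕ) : ℤ)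

/-- The norm `N(A) = A(z) A(z⁻¹)`. -/
noncomputable def seqNorm {m : ℕ} (a : Fin m → ℤˣ) : LaurentPolynomial ℤ :=
  seqPoly a * LaurentPolynomial.invert (seqPoly a)

/-- `(A; B; C; D)` are base sequences: `N(A) + N(B) + N(C) + N(D) = 2 (m + n)`. -/
def IsBaseSequences {m n : ℕ} (x : BinaryQuad m n) : Prop :=
  seqNorm x.A + seqNorm x.B + seqNorm x.C + seqNorm x.D =
    LaurentPolynomial.C (2 * ((m : ℤ) + (n : ℤ)))

/-- The set `BS(m, n)`. -/
def BS (m n : ℕ) : Type := {x : BinaryQuad m n // IsBaseSequences x}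

/-! ### Equivalence of base sequences in `BS(n + 1, n)` -/

/-- The reversed sequence. -/
def revSeq {m : ℕ} (a : Fin m → ℤˣ) : Fin m → ℤˣ := fun i => a i.rev

/-- The alternated sequence `a₁, -a₂, a₃, -a₄, …`. -/
def altSeq {m : ℕ} (a : Fin m → ℤˣ) : Fin m → ℤˣ := fun i => (-1) ^ (i : ℕ) * a i

/-- The `i`-th and the mirror columns of `(C; D)` form one of the two quads
`[+ -; - +]` and `[- +; + -]` (never so for the central column). -/
def IsDiagQuad {n : ℕ} (c d : Fin n → ℤˣ) (i : Fin n) : Prop :=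
  c i.rev = -c i ∧ d i = -c i ∧ d i.rev = c i

open Classical in
/-- For a pair `(C; D)`: the first or second sequence `s` of the pair, after each quad `[+ -; - +]`
of `(C; D)` has been replaced by `[- +; + -]` and vice versa. -/
noncomputable def quadSwap {n : ℕ} (c d s : Fin n → ℤˣ) : Fin n → ℤˣ :=
  fun i => if IsDiagQuad c d i then -s i else s i

/-- The elementary transformations of `BS(n + 1, n)`: negate or reverse one of the four sequences,
interchange `A` and `B`, interchange `C` and `D`, swap the quads `[+ -; - +]` and `[- +; + -]`
throughout `(C; D)`, alternate all four sequences. -/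
inductive Elementary {n : ℕ} : BinaryQuad (n + 1) n → BinaryQuad (n + 1) n → Prop
  | negA (a b c d) : Elementary ⟨a, b, c, d⟩ ⟨-a, b, c, d⟩
  | negB (a b c d) : Elementary ⟨a, b, c, d⟩ ⟨a, -b, c, d⟩
  | negC (a b c d) : Elementary ⟨a, b, c, d⟩ ⟨a, b, -c, d⟩
  | negD (a b c d) : Elementary ⟨a, b, c, d⟩ ⟨a, b, c, -d⟩
  | revA (a b c d) : Elementary ⟨a, b, c, d⟩ ⟨revSeq a, b, c, d⟩
  | revB (a b c d) : Elementary ⟨a, b, c, d⟩ ⟨a, revSeq b, c, d⟩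
  | revC (a b c d) : Elementary ⟨a, b, c, d⟩ ⟨a, b, revSeq c, d⟩
  | revD (a b c d) : Elementary ⟨a, b, c, d⟩ ⟨a, b, c, revSeq d⟩
  | swapAB (a b c d) : Elementary ⟨a, b, c, d⟩ ⟨b, a, c, d⟩
  | swapCD (a b c d) : Elementary ⟨a, b, c, d⟩ ⟨a, b, d, c⟩
  | quads (a b c d) : Elementary ⟨a, b, c, d⟩ ⟨a, b, quadSwap c d c, quadSwap c d d⟩
  | alt (a b c d) : Elementary ⟨a, b, c, d⟩ ⟨altSeq a, altSeq b, altSeq c, altSeq d⟩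

/-- Equivalence of base sequences: a finite chain of elementary transformations inside
`BS(n + 1, n)`. -/
def baseSetoid (n : ℕ) : Setoid (BS (n + 1) n) :=
  Relation.EqvGen.setoid fun x y => Elementary x.1 y.1

/-! ### Hadamard matrices -/

/-- The set `H(N)` of Hadamard matrices of order `N`. -/
def HadamardMat (N : ℕ) : Type := {M : Matrix (Fin N) (Fin N) ℤ // M.IsHadamard}

/-- The signed permutation matrix with entry `ε i` at position `(i, σ i)`, all others zero. -/
def signedPerm {N : ℕ} (σ : Equiv.Perm (Fin N)) (ε : Fin N → ℤˣ) : Matrix (Fin N) (Fin N) ℤ :=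
  Matrix.of fun i j => if σ i = j then ((ε i : ℤˣ) : ℤ) else 0

/-- `P` is a signed permutation matrix. -/
def IsSignedPerm {N : ℕ} (P : Matrix (Fin N) (Fin N) ℤ) : Prop :=
  ∃ (σ : Equiv.Perm (Fin N)) (ε : Fin N → ℤˣ), P = signedPerm σ ε

/-- Equivalence of matrices: `B = P A Q` for some signed permutation matrices `P` and `Q`. -/
def HadamardEquivalent {N : ℕ} (A B : Matrix (Fin N) (Fin N) ℤ) : Prop :=
  ∃ P Q : Matrix (Fin N) (Fin N) ℤ, IsSignedPerm P ∧ IsSignedPerm Q ∧ B = P * A * Q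

theorem isSignedPerm_one {N : ℕ} : IsSignedPerm (1 : Matrix (Fin N) (Fin N) ℤ) := by
  refine ⟨1, 1, ?_⟩
  ext i j
  by_cases h : i = j <;> simp [signedPerm, Matrix.one_apply, h]

theorem signedPerm_mul {N : ℕ} (σ τ : Equiv.Perm (Fin N)) (ε δ : Fin N → ℤˣ) :
    signedPerm σ ε * signedPerm τ δ = signedPerm (σ.trans τ) (fun i => ε i * δ (σ i)) := by
  ext i j
  rw [Matrix.mul_apply, Finset.sum_eq_single (σ i)]
  · by_cases h : τ (σ i) = j <;> simp [signedPerm, h]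
  · intro k _ hk
    simp [signedPerm, hk.symm]
  · simp

theorem IsSignedPerm.mul {N : ℕ} {P Q : Matrix (Fin N) (Fin N) ℤ} (hP : IsSignedPerm P)
    (hQ : IsSignedPerm Q) : IsSignedPerm (P * Q) := by
  obtain ⟨σ, ε, rfl⟩ := hP
  obtain ⟨τ, δ, rfl⟩ := hQ
  exact ⟨_, _, signedPerm_mul σ τ ε δ⟩

theorem IsSignedPerm.exists_inv {N : ℕ} {P : Matrix (Fin N) (Fin N) ℤ} (hP : IsSignedPerm P) :
    ∃ P' : Matrix (Fin N) (Fin N) ℤ, IsSignedPerm P' ∧ P' * P = 1 ∧ P * P' = 1 := by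
  obtain ⟨σ, ε, rfl⟩ := hP
  have h : signedPerm σ ε * signedPerm σ.symm (fun i => ε (σ.symm i)) = 1 := by
    rw [signedPerm_mul]
    ext i j
    by_cases h : i = j <;> simp [signedPerm, Matrix.one_apply, h]
  exact ⟨_, ⟨_, _, rfl⟩, mul_eq_one_comm.mp h, h⟩

/-- Equivalence of Hadamard matrices of order `N`. -/
def hadamardSetoid (N : ℕ) : Setoid (HadamardMat N) where
  r A B := HadamardEquivalent A.1 B.1
  iseqv :=
    { refl := fun A => ⟨1, 1, isSignedPerm_one, isSignedPerm_one, by simp⟩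
      symm := by
        rintro ⟨A, hA⟩ ⟨B, hB⟩ ⟨P, Q, hP, hQ, h⟩
        obtain ⟨P', hP', h1, -⟩ := hP.exists_inv
        obtain ⟨Q', hQ', -, h2⟩ := hQ.exists_inv
        refine ⟨P', Q', hP', hQ', ?_⟩
        change B = P * A * Q at h
        change A = P' * B * Q'
        rw [h]
        calc A = (P' * P) * A * (Q * Q') := by rw [h1, h2]; simp
          _ = P' * (P * A * Q) * Q' := by simp only [Matrix.mul_assoc]
      trans := by
        rintro ⟨A, hA⟩ ⟨B, hB⟩ ⟨C, hC⟩ ⟨P, Q, hP, hQ, h⟩ ⟨P', Q', hP', hQ', h'⟩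
        refine ⟨P' * P, Q * Q', hP'.mul hP, hQ.mul hQ', ?_⟩
        change B = P * A * Q at h
        change C = P' * B * Q' at h'
        change C = P' * P * A * (Q * Q')
        rw [h', h]
        simp only [Matrix.mul_assoc] }

/-! ### From base sequences to Hadamard matrices -/

/-- The circulant matrix `Z_X` with first row `X`. -/
def circ {d : ℕ} (X : Fin d → ℤˣ) : Matrix (Fin d) (Fin d) ℤ :=
  (Matrix.circulant fun i => ((X i : ℤˣ) : ℤ))ᵀ

/-- The matrix `R` with ones on the back-diagonal and zeros elsewhere. -/
def backDiag (d : ℕ) : Matrix (Fin d) (Fin d) ℤ :=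
  Matrix.of fun i j => if j = i.rev then 1 else 0

/-- The Goethals–Seidel array, as a `4 × 4` array of `d × d` blocks. -/
def goethalsSeidelBlocks {d : ℕ} (Z₀ Z₁ Z₂ Z₃ : Matrix (Fin d) (Fin d) ℤ) :
    Matrix (Fin 4) (Fin 4) (Matrix (Fin d) (Fin d) ℤ) :=
  let R := backDiag d
  !![ Z₀,        Z₁ * R,    Z₂ * R,    Z₃ * R;
      -(Z₁ * R), Z₀,        -(R * Z₃), R * Z₂;
      -(Z₂ * R), R * Z₃,    Z₀,        -(R * Z₁);
      -(Z₃ * R), -(R * Z₂), R * Z₁,    Z₀ ]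

/-- The Goethals–Seidel array as a matrix of order `4 d`: row `d * p + i` is the `i`-th row of the
`p`-th row of blocks, and likewise for the columns. -/
def goethalsSeidel {d : ℕ} (Z₀ Z₁ Z₂ Z₃ : Matrix (Fin d) (Fin d) ℤ) :
    Matrix (Fin (4 * d)) (Fin (4 * d)) ℤ :=
  Matrix.reindex finProdFinEquiv finProdFinEquiv
    (Matrix.of fun r c : Fin 4 × Fin d => goethalsSeidelBlocks Z₀ Z₁ Z₂ Z₃ r.1 c.1 r.2 c.2)

/-- Plugging the circulants `Z_M, Z_U, Z_V, Z_W` into the Goethals–Seidel array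
(the map `BS(d, d) → H(4 d)`). -/
def quadToMatrix {d : ℕ} (x : BinaryQuad d d) : Matrix (Fin (4 * d)) (Fin (4 * d)) ℤ :=
  goethalsSeidel (circ x.A) (circ x.B) (circ x.C) (circ x.D)

/-- `(A; B; C; D) ↦ (A,C; A,-C; B,D; B,-D)`, where the comma is concatenation
(the map `BS(m, n) → BS(m + n, m + n)`). -/
def doubling {m n : ℕ} (x : BinaryQuad m n) : BinaryQuad (m + n) (m + n) where
  A := Fin.append x.A x.C
  B := Fin.append x.A (-x.C)
  C := Fin.append x.B x.D
  D := Fin.append x.B (-x.D)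

/-- The matrix of order `4 (m + n)` constructed from `(A; B; C; D)`. -/
def constructedMatrix {m n : ℕ} (x : BinaryQuad m n) :
    Matrix (Fin (4 * (m + n))) (Fin (4 * (m + n))) ℤ :=
  quadToMatrix (doubling x)

/-- The equivalence classes of Hadamard matrices constructed from the base sequences in `S`. -/
def constructedClasses {m n : ℕ} (S : Set (BS m n)) :
    Set (Quotient (hadamardSetoid (4 * (m + n)))) :=
  {c | ∃ x ∈ S, ∃ H : HadamardMat (4 * (m + n)),
    H.1 = constructedMatrix x.1 ∧ c = Quotient.mk (hadamardSetoid (4 * (m + n))) H}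

/-! ### The encoding of base sequences in `BS(8, 7)` and the table -/

/-- The quad `[x₀ x₁; y₀ y₁]` with the given label, as the matrix of its entries.
The label `0` is the first-quad label `3'`; labels above `8` are not used. -/
def quadOfLabel : ℕ → Matrix (Fin 2) (Fin 2) ℤˣ
  | 0 => !![ 1,  1;  1, -1]
  | 1 => !![ 1,  1;  1,  1]
  | 2 => !![ 1,  1; -1, -1]
  | 3 => !![-1,  1; -1,  1]
  | 4 => !![ 1, -1; -1,  1]
  | 5 => !![-1,  1;  1, -1]
  | 6 => !![ 1, -1;  1, -1]
  | 7 => !![-1, -1;  1,  1]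
  | _ => !![-1, -1; -1, -1]

/-- The central column with the given label; labels above `3` are not used. -/
def centralOfLabel : ℕ → Fin 2 → ℤˣ
  | 0 => ![ 1,  1]
  | 1 => ![ 1, -1]
  | 2 => ![-1,  1]
  | _ => ![-1, -1]

/-- Row `r` (`0` for `A`, `1` for `B`) of the pair `(A; B)` of length `8` encoded by
`p₁ p₂ p₃ p₄`. -/
def decodeAB (p : Fin 4 → ℕ) (r : Fin 2) : Fin 8 → ℤˣ :=
  ![quadOfLabel (p 0) r 0, quadOfLabel (p 1) r 0, quadOfLabel (p 2) r 0, quadOfLabel (p 3) r 0,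
    quadOfLabel (p 3) r 1, quadOfLabel (p 2) r 1, quadOfLabel (p 1) r 1, quadOfLabel (p 0) r 1]

/-- Row `r` (`0` for `C`, `1` for `D`) of the pair `(C; D)` of length `7` encoded by
`q₁ q₂ q₃ q₄`, where `q₄` is the label of the central column. -/
def decodeCD (q : Fin 4 → ℕ) (r : Fin 2) : Fin 7 → ℤˣ :=
  ![quadOfLabel (q 0) r 0, quadOfLabel (q 1) r 0, quadOfLabel (q 2) r 0, centralOfLabel (q 3) r,
    quadOfLabel (q 2) r 1, quadOfLabel (q 1) r 1, quadOfLabel (q 0) r 1]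

/-- The quadruple with encoding `p; q`. -/
def decode (p q : Fin 4 → ℕ) : BinaryQuad 8 7 where
  A := decodeAB p 0
  B := decodeAB p 1
  C := decodeCD q 0
  D := decodeCD q 1

/-- A row of the table: the encoded representative `AB; CD`, the size of its equivalence class,
and the number of classes of Hadamard matrices constructed from that class. -/
structure TableRow where
  AB : Fin 4 → ℕ
  CD : Fin 4 → ℕ
  size : ℕ
  had : ℕ

/-- The table for `BS(8, 7)`. -/
def table : Fin 17 → TableRow :=
  ![⟨![0, 1, 6, 5], ![6, 1, 2, 3], 2048, 32⟩,
    ⟨![0, 1, 6, 5], ![6, 1, 4, 1], 4096, 64⟩,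
    ⟨![0, 1, 6, 6], ![6, 1, 2, 2], 2048, 32⟩,
    ⟨![0, 1, 7, 3], ![6, 1, 6, 1], 2048, 32⟩,
    ⟨![0, 1, 7, 3], ![6, 4, 1, 1], 4096, 64⟩,
    ⟨![0, 1, 8, 3], ![6, 1, 2, 1], 2048, 32⟩,
    ⟨![0, 6, 1, 3], ![1, 6, 2, 3], 2048, 32⟩,
    ⟨![0, 6, 1, 4], ![1, 6, 4, 1], 4096, 64⟩,
    ⟨![0, 6, 1, 5], ![1, 2, 6, 3], 2048, 32⟩,
    ⟨![0, 6, 1, 5], ![1, 2, 7, 2], 512, 8⟩,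
    ⟨![0, 6, 1, 6], ![1, 2, 6, 2], 2048, 32⟩,
    ⟨![0, 6, 1, 8], ![1, 2, 6, 1], 2048, 32⟩,
    ⟨![0, 6, 3, 5], ![1, 6, 2, 1], 1024, 16⟩,
    ⟨![0, 6, 3, 8], ![1, 6, 2, 0], 2048, 32⟩,
    ⟨![0, 6, 4, 1], ![1, 6, 2, 2], 2048, 32⟩,
    ⟨![0, 6, 4, 6], ![1, 2, 2, 2], 256, 6⟩,
    ⟨![0, 6, 4, 6], ![1, 2, 6, 0], 1024, 16⟩]

namespace BaseSeq

/-! ### Numbers as lists of digits -/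

/-! The theorem rests on two finite computations: a classification of the base sequences by
exhaustive search, and a comparison of Hadamard matrices by numerical invariants.

Classification. The norm condition says that the aperiodic autocorrelations of the four sequences
cancel at the distances 1, …, 7. A sequence is coded by a number whose set bits mark the terms −1,
and its autocorrelations are stored in one number, its `profile`, which negation and reversal do not
change. Membership in BS(8,7) becomes the statement that four profiles have a prescribed sum
(`isBaseSequences_mkq`), so it is enough to search among sequences that are least in their orbits
under negation and reversal. The search leaves the 40 keys of `keyTable`, each labelled by a row of
the table. The label is invariant under every elementary transformation (`Code.cls_step`), and every
key comes with a chain of transformations inside BS(8,7) to the representative of its row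
(`Code.linked_representative`). Hence the labels are the equivalence classes
(`exists_representative`), and their sizes follow from orbit sizes (`ncard_rowOf_eq`).

Upper bound for the Hadamard classes. Five transformations of (A;B;C;D) only permute rows and
columns of the constructed matrix and change their signs: negating C and D, A and C, or A and B,
interchanging (A,C) with (B,D), and reversing A and C. With these, every member of BS(8,7) is moved
to one of the 558 quadruples of `hadTable`, within the row of its class (`exists_hadList`).

Lower bound. For four rows of a matrix of order 60, the absolute value of the sum of their entrywise
product is not affected by signs and permutations of columns, nor by signs of rows. Adding a
function of this value over all quadruples of rows gives an invariant, `fourScore`. It separates all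
the listed matrices except one pair, and for that pair the contributions of the single rows,
`localScore`, differ. So the 558 listed matrices are pairwise nonequivalent
(`eq_of_hadamardEquivalent`). As this holds across the rows of the table too, nonequivalent base
sequences give nonequivalent matrices. That the constructed matrices are Hadamard is verified on the
list and carried over by equivalence; no general theorem on the Goethals–Seidel array is used.

Computation. A row is a number of 60 bits, the product of rows is an exclusive or, and its sum is 60
minus twice a population count. A matrix has 487635 quadruples of rows, so the exclusive ors of all
quadruples with a given largest row are packed into lanes of 64 bits of one large number, and
population counts, scores and sums are computed for all lanes at once. -/

theorem testBit_add_two_pow_mul {w x X : ℕ} (hx : x < 2 ^ w) (i : ℕ) :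
    (x + 2 ^ w * X).testBit i = if i < w then x.testBit i else X.testBit (i - w) := by
  rw [add_comm, Nat.testBit_two_pow_mul_add _ hx]

theorem land_add_two_pow_mul {w x y : ℕ} (X Y : ℕ) (hx : x < 2 ^ w) (hy : y < 2 ^ w) :
    (x + 2 ^ w * X) &&& (y + 2 ^ w * Y) = (x &&& y) + 2 ^ w * (X &&& Y) := by
  apply Nat.eq_of_testBit_eq
  intro i
  rw [Nat.testBit_and, testBit_add_two_pow_mul hx, testBit_add_two_pow_mul hy,
    testBit_add_two_pow_mul (Nat.and_lt_two_pow _ hy)]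
  split_ifs <;> simp

theorem xor_add_two_pow_mul {w x y : ℕ} (X Y : ℕ) (hx : x < 2 ^ w) (hy : y < 2 ^ w) :
    (x + 2 ^ w * X) ^^^ (y + 2 ^ w * Y) = (x ^^^ y) + 2 ^ w * (X ^^^ Y) := by
  apply Nat.eq_of_testBit_eq
  intro i
  rw [Nat.testBit_xor, testBit_add_two_pow_mul hx, testBit_add_two_pow_mul hy,
    testBit_add_two_pow_mul (Nat.xor_lt_two_pow hx hy)]
  split_ifs <;> simp

theorem ofDigits_land_map {α : Type*} {w : ℕ} {L : List α} {f g : α → ℕ}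
    (hf : ∀ x ∈ L, f x < 2 ^ w) (hg : ∀ x ∈ L, g x < 2 ^ w) :
    Nat.ofDigits (2 ^ w) (L.map f) &&& Nat.ofDigits (2 ^ w) (L.map g) =
      Nat.ofDigits (2 ^ w) (L.map fun x => f x &&& g x) := by
  induction L with
  | nil => simp
  | cons a L ih =>
    simp only [List.mem_cons, forall_eq_or_imp] at hf hg
    simp only [List.map_cons, Nat.ofDigits_cons]
    rw [land_add_two_pow_mul _ _ hf.1 hg.1, ih hf.2 hg.2]

theorem ofDigits_xor_map {α : Type*} {w : ℕ} {L : List α} {f g : α → ℕ}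
    (hf : ∀ x ∈ L, f x < 2 ^ w) (hg : ∀ x ∈ L, g x < 2 ^ w) :
    Nat.ofDigits (2 ^ w) (L.map f) ^^^ Nat.ofDigits (2 ^ w) (L.map g) =
      Nat.ofDigits (2 ^ w) (L.map fun x => f x ^^^ g x) := by
  induction L with
  | nil => simp
  | cons a L ih =>
    simp only [List.mem_cons, forall_eq_or_imp] at hf hg
    simp only [List.map_cons, Nat.ofDigits_cons]
    rw [xor_add_two_pow_mul _ _ hf.1 hg.1, ih hf.2 hg.2]

theorem ofDigits_add_map {α : Type*} (b : ℕ) (L : List α) (f g : α → ℕ) :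
    Nat.ofDigits b (L.map f) + Nat.ofDigits b (L.map g) =
      Nat.ofDigits b (L.map fun x => f x + g x) := by
  induction L with
  | nil => simp
  | cons a L ih =>
    simp only [List.map_cons, Nat.ofDigits_cons, ← ih]
    ring

theorem mul_ofDigits_map {α : Type*} (b c : ℕ) (L : List α) (f : α → ℕ) :
    c * Nat.ofDigits b (L.map f) = Nat.ofDigits b (L.map fun x => c * f x) := by
  induction L with
  | nil => simp
  | cons a L ih =>
    simp only [List.map_cons, Nat.ofDigits_cons, ← ih]
    ring

/-- The geometric series. It identifies numbers with a constant digit, such as `laneOnes` and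
`evenMask`, with quotients that are computed in one division. -/
theorem ofDigits_map_const_add_one {α : Type*} (b c : ℕ) (L : List α) (hb : 0 < b) :
    (b - 1) * Nat.ofDigits b (L.map fun _ => c) + c = c * b ^ L.length := by
  induction L with
  | nil => simp
  | cons a L ih =>
    obtain ⟨b, rfl⟩ := Nat.exists_eq_add_of_lt hb
    simp only [List.map_cons, Nat.ofDigits_cons, List.length_cons, pow_succ,
      zero_add, Nat.add_sub_cancel] at ih ⊢
    rw [← mul_assoc, ← ih]
    ring

/-- Since b ≡ 1 modulo b − 1. For b = 2 ^ 64 a single remainder adds up all lanes. -/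
theorem ofDigits_modEq_sum (b : ℕ) (L : List ℕ) (hb : 0 < b) :
    Nat.ofDigits b L ≡ L.sum [MOD b - 1] := by
  obtain ⟨b, rfl⟩ := Nat.exists_eq_add_of_lt hb
  simp only [zero_add, Nat.add_sub_cancel]
  simpa [Nat.ofDigits_one] using Nat.ofDigits_modEq' (b + 1) 1 b (by simp [Nat.ModEq]) L

theorem eq_zero_of_ofDigits_eq_zero {b : ℕ} (hb : 0 < b) {L : List ℕ}
    (h : Nat.ofDigits b L = 0) : ∀ x ∈ L, x = 0 := by
  induction L with
  | nil => simp
  | cons a L ih =>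
    simp only [Nat.ofDigits_cons, Nat.add_eq_zero_iff, mul_eq_zero] at h
    simp only [List.mem_cons, forall_eq_or_imp]
    exact ⟨h.1, ih (h.2.resolve_left hb.ne')⟩

/-! ### Many population counts at once -/

/-- The number with `k` lanes of 64 bits, all equal to `1`. -/
def laneOnes (k : ℕ) : ℕ :=
  -- The divisor is 2 ^ 64 − 1.
  Nat.div (Nat.sub (Nat.pow 2 (Nat.mul 64 k)) 1) 18446744073709551615

/-- The mask of the even fields of width `s` in `k` lanes. -/
def evenMask (s k : ℕ) : ℕ :=
  Nat.div (Nat.sub (Nat.pow 2 (Nat.mul 64 k)) 1) (Nat.add (Nat.pow 2 s) 1)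

/-- Add each odd field of width `s` to its lower neighbour. -/
def addFields (s k X : ℕ) : ℕ :=
  Nat.add (Nat.land X (evenMask s k))
    (Nat.shiftRight (Nat.sub X (Nat.land X (evenMask s k))) s)

/-- Population counts of all `k` lanes of `X`. -/
def lanePop (k X : ℕ) : ℕ :=
  addFields 32 k (addFields 16 k (addFields 8 k (addFields 4 k (addFields 2 k (addFields 1 k X)))))

/-- The population count of a number below `2 ^ 64`. -/
def popcount (x : ℕ) : ℕ := ((List.range 64).map fun i => (x.testBit i).toNat).sum

theorem mul_laneOnes {α : Type*} {k : ℕ} (c : ℕ) {L : List α} (hL : L.length = k) :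
    c * laneOnes k = Nat.ofDigits (2 ^ 64) (L.map fun _ => c) := by
  have h := ofDigits_map_const_add_one (2 ^ 64) 1 L (by positivity)
  have h1 : laneOnes k = Nat.ofDigits (2 ^ 64) (L.map fun _ => 1) := by
    change (2 ^ (64 * k) - 1) / 18446744073709551615 = _
    rw [hL, ← pow_mul, one_mul] at h
    rw [← h, Nat.add_sub_cancel]
    exact Nat.mul_div_cancel_left _ (by norm_num)
  rw [h1, mul_ofDigits_map]
  simp

/-- Because 2 ^ (2s) − 1 = (2 ^ s + 1)(2 ^ s − 1), dividing the all-ones number by 2 ^ s + 1 leaves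
ones exactly in the lower half of each field of width 2s. -/
theorem evenMask_eq {s k : ℕ} {D : List ℕ} (hD : 2 * s * D.length = 64 * k) :
    evenMask s k = Nat.ofDigits (2 ^ (2 * s)) (D.map fun _ => 2 ^ s - 1) := by
  have h := ofDigits_map_const_add_one (2 ^ (2 * s)) 1 D (by positivity)
  change (2 ^ (64 * k) - 1) / (2 ^ s + 1) = _
  rw [← pow_mul, hD, one_mul] at h
  rw [← h, Nat.add_sub_cancel]
  have h2 : 2 ^ (2 * s) - 1 = (2 ^ s + 1) * (2 ^ s - 1) := by
    rw [← Nat.sq_sub_sq, mul_comm 2 s, pow_mul]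
  rw [h2, mul_assoc, Nat.mul_div_cancel_left _ (by positivity), mul_ofDigits_map]
  simp

/-- The mask keeps the lower halves of the digits. What remains is a multiple of 2 ^ s, so the shift
moves the upper halves down without loss. -/
theorem addFields_ofDigits {s k : ℕ} {D : List ℕ} (hD : 2 * s * D.length = 64 * k)
    (hlt : ∀ d ∈ D, d < 2 ^ (2 * s)) :
    addFields s k (Nat.ofDigits (2 ^ (2 * s)) D) =
      Nat.ofDigits (2 ^ (2 * s)) (D.map fun d => d % 2 ^ s + d / 2 ^ s) := by
  have hE : Nat.ofDigits (2 ^ (2 * s)) D &&& evenMask s k =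
      Nat.ofDigits (2 ^ (2 * s)) (D.map fun d => d % 2 ^ s) := by
    have h := ofDigits_land_map (L := D) (w := 2 * s) (f := fun d => d) (g := fun _ => 2 ^ s - 1)
      hlt (fun _ _ => lt_of_lt_of_le (Nat.sub_lt (by positivity) one_pos)
        (Nat.pow_le_pow_right two_pos (by omega)))
    simp only [List.map_id', Nat.and_two_pow_sub_one_eq_mod] at h
    rw [evenMask_eq hD, h]
  have hX : Nat.ofDigits (2 ^ (2 * s)) D = Nat.ofDigits (2 ^ (2 * s)) (D.map fun d => d % 2 ^ s) +
      2 ^ s * Nat.ofDigits (2 ^ (2 * s)) (D.map fun d => d / 2 ^ s) := by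
    rw [mul_ofDigits_map, ofDigits_add_map]
    simp [Nat.mod_add_div]
  change (Nat.ofDigits (2 ^ (2 * s)) D &&& evenMask s k) +
    (Nat.ofDigits (2 ^ (2 * s)) D - (Nat.ofDigits (2 ^ (2 * s)) D &&& evenMask s k)) >>> s = _
  rw [hE, hX, Nat.add_sub_cancel_left, Nat.shiftRight_eq_div_pow,
    Nat.mul_div_cancel_left _ (by positivity), ofDigits_add_map]

/-- Sums of consecutive pairs. -/
def pairSum : List ℕ → List ℕ
  | a :: b :: l => (a + b) :: pairSum l
  | _ => []

/-- One round of the parallel population count. Two neighbouring digits to the base 2 ^ s are the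
halves of one digit to the base 2 ^ (2s), collected in `D'`. Their sum fits into the wider field
because 2 · 2 ^ s ≤ 2 ^ s · 2 ^ s for s ≥ 1. -/
theorem pairSum_spec {s : ℕ} (hs : 1 ≤ s) : ∀ (n : ℕ) (D : List ℕ), D.length = 2 * n →
    (∀ d ∈ D, d < 2 ^ s) →
    (pairSum D).length = n ∧ (pairSum D).sum = D.sum ∧ (∀ d ∈ pairSum D, d < 2 ^ (2 * s)) ∧
    ∃ D' : List ℕ, D'.length = n ∧ (∀ d ∈ D', d < 2 ^ (2 * s)) ∧
      Nat.ofDigits (2 ^ s) D = Nat.ofDigits (2 ^ (2 * s)) D' ∧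
      D'.map (fun d => d % 2 ^ s + d / 2 ^ s) = pairSum D
  | 0, [], _, _ => by simp [pairSum]
  | n + 1, a :: b :: D, h, hlt => by
    simp only [List.mem_cons, forall_eq_or_imp] at hlt
    obtain ⟨h1, h2, h3, D', h4, h5, h6, h7⟩ := pairSum_spec hs n D
      (by simp only [List.length_cons] at h; omega) hlt.2.2
    have hpow : 2 ^ (2 * s) = 2 ^ s * 2 ^ s := by rw [two_mul, pow_add]
    have h2s : 2 ≤ 2 ^ s := by
      calc 2 = 2 ^ 1 := rfl
        _ ≤ 2 ^ s := Nat.pow_le_pow_right two_pos hs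
    refine ⟨by simp [pairSum, h1], by simp [pairSum, h2, add_assoc], ?_,
      (a + 2 ^ s * b) :: D', by simp [h4], ?_, ?_, ?_⟩
    · simp only [pairSum, List.mem_cons, forall_eq_or_imp]
      refine ⟨?_, h3⟩
      rw [hpow]
      nlinarith [hlt.1, hlt.2.1]
    · simp only [List.mem_cons, forall_eq_or_imp]
      refine ⟨?_, h5⟩
      rw [hpow]
      nlinarith [hlt.1, hlt.2.1]
    · simp only [Nat.ofDigits_cons, h6, hpow]
      ring
    · simp only [List.map_cons, pairSum, h7, Nat.add_mul_mod_self_left, Nat.mod_eq_of_lt hlt.1,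
        Nat.add_mul_div_left _ _ (show 0 < 2 ^ s by positivity), Nat.div_eq_of_lt hlt.1, zero_add]

theorem addFields_pairSum {s k n : ℕ} (hs : 1 ≤ s) {D : List ℕ} (hD : D.length = 2 * n)
    (hk : 2 * s * n = 64 * k) (hlt : ∀ d ∈ D, d < 2 ^ s) :
    addFields s k (Nat.ofDigits (2 ^ s) D) = Nat.ofDigits (2 ^ (2 * s)) (pairSum D) := by
  obtain ⟨-, -, -, D', h4, h5, h6, h7⟩ := pairSum_spec hs n D hD hlt
  rw [h6, addFields_ofDigits (by rw [h4, hk]) h5, h7]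

theorem pairSum_append : ∀ (n : ℕ) (D E : List ℕ), D.length = 2 * n →
    pairSum (D ++ E) = pairSum D ++ pairSum E
  | 0, [], _, _ => by simp [pairSum]
  | n + 1, a :: b :: D, E, h => by
    simp only [List.cons_append, pairSum]
    rw [pairSum_append n D E (by simp only [List.length_cons] at h; omega)]

theorem pairSum_flatMap {n : ℕ} {f : ℕ → List ℕ} (hf : ∀ x, (f x).length = 2 * n) (L : List ℕ) :
    pairSum (L.flatMap f) = L.flatMap fun x => pairSum (f x) := by
  induction L with
  | nil => simp [pairSum]
  | cons a L ih => rw [List.flatMap_cons, pairSum_append n _ _ (hf a), ih, List.flatMap_cons]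

/-- The binary digits of a number below `2 ^ 64`. -/
def bits (x : ℕ) : List ℕ := (List.range 64).map fun i => (x.testBit i).toNat

theorem bits_lt (x : ℕ) : ∀ d ∈ bits x, d < 2 ^ 1 := by
  intro d hd
  obtain ⟨i, -, rfl⟩ := List.mem_map.1 hd
  exact Bool.toNat_lt _

theorem ofDigits_testBit (n x : ℕ) :
    Nat.ofDigits 2 ((List.range n).map fun i => (x.testBit i).toNat) = x % 2 ^ n := by
  induction n with
  | zero => simp [Nat.mod_one]
  | succ n ih =>
    rw [List.range_succ, List.map_append, Nat.ofDigits_append, ih]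
    simp only [List.length_map, List.length_range, List.map_cons, List.map_nil,
      Nat.ofDigits_singleton]
    rw [Nat.mod_pow_succ, Nat.toNat_testBit]

theorem ofDigits_bits {L : List ℕ} (hL : ∀ x ∈ L, x < 2 ^ 64) :
    Nat.ofDigits (2 ^ 1) (L.flatMap bits) = Nat.ofDigits (2 ^ 64) L := by
  induction L with
  | nil => simp
  | cons a L ih =>
    simp only [List.mem_cons, forall_eq_or_imp] at hL
    rw [List.flatMap_cons, Nat.ofDigits_append, ih hL.2, Nat.ofDigits_cons, pow_one, bits,
      ofDigits_testBit, Nat.mod_eq_of_lt hL.1]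
    simp

/-- Six rounds, with fields of width 1, 2, 4, …, 32, reduce the 64 binary digits of each lane to one
digit, their sum. Before each round every lane consists of an even number of fields, so lanes are
never mixed. -/
theorem lanePop_ofDigits {k : ℕ} {L : List ℕ} (hk : L.length = k) (hL : ∀ x ∈ L, x < 2 ^ 64) :
    lanePop k (Nat.ofDigits (2 ^ 64) L) = Nat.ofDigits (2 ^ 64) (L.map popcount) := by
  have len : ∀ {f : ℕ → List ℕ} {n : ℕ}, (∀ x, (f x).length = n) → (L.flatMap f).length = n * k := by
    intro f n hf
    simp [List.length_flatMap, hf, hk, mul_comm]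
  have mem : ∀ {f : ℕ → List ℕ} {c : ℕ}, (∀ x, ∀ d ∈ f x, d < c) → ∀ d ∈ L.flatMap f, d < c := by
    intro f c hf d hd
    obtain ⟨x, -, h⟩ := List.mem_flatMap.1 hd
    exact hf x d h
  -- The invariant of the rounds: lane `x` has 2n digits below 2 ^ s with sum `popcount x`; a round
  -- halves their number and doubles their width.
  have key : ∀ (s t n : ℕ) (f : ℕ → List ℕ), t = 2 * s → 1 ≤ s → s * (2 * n) = 64 →
      (∀ x, (f x).length = 2 * n ∧ (∀ d ∈ f x, d < 2 ^ s) ∧ (f x).sum = popcount x) →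
      addFields s k (Nat.ofDigits (2 ^ s) (L.flatMap f)) =
        Nat.ofDigits (2 ^ t) (L.flatMap fun x => pairSum (f x)) ∧
      ∀ x, (pairSum (f x)).length = n ∧ (∀ d ∈ pairSum (f x), d < 2 ^ t) ∧
        (pairSum (f x)).sum = popcount x := by
    rintro s t n f rfl hs hn hf
    refine ⟨?_, fun x => ?_⟩
    · rw [addFields_pairSum hs (n := n * k)
        (by rw [len fun x => (hf x).1]; ring) (by rw [← hn]; ring) (mem fun x => (hf x).2.1),
        pairSum_flatMap fun x => (hf x).1]
    · obtain ⟨h1, h2, h3, -⟩ := pairSum_spec hs n (f x) (hf x).1 (hf x).2.1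
      exact ⟨h1, h3, h2.trans (hf x).2.2⟩
  rw [← ofDigits_bits hL, lanePop]
  obtain ⟨e1, h1⟩ := key 1 2 32 bits rfl le_rfl rfl fun x => ⟨by simp [bits], bits_lt x, rfl⟩
  obtain ⟨e2, h2⟩ := key 2 4 16 _ rfl (by norm_num) rfl h1
  obtain ⟨e3, h3⟩ := key 4 8 8 _ rfl (by norm_num) rfl h2
  obtain ⟨e4, h4⟩ := key 8 16 4 _ rfl (by norm_num) rfl h3
  obtain ⟨e5, h5⟩ := key 16 32 2 _ rfl (by norm_num) rfl h4
  obtain ⟨e6, h6⟩ := key 32 64 1 _ rfl (by norm_num) rfl h5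
  rw [e1, e2, e3, e4, e5, e6]
  have hlast : (fun x => pairSum (pairSum (pairSum (pairSum (pairSum (pairSum (bits x))))))) =
      fun x => [popcount x] := by
    funext x
    obtain ⟨hl, -, hs⟩ := h6 x
    obtain ⟨y, hy⟩ := List.length_eq_one_iff.1 hl
    rw [hy] at hs ⊢
    simpa using hs
  rw [hlast, List.map_eq_flatMap]

theorem popcount_le (x : ℕ) : popcount x ≤ 64 := by
  refine (List.sum_le_card_nsmul _ 1 ?_).trans (by simp)
  intro d hd
  obtain ⟨i, -, rfl⟩ := List.mem_map.1 hd
  exact Bool.toNat_le _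

/-! ### Exclusive ors of the subsets of the rows -/

/-- The exclusive ors of the `j`-element subfamilies of `r 0, …, r (m - 1)`. -/
def subsetXors (r : ℕ → ℕ) : ℕ → ℕ → List ℕ
  | 0, _ => [0]
  | _ + 1, 0 => []
  | j + 1, m + 1 => subsetXors r (j + 1) m ++ (subsetXors r j m).map fun x => x ^^^ r m

theorem length_subsetXors (r : ℕ → ℕ) : ∀ j m, (subsetXors r j m).length = m.choose j
  | 0, _ => by simp [subsetXors]
  | _ + 1, 0 => by simp [subsetXors]
  | j + 1, m + 1 => by
    simp [subsetXors, length_subsetXors r (j + 1) m, length_subsetXors r j m,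
      Nat.choose_succ_succ, add_comm]

theorem subsetXors_lt {r : ℕ → ℕ} {w : ℕ} (hr : ∀ i, r i < 2 ^ w) :
    ∀ j m, ∀ x ∈ subsetXors r j m, x < 2 ^ w
  | 0, _ => by simp [subsetXors]
  | _ + 1, 0 => by simp [subsetXors]
  | j + 1, m + 1 => by
    intro x hx
    simp only [subsetXors, List.mem_append, List.mem_map] at hx
    obtain hx | ⟨y, hy, rfl⟩ := hx
    · exact subsetXors_lt hr _ _ x hx
    · exact Nat.xor_lt_two_pow (subsetXors_lt hr _ _ y hy) (hr m)

/-- Number of pairs, in a form that the kernel evaluates with few steps. -/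
def pairCount (m : ℕ) : ℕ := Nat.div (Nat.mul m (Nat.sub m 1)) 2

/-- Number of triples, in a form that the kernel evaluates with few steps. -/
def tripleCount (m : ℕ) : ℕ := Nat.div (Nat.mul (Nat.mul m (Nat.sub m 1)) (Nat.sub m 2)) 6

/-- Exclusive or of each of the `k` lanes of `X` with `r m`. -/
def xorLanes (r : ℕ → ℕ) (m k X : ℕ) : ℕ := Nat.xor X (Nat.mul (r m) (laneOnes k))

/-- The lanes `r 0, …, r (m - 1)`. -/
def singles (r : ℕ → ℕ) (m : ℕ) : ℕ :=
  Nat.rec 0 (fun m e => Nat.add e (Nat.shiftLeft (r m) (Nat.mul 64 m))) m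

/-- The exclusive ors of pairs, as lanes. -/
def pairs (r : ℕ → ℕ) (m : ℕ) : ℕ :=
  Nat.rec 0 (fun m e => Nat.add e
    (Nat.shiftLeft (xorLanes r m m (singles r m)) (Nat.mul 64 (pairCount m)))) m

/-- The exclusive ors of triples, as lanes. -/
def triples (r : ℕ → ℕ) (m : ℕ) : ℕ :=
  Nat.rec 0 (fun m e => Nat.add e
    (Nat.shiftLeft (xorLanes r m (pairCount m) (pairs r m)) (Nat.mul 64 (tripleCount m)))) m

theorem pairCount_eq (m : ℕ) : pairCount m = m.choose 2 := (Nat.choose_two_right m).symm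

theorem tripleCount_eq (m : ℕ) : tripleCount m = m.choose 3 := by
  rw [Nat.choose_eq_descFactorial_div_factorial]
  change m * (m - 1) * (m - 2) / 6 = _
  simp only [Nat.descFactorial_succ, Nat.descFactorial_zero, Nat.factorial]
  congr 1
  simp
  ring

section rows

variable {r : ℕ → ℕ}

theorem xorLanes_ofDigits {m k : ℕ} {L : List ℕ} (hr : ∀ i, r i < 2 ^ 64) (hk : L.length = k)
    (hL : ∀ x ∈ L, x < 2 ^ 64) :
    xorLanes r m k (Nat.ofDigits (2 ^ 64) L) = Nat.ofDigits (2 ^ 64) (L.map fun x => x ^^^ r m) := by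
  change Nat.ofDigits (2 ^ 64) L ^^^ (r m * laneOnes k) = _
  rw [mul_laneOnes (r m) hk]
  simpa using ofDigits_xor_map (w := 64) (L := L) (f := fun x => x) (g := fun _ => r m) hL
    fun _ _ => hr m

/-- `subsetXors` lists the subsets according to their largest index. Passing from m to m + 1
therefore only appends lanes at the top, shifted by the number of lanes already present; the same
holds for `pairs` and `triples`. -/
theorem singles_eq (m : ℕ) :
    singles r m = Nat.ofDigits (2 ^ 64) (subsetXors r 1 m) := by
  induction m with
  | zero => simp [singles, subsetXors]
  | succ m ih =>
    change singles r m + (r m) <<< (64 * m) = _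
    simp only [subsetXors, Nat.ofDigits_append, length_subsetXors, ← ih, zero_add, Nat.choose_one_right,
      List.map_cons, List.map_nil, Nat.ofDigits_singleton, Nat.zero_xor, Nat.shiftLeft_eq, pow_mul]
    ring

theorem pairs_eq (hr : ∀ i, r i < 2 ^ 64) (m : ℕ) :
    pairs r m = Nat.ofDigits (2 ^ 64) (subsetXors r 2 m) := by
  induction m with
  | zero => simp [pairs, subsetXors]
  | succ m ih =>
    change pairs r m + (xorLanes r m m (singles r m)) <<< (64 * pairCount m) = _
    rw [singles_eq, xorLanes_ofDigits hr (by simp [length_subsetXors]) (subsetXors_lt hr _ _), ih,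
      subsetXors, Nat.ofDigits_append, length_subsetXors, Nat.shiftLeft_eq, pairCount_eq, pow_mul,
      mul_comm (Nat.ofDigits _ _)]

theorem triples_eq (hr : ∀ i, r i < 2 ^ 64) (m : ℕ) :
    triples r m = Nat.ofDigits (2 ^ 64) (subsetXors r 3 m) := by
  induction m with
  | zero => simp [triples, subsetXors]
  | succ m ih =>
    change triples r m + (xorLanes r m (pairCount m) (pairs r m)) <<< (64 * tripleCount m) = _
    rw [pairs_eq hr, xorLanes_ofDigits hr (by simp [length_subsetXors, pairCount_eq])
      (subsetXors_lt hr _ _), ih, subsetXors, Nat.ofDigits_append, length_subsetXors,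
      Nat.shiftLeft_eq, tripleCount_eq, pow_mul, mul_comm (Nat.ofDigits _ _)]

/-! ### Scores of the quadruples of rows -/

/-- Bits `2` and `3` of `w`, flipped if bit `5` is set. -/
def foldWeight (w : ℕ) : ℕ := (w &&& 12) ^^^ (3 * ((w &&& 32) / 8))

/-- The score of a quadruple of rows whose exclusive or has population count `w`. -/
def score (w : ℕ) : ℕ := (foldWeight w &&& 4) + 1048576 * (foldWeight w &&& 8)

/-- `foldWeight` on all lanes. -/
def foldLanes (k X : ℕ) : ℕ :=
  Nat.xor (Nat.land X (Nat.mul 12 (laneOnes k)))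
    (Nat.mul 3 (Nat.shiftRight (Nat.land X (Nat.mul 32 (laneOnes k))) 3))

/-- The sum of `score` over all lanes, given the folded weights. -/
def sumLanes (k X : ℕ) : ℕ :=
  Nat.mod (Nat.add (Nat.land X (Nat.mul 4 (laneOnes k)))
    (Nat.mul 1048576 (Nat.land X (Nat.mul 8 (laneOnes k))))) 18446744073709551615

/-- All lanes are divisible by `4`. -/
def lanesDvd (k X : ℕ) : Bool := Nat.beq (Nat.land X (Nat.mul 3 (laneOnes k))) 0

/-- The weights of the quadruples of rows with largest row `m`. -/
def quadWeights (r : ℕ → ℕ) (m : ℕ) : ℕ :=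
  lanePop (tripleCount m) (xorLanes r m (tripleCount m) (triples r m))

/-- The total score of the quadruples of rows with largest row `m`. -/
def quadScore (r : ℕ → ℕ) (m : ℕ) : ℕ :=
  sumLanes (tripleCount m) (foldLanes (tripleCount m) (quadWeights r m))

/-- The total score of the quadruples of the first `m` rows. -/
def totalScore (r : ℕ → ℕ) (m : ℕ) : ℕ := Nat.rec 0 (fun m a => Nat.add a (quadScore r m)) m

/-- All quadruples of the first `m` rows have weights divisible by `4`. -/
def weightsDvd (r : ℕ → ℕ) (m : ℕ) : Bool :=
  Nat.rec true (fun m a => and a (lanesDvd (tripleCount m) (quadWeights r m))) m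

theorem quadWeights_eq (hr : ∀ i, r i < 2 ^ 64) (m : ℕ) :
    quadWeights r m =
      Nat.ofDigits (2 ^ 64) ((subsetXors r 3 m).map fun x => popcount (x ^^^ r m)) := by
  rw [quadWeights, triples_eq hr, xorLanes_ofDigits hr
    (by simp [length_subsetXors, tripleCount_eq]) (subsetXors_lt hr _ _),
    lanePop_ofDigits (by simp [length_subsetXors, tripleCount_eq]), List.map_map]
  · rfl
  · intro x hx
    obtain ⟨y, hy, rfl⟩ := List.mem_map.1 hx
    exact Nat.xor_lt_two_pow (subsetXors_lt hr _ _ y hy) (hr m)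

theorem land_mul_laneOnes {k c : ℕ} {α : Type*} {L : List α} {f : α → ℕ} (hk : L.length = k)
    (hc : c < 2 ^ 64) (hf : ∀ x ∈ L, f x < 2 ^ 64) :
    Nat.land (Nat.ofDigits (2 ^ 64) (L.map f)) (Nat.mul c (laneOnes k)) =
      Nat.ofDigits (2 ^ 64) (L.map fun x => f x &&& c) := by
  change Nat.ofDigits (2 ^ 64) (L.map f) &&& (c * laneOnes k) = _
  rw [mul_laneOnes c hk]
  exact ofDigits_land_map hf fun _ _ => hc

theorem foldWeight_lt {w : ℕ} : foldWeight w < 2 ^ 4 := by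
  refine Nat.xor_lt_two_pow (Nat.and_lt_two_pow _ (by norm_num)) ?_
  have : w &&& 32 ≤ 32 := Nat.and_le_right
  omega

theorem foldLanes_ofDigits {k : ℕ} {α : Type*} {L : List α} {f : α → ℕ} (hk : L.length = k)
    (hf : ∀ x ∈ L, f x < 2 ^ 64) :
    foldLanes k (Nat.ofDigits (2 ^ 64) (L.map f)) =
      Nat.ofDigits (2 ^ 64) (L.map fun x => foldWeight (f x)) := by
  rw [foldLanes, land_mul_laneOnes hk (by norm_num) hf, land_mul_laneOnes hk (by norm_num) hf]
  -- After masking, each lane is 0 or 32, so shifting the whole number by 3 places divides every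
  -- lane by 8 and no bit crosses a lane boundary.
  have h8 : ∀ w : ℕ, w &&& 32 = 8 * ((w &&& 32) / 8) := by
    intro w
    have : w &&& 32 = 2 ^ 5 * (w.testBit 5).toNat := by
      simpa [mul_comm] using Nat.and_two_pow w 5
    rw [this]
    omega
  have hs : Nat.shiftRight (Nat.ofDigits (2 ^ 64) (L.map fun x => f x &&& 32)) 3 =
      Nat.ofDigits (2 ^ 64) (L.map fun x => (f x &&& 32) / 8) := by
    change _ >>> 3 = _
    rw [Nat.shiftRight_eq_div_pow]
    conv_lhs => enter [1, 2, 1, x]; rw [h8]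
    rw [← mul_ofDigits_map]
    exact Nat.mul_div_cancel_left _ (by norm_num)
  rw [hs]
  change _ ^^^ (3 * _) = _
  rw [mul_ofDigits_map]
  refine ofDigits_xor_map (fun x _ => Nat.and_lt_two_pow _ (by norm_num)) fun x _ => ?_
  have : f x &&& 32 ≤ 32 := Nat.and_le_right
  omega

/-- The bound is 4 + 2 ^ 20 · 8. A score packs two indicators, with weights 4 and 2 ^ 23. Over all
487635 quadruples the lower part adds up to less than 2 ^ 23, so a total score determines both
counts. -/
theorem score_le (w : ℕ) : score w ≤ 8388612 := by
  have h1 : foldWeight w &&& 4 ≤ 4 := Nat.and_le_right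
  have h2 : foldWeight w &&& 8 ≤ 8 := Nat.and_le_right
  unfold score
  omega

/-- With fewer than 2 ^ 40 lanes the sum of the scores stays below 2 ^ 64 − 1, so the remainder
modulo 2 ^ 64 − 1 is the sum itself. -/
theorem sumLanes_ofDigits {k : ℕ} {α : Type*} {L : List α} {f : α → ℕ} (hk : L.length = k)
    (hk' : k < 2 ^ 40) :
    sumLanes k (Nat.ofDigits (2 ^ 64) (L.map fun x => foldWeight (f x))) =
      (L.map fun x => score (f x)).sum := by
  have hf : ∀ x ∈ L, foldWeight (f x) < 2 ^ 64 := fun x _ => foldWeight_lt.trans (by norm_num)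
  rw [sumLanes, land_mul_laneOnes hk (by norm_num) hf, land_mul_laneOnes hk (by norm_num) hf]
  change (_ + 1048576 * _) % 18446744073709551615 = _
  rw [mul_ofDigits_map, ofDigits_add_map]
  have h := ofDigits_modEq_sum (2 ^ 64) (L.map fun x => score (f x)) (by positivity)
  have hlt : (L.map fun x => score (f x)).sum < 18446744073709551615 := by
    have := List.sum_le_card_nsmul (L.map fun x => score (f x)) 8388612 (by
      intro d hd
      obtain ⟨x, -, rfl⟩ := List.mem_map.1 hd
      exact score_le _)
    simp only [List.length_map, hk, smul_eq_mul] at this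
    omega
  exact Eq.trans h (Nat.mod_eq_of_lt hlt)

theorem quadScore_eq (hr : ∀ i, r i < 2 ^ 64) {m : ℕ} (hm : m ≤ 60) :
    quadScore r m = ((subsetXors r 3 m).map fun x => score (popcount (x ^^^ r m))).sum := by
  have hlen : (subsetXors r 3 m).length = tripleCount m := by
    rw [length_subsetXors, tripleCount_eq]
  rw [quadScore, quadWeights_eq hr, foldLanes_ofDigits hlen, sumLanes_ofDigits hlen]
  · rw [tripleCount_eq]
    calc m.choose 3 ≤ Nat.choose 60 3 := Nat.choose_le_choose 3 hm
      _ < 2 ^ 40 := by decide +kernel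
  · exact fun x _ => (popcount_le _).trans_lt (by norm_num)

theorem lanesDvd_spec (hr : ∀ i, r i < 2 ^ 64) {m : ℕ}
    (h : lanesDvd (tripleCount m) (quadWeights r m) = true) :
    ∀ x ∈ subsetXors r 3 m, popcount (x ^^^ r m) % 4 = 0 := by
  have hlen : (subsetXors r 3 m).length = tripleCount m := by
    rw [length_subsetXors, tripleCount_eq]
  rw [lanesDvd, quadWeights_eq hr, land_mul_laneOnes hlen (by norm_num)
    fun x _ => (popcount_le _).trans_lt (by norm_num)] at h
  intro x hx
  have := eq_zero_of_ofDigits_eq_zero (by positivity) (Nat.eq_of_beq_eq_true h) _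
    (List.mem_map_of_mem hx)
  rwa [show (3 : ℕ) = 2 ^ 2 - 1 from rfl, Nat.and_two_pow_sub_one_eq_mod] at this

theorem totalScore_eq (hr : ∀ i, r i < 2 ^ 64) {m : ℕ} (hm : m ≤ 60) :
    totalScore r m = ((subsetXors r 4 m).map fun x => score (popcount x)).sum := by
  induction m with
  | zero => simp [totalScore, subsetXors]
  | succ m ih =>
    change totalScore r m + quadScore r m = _
    rw [ih (by omega), quadScore_eq hr (by omega), subsetXors, List.map_append, List.sum_append,
      List.map_map]
    rfl

/-- Divisibility by 4 holds for any four rows of a Hadamard matrix of order 60; here it is read off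
from the computation. It is needed because `score` looks only at bits 2, 3 and 5 of the weight. -/
theorem weightsDvd_spec (hr : ∀ i, r i < 2 ^ 64) {m : ℕ} (h : weightsDvd r m = true) :
    ∀ x ∈ subsetXors r 4 m, popcount x % 4 = 0 := by
  induction m with
  | zero => simp [subsetXors]
  | succ m ih =>
    obtain ⟨h1, h2⟩ := (Bool.and_eq_true _ _).mp h
    intro x hx
    simp only [subsetXors, List.mem_append, List.mem_map] at hx
    obtain hx | ⟨y, hy, rfl⟩ := hx
    · exact ih h1 x hx
    · exact lanesDvd_spec hr h2 y hy

/-- All pairs of the first `m` rows have distance `30`. -/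
def pairsBalanced (r : ℕ → ℕ) (m : ℕ) : Bool :=
  Nat.beq (lanePop (pairCount m) (pairs r m)) (Nat.mul 30 (laneOnes (pairCount m)))

theorem pairsBalanced_spec (hr : ∀ i, r i < 2 ^ 64) {m : ℕ} (h : pairsBalanced r m = true) :
    ∀ x ∈ subsetXors r 2 m, popcount x = 30 := by
  have hlen : (subsetXors r 2 m).length = pairCount m := by
    rw [length_subsetXors, pairCount_eq]
  have h := Nat.eq_of_beq_eq_true h
  change _ = 30 * laneOnes _ at h
  rw [pairs_eq hr, lanePop_ofDigits hlen (subsetXors_lt hr _ _), mul_laneOnes 30 hlen] at h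
  have := Nat.ofDigits_inj_of_len_eq (b := 2 ^ 64) (by norm_num) (by simp)
    (fun d hd => by
      obtain ⟨x, -, rfl⟩ := List.mem_map.1 hd
      exact (popcount_le x).trans_lt (by norm_num))
    (fun d hd => by
      obtain ⟨x, -, rfl⟩ := List.mem_map.1 hd
      norm_num) h
  exact fun x hx => List.map_inj_left.1 this x hx

theorem mem_subsetXors_two {i m : ℕ} (j : ℕ) (hij : i < j) (hj : j < m) :
    r i ^^^ r j ∈ subsetXors r 2 m := by
  have h1 : ∀ n, i < n → r i ∈ subsetXors r 1 n := by
    intro n hn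
    induction n, hn using Nat.le_induction with
    | base => simp [subsetXors]
    | succ n _ ih => simp [subsetXors, ih]
  induction m, hj using Nat.le_induction with
  | base =>
    simp only [subsetXors, List.mem_append, List.mem_map]
    exact Or.inr ⟨_, h1 j hij, rfl⟩
  | succ n _ ih =>
    simp only [subsetXors, List.mem_append]
    exact Or.inl ih

end rows

/-! ### The scores as invariants of Hadamard equivalence -/

/-- The sign encoded by the bit `c` of `x`. -/
def bitSign (x c : ℕ) : ℤˣ := if x.testBit c then -1 else 1

theorem bitSign_zero (c : ℕ) : bitSign 0 c = 1 := by simp [bitSign]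

theorem bitSign_xor (x y c : ℕ) : bitSign (x ^^^ y) c = bitSign x c * bitSign y c := by
  unfold bitSign
  rw [Nat.testBit_xor]
  cases x.testBit c <;> cases y.testBit c <;> simp

/-- The sum of the entrywise product of the rows in `s`. -/
def rowSum (H : Matrix (Fin 60) (Fin 60) ℤ) (s : Finset (Fin 60)) : ℤ := ∑ c, ∏ i ∈ s, H i c

/-- The score of a quadruple of rows whose entrywise product has a sum of absolute value `p`. -/
def absScore (p : ℕ) : ℕ := score ((60 - p) / 2)

/-- The sum of the scores of all quadruples of rows. -/
def fourScore (H : Matrix (Fin 60) (Fin 60) ℤ) : ℕ :=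
  ∑ s ∈ Finset.powersetCard 4 Finset.univ, absScore (rowSum H s).natAbs

/-- The sum of the scores of all quadruples of rows containing the row `i`. -/
def localScore (H : Matrix (Fin 60) (Fin 60) ℤ) (i : Fin 60) : ℕ :=
  ∑ s ∈ Finset.powersetCard 4 Finset.univ with i ∈ s, absScore (rowSum H s).natAbs

theorem signedPerm_mul_apply {N : ℕ} (σ : Equiv.Perm (Fin N)) (ε : Fin N → ℤˣ)
    (A : Matrix (Fin N) (Fin N) ℤ) (i j : Fin N) :
    (signedPerm σ ε * A) i j = (ε i : ℤ) * A (σ i) j := by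
  rw [Matrix.mul_apply, Finset.sum_eq_single (σ i)]
  · simp [signedPerm]
  · intro k _ hk
    simp [signedPerm, hk.symm]
  · simp

theorem mul_signedPerm_apply {N : ℕ} (σ : Equiv.Perm (Fin N)) (ε : Fin N → ℤˣ)
    (A : Matrix (Fin N) (Fin N) ℤ) (i j : Fin N) :
    (A * signedPerm σ ε) i (σ j) = A i j * (ε j : ℤ) := by
  rw [Matrix.mul_apply, Finset.sum_eq_single j]
  · simp [signedPerm]
  · intro k _ hk
    simp [signedPerm, hk]
  · simp

theorem hadamardEquivalent_iff {N : ℕ} {A B : Matrix (Fin N) (Fin N) ℤ} :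
    HadamardEquivalent A B ↔ ∃ (σ τ : Equiv.Perm (Fin N)) (ε δ : Fin N → ℤˣ),
      ∀ i j, B i (τ j) = ε i * A (σ i) j * δ j := by
  constructor
  · rintro ⟨_, _, ⟨σ, ε, rfl⟩, ⟨τ, δ, rfl⟩, rfl⟩
    refine ⟨σ, τ, ε, δ, fun i j => ?_⟩
    rw [mul_signedPerm_apply, signedPerm_mul_apply]
  · rintro ⟨σ, τ, ε, δ, h⟩
    refine ⟨_, _, ⟨σ, ε, rfl⟩, ⟨τ, δ, rfl⟩, ?_⟩
    ext i j
    obtain ⟨j, rfl⟩ := τ.surjective j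
    rw [mul_signedPerm_apply, signedPerm_mul_apply, h]

/-- In a product of four rows each column sign occurs to the fourth power and disappears. The row
signs leave one global sign, which the absolute value removes, and the column permutation only
reorders the sum. -/
theorem natAbs_rowSum {A B : Matrix (Fin 60) (Fin 60) ℤ} {σ τ : Equiv.Perm (Fin 60)}
    {ε δ : Fin 60 → ℤˣ} (h : ∀ i j, B i (τ j) = ε i * A (σ i) j * δ j) {s : Finset (Fin 60)}
    (hs : s.card = 4) : (rowSum B s).natAbs = (rowSum A (s.map σ.toEmbedding)).natAbs := by
  have : rowSum B s = ((∏ i ∈ s, ε i : ℤˣ) : ℤ) * rowSum A (s.map σ.toEmbedding) := by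
    rw [rowSum, ← Equiv.sum_comp τ, rowSum, Finset.mul_sum]
    refine Finset.sum_congr rfl fun c _ => ?_
    have h4 : ((δ c : ℤˣ) : ℤ) ^ 4 = 1 := by
      rcases Int.units_eq_one_or (δ c) with h | h <;> simp [h]
    simp [h, Finset.prod_mul_distrib, hs, h4, Units.coe_prod]
  rw [this, Int.natAbs_mul, Int.units_natAbs, one_mul]

theorem fourScore_eq_of_hadamardEquivalent {A B : Matrix (Fin 60) (Fin 60) ℤ}
    (h : HadamardEquivalent A B) : fourScore A = fourScore B := by
  obtain ⟨σ, τ, ε, δ, h⟩ := hadamardEquivalent_iff.1 h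
  unfold fourScore
  symm
  refine Finset.sum_equiv (Equiv.finsetCongr σ) (by simp [Finset.mem_powersetCard]) ?_
  intro s hs
  rw [natAbs_rowSum h (Finset.mem_powersetCard.1 hs).2]
  rfl

theorem localScore_apply {A B : Matrix (Fin 60) (Fin 60) ℤ} {σ τ : Equiv.Perm (Fin 60)}
    {ε δ : Fin 60 → ℤˣ} (h : ∀ i j, B i (τ j) = ε i * A (σ i) j * δ j) (i : Fin 60) :
    localScore B i = localScore A (σ i) := by
  unfold localScore
  refine Finset.sum_equiv (Equiv.finsetCongr σ) (by simp [Finset.mem_powersetCard]) ?_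
  intro s hs
  rw [natAbs_rowSum h (Finset.mem_powersetCard.1 (Finset.mem_filter.1 hs).1).2]
  rfl

/-- Thus the multiset of local scores is an invariant. It refines `fourScore`, since the local
scores add up to four times that number. -/
theorem localScore_eq_of_hadamardEquivalent {A B : Matrix (Fin 60) (Fin 60) ℤ}
    (h : HadamardEquivalent A B) :
    ∃ σ : Equiv.Perm (Fin 60), ∀ i, localScore A (σ i) = localScore B i := by
  obtain ⟨σ, τ, ε, δ, h⟩ := hadamardEquivalent_iff.1 h
  exact ⟨σ, fun i => (localScore_apply h i).symm⟩

/-! ### Computation of the scores -/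

/-- The sum of the signs encoded by the first `60` bits of `x`. -/
def signSum (x : ℕ) : ℤ := ∑ c ∈ Finset.range 60, ((bitSign x c : ℤˣ) : ℤ)

theorem signSum_eq {x : ℕ} (hx : x < 2 ^ 60) : signSum x = 60 - 2 * (popcount x : ℤ) := by
  have h : ∀ n : ℕ, ∑ c ∈ Finset.range n, ((bitSign x c : ℤˣ) : ℤ) =
      n - 2 * ((((List.range n).map fun i => (x.testBit i).toNat).sum : ℕ) : ℤ) := by
    intro n
    induction n with
    | zero => simp
    | succ n ih =>
      rw [Finset.sum_range_succ, ih, List.range_succ, List.map_append, List.sum_append]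
      cases hb : x.testBit n <;> simp [bitSign, hb] <;> ring
  have h64 : popcount x = ((List.range 60).map fun i => (x.testBit i).toNat).sum := by
    have hz : ∀ i, 60 ≤ i → x.testBit i = false := fun i hi =>
      Nat.testBit_lt_two_pow (hx.trans_le (Nat.pow_le_pow_right two_pos hi))
    rw [popcount, show 64 = 60 + 1 + 1 + 1 + 1 from rfl]
    simp only [List.range_succ (n := 60), List.range_succ (n := 60 + 1),
      List.range_succ (n := 60 + 1 + 1), List.range_succ (n := 60 + 1 + 1 + 1)]
    simp [hz]
  rw [h64]
  exact h 60

theorem popcount_le_sixty {x : ℕ} (hx : x < 2 ^ 60) : popcount x ≤ 60 := by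
  have h := signSum_eq hx
  have h1 : -60 ≤ signSum x := by
    have : ∑ c ∈ Finset.range 60, (-1 : ℤ) ≤ signSum x := Finset.sum_le_sum fun c _ => by
      rcases Int.units_eq_one_or (bitSign x c) with h | h <;> simp [h]
    simpa using this
  omega

/-- Negating the sum replaces the weight w by 60 − w. As 60 is 111100 in binary and w is a multiple
of 4, this complements bits 2 to 5. Flipping bits 2 and 3 whenever bit 5 is set therefore makes the
score a function of the absolute value |60 − 2w|. -/
theorem absScore_signSum {x : ℕ} (hx : x < 2 ^ 60) (h4 : popcount x % 4 = 0) :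
    absScore (signSum x).natAbs = score (popcount x) := by
  have key : ∀ w : ℕ, w < 61 → w % 4 = 0 → absScore (60 - 2 * (w : ℤ)).natAbs = score w := by
    decide +kernel
  rw [signSum_eq hx]
  exact key _ (Nat.lt_succ_of_le (popcount_le_sixty hx)) h4

/-- The parameter `y` is the exclusive or of rows already chosen. It makes the induction on `m`
work: subsets containing the row `m` are treated by the induction hypothesis with `r m` absorbed
into `y`. -/
theorem sum_powersetCard_eq (r : ℕ → ℕ) (j m y : ℕ) :
    ∑ s ∈ Finset.powersetCard j (Finset.range m), absScore
      (∑ c ∈ Finset.range 60, ((bitSign y c * ∏ i ∈ s, bitSign (r i) c : ℤˣ) : ℤ)).natAbs =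
      ((subsetXors r j m).map fun x => absScore (signSum (x ^^^ y)).natAbs).sum := by
  induction m generalizing j y with
  | zero =>
    cases j with
    | zero => simp [subsetXors, signSum]
    | succ j => simp [subsetXors]
  | succ m ih =>
    cases j with
    | zero => simp [subsetXors, signSum]
    | succ j =>
      have hm : m ∉ Finset.range m := Finset.notMem_range_self
      have hmem : ∀ s ∈ Finset.powersetCard j (Finset.range m), m ∉ s := fun s hs hms =>
        hm ((Finset.mem_powersetCard.1 hs).1 hms)
      rw [Finset.range_add_one, Finset.powersetCard_succ_insert hm, Finset.sum_union, ih,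
        Finset.sum_image, subsetXors, List.map_append, List.sum_append, List.map_map]
      · congr 1
        rw [Finset.sum_congr rfl fun s hs => by rw [Finset.sum_congr rfl fun c _ => by
          rw [Finset.prod_insert (hmem s hs), ← mul_assoc, ← bitSign_xor]], ih]
        simp [Function.comp_def, Nat.xor_comm, Nat.xor_left_comm]
      · intro s hs t ht hst
        rw [← Finset.erase_insert (hmem s hs), ← Finset.erase_insert (hmem t ht), hst]
      · rw [Finset.disjoint_left]
        intro s hs hs'
        obtain ⟨t, -, rfl⟩ := Finset.mem_image.1 hs'
        exact hm ((Finset.mem_powersetCard.1 hs).1 (Finset.mem_insert_self m t))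

/-- Removing the largest row `m` turns the subsets that contain it into the smaller subsets of the
rows before it. This is why the local score of the last row is the last summand of the total score.
-/
theorem sum_powersetCard_insert_eq (r : ℕ → ℕ) (j m : ℕ) :
    ∑ s ∈ Finset.powersetCard (j + 1) (Finset.range (m + 1)) with m ∈ s, absScore
      (∑ c ∈ Finset.range 60, ((∏ i ∈ s, bitSign (r i) c : ℤˣ) : ℤ)).natAbs =
      ((subsetXors r j m).map fun x => absScore (signSum (x ^^^ r m)).natAbs).sum := by
  have hm : m ∉ Finset.range m := Finset.notMem_range_self
  have hmem : ∀ s ∈ Finset.powersetCard j (Finset.range m), m ∉ s := fun s hs hms =>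
    hm ((Finset.mem_powersetCard.1 hs).1 hms)
  have hfil : (Finset.powersetCard (j + 1) (Finset.range (m + 1))).filter (m ∈ ·) =
      (Finset.powersetCard j (Finset.range m)).image (insert m) := by
    rw [Finset.range_add_one, Finset.powersetCard_succ_insert hm, Finset.filter_union,
      Finset.filter_false_of_mem, Finset.filter_true_of_mem, Finset.empty_union]
    · intro s hs
      obtain ⟨t, -, rfl⟩ := Finset.mem_image.1 hs
      exact Finset.mem_insert_self m t
    · exact fun s hs hms => hm ((Finset.mem_powersetCard.1 hs).1 hms)
  rw [hfil, Finset.sum_image, ← sum_powersetCard_eq]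
  · refine Finset.sum_congr rfl fun s hs => ?_
    rw [Finset.sum_congr rfl fun c _ => by rw [Finset.prod_insert (hmem s hs)]]
  · intro s hs t ht hst
    rw [← Finset.erase_insert (hmem s hs), ← Finset.erase_insert (hmem t ht), hst]

theorem powersetCard_range_eq (j : ℕ) :
    Finset.powersetCard j (Finset.range 60) =
      (Finset.powersetCard j (Finset.univ : Finset (Fin 60))).map
        (Finset.mapEmbedding Fin.valEmbedding).toEmbedding := by
  rw [← Finset.powersetCard_map]
  congr 1

/-! ### Scores and orthogonality of a matrix given by the bits of its rows -/

section matrix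

variable {H : Matrix (Fin 60) (Fin 60) ℤ} {r : ℕ → ℕ}

theorem rowSum_eq (hH : ∀ i j : Fin 60, H i j = (bitSign (r i) j : ℤˣ)) (s : Finset (Fin 60)) :
    rowSum H s = ∑ c ∈ Finset.range 60,
      ((∏ i ∈ s.map Fin.valEmbedding, bitSign (r i) c : ℤˣ) : ℤ) := by
  rw [Finset.sum_range, rowSum]
  simp [hH, Units.coe_prod]

theorem fourScore_eq (hr : ∀ i, r i < 2 ^ 60) (hH : ∀ i j : Fin 60, H i j = (bitSign (r i) j : ℤˣ))
    (hd : weightsDvd r 60 = true) : fourScore H = totalScore r 60 := by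
  have hr' : ∀ i, r i < 2 ^ 64 := fun i => (hr i).trans (by norm_num)
  have h := sum_powersetCard_eq r 4 60 0
  rw [powersetCard_range_eq, Finset.sum_map] at h
  rw [totalScore_eq hr' le_rfl, fourScore]
  calc _ = _ := Finset.sum_congr rfl fun s _ => by rw [rowSum_eq hH]
    _ = _ := by simpa [bitSign_zero, Finset.mapEmbedding_apply] using h
    _ = _ := congrArg List.sum (List.map_congr_left fun x hx => absScore_signSum
      (subsetXors_lt hr _ _ x hx) (weightsDvd_spec hr' hd x hx))

theorem localScore_last_eq (hr : ∀ i, r i < 2 ^ 60)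
    (hH : ∀ i j : Fin 60, H i j = (bitSign (r i) j : ℤˣ))
    (hd : lanesDvd (tripleCount 59) (quadWeights r 59) = true) :
    localScore H (Fin.last 59) = quadScore r 59 := by
  have hr' : ∀ i, r i < 2 ^ 64 := fun i => (hr i).trans (by norm_num)
  have h := sum_powersetCard_insert_eq r 3 59
  rw [powersetCard_range_eq, Finset.filter_map, Finset.sum_map] at h
  rw [quadScore_eq hr' (by norm_num), localScore]
  have hf : ∀ s : Finset (Fin 60), Fin.last 59 ∈ s ↔
      (59 : ℕ) ∈ (Finset.mapEmbedding Fin.valEmbedding) s := by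
    intro s
    rw [Finset.mapEmbedding_apply]
    exact (Finset.mem_map' Fin.valEmbedding (a := Fin.last 59)).symm
  calc _ = _ := Finset.sum_congr (Finset.filter_congr fun s _ => hf s) fun s _ => by
        rw [rowSum_eq hH, RelEmbedding.coe_toEmbedding, Finset.mapEmbedding_apply]
    _ = _ := h
    _ = _ := congrArg List.sum (List.map_congr_left fun x hx => absScore_signSum
      (Nat.xor_lt_two_pow (subsetXors_lt hr _ _ x hx) (hr _)) (lanesDvd_spec hr' hd x hx))

/-- Two sign rows of length 60 are orthogonal exactly if they differ in 30 places; together with the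
diagonal this gives H Hᵀ = 60. -/
theorem isHadamard_of_pairsBalanced (hr : ∀ i, r i < 2 ^ 60)
    (hH : ∀ i j : Fin 60, H i j = (bitSign (r i) j : ℤˣ))
    (hb : pairsBalanced r 60 = true) : H.IsHadamard := by
  have hr' : ∀ i, r i < 2 ^ 64 := fun i => (hr i).trans (by norm_num)
  have hdot : ∀ i j : Fin 60, ∑ c, H i c * H j c = signSum (r i ^^^ r j) := by
    intro i j
    rw [signSum, Finset.sum_range]
    simp [hH, bitSign_xor]
  have hlt : ∀ i j : Fin 60, i < j → signSum (r i ^^^ r j) = 0 := by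
    intro i j hij
    rw [signSum_eq (Nat.xor_lt_two_pow (hr i) (hr j)),
      pairsBalanced_spec hr' hb _ (mem_subsetXors_two (r := r) (j : ℕ) hij j.2)]
    norm_num
  refine Matrix.IsHadamard.of_mul_conjTranspose ?_ ?_ ?_
  · intro i j
    rw [Unitary.mem_iff_eq_one_or_eq_neg_one, hH]
    rcases Int.units_eq_one_or (bitSign (r i) j) with h | h <;> simp [h]
  · ext i j
    rw [Matrix.mul_apply]
    simp only [Matrix.conjTranspose_apply, star_trivial, hdot, Matrix.smul_apply,
      Matrix.one_apply, Fintype.card_fin]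
    rcases lt_trichotomy i j with h | rfl | h
    · simp [hlt i j h, h.ne]
    · simp [signSum, bitSign_zero]
    · rw [Nat.xor_comm, hlt j i h]
      simp [h.ne']
  · exact IsRegular.of_ne_zero (by norm_num)

end matrix

/-! ### The entries of the constructed matrix -/

/-- The Hadamard matrix constructed from a quadruple of sequences of lengths `8, 8, 7, 7`. -/
abbrev hadMat (x : BinaryQuad 8 7) : Matrix (Fin 60) (Fin 60) ℤ := constructedMatrix x

/-- All terms of the four sequences. -/
def terms (x : BinaryQuad 8 7) : Fin 30 → ℤˣ :=
  Fin.append (Fin.append x.A x.B) (Fin.append x.C x.D)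

/-- The sign `-1` for `true`, and `1` for `false`. -/
def boolSign (b : Bool) : ℤˣ := bif b then -1 else 1

theorem boolSign_xor (a b : Bool) : boolSign (a ^^ b) = boolSign a * boolSign b := by
  cases a <;> cases b <;> simp [boolSign]

/-- The term `t` of the `k`-th of the sequences `A,C; A,-C; B,D; B,-D`: whether it is negated, and
its position among all terms. -/
def doubledTerm (k : Fin 4) (t : Fin 15) : Bool × Fin 30 :=
  ![![(false, 0), (false, 1), (false, 2), (false, 3), (false, 4), (false, 5), (false, 6),
      (false, 7), (false, 16), (false, 17), (false, 18), (false, 19), (false, 20), (false, 21),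
      (false, 22)],
    ![(false, 0), (false, 1), (false, 2), (false, 3), (false, 4), (false, 5), (false, 6),
      (false, 7), (true, 16), (true, 17), (true, 18), (true, 19), (true, 20), (true, 21),
      (true, 22)],
    ![(false, 8), (false, 9), (false, 10), (false, 11), (false, 12), (false, 13), (false, 14),
      (false, 15), (false, 23), (false, 24), (false, 25), (false, 26), (false, 27), (false, 28),
      (false, 29)],
    ![(false, 8), (false, 9), (false, 10), (false, 11), (false, 12), (false, 13), (false, 14),
      (false, 15), (true, 23), (true, 24), (true, 25), (true, 26), (true, 27), (true, 28),
      (true, 29)]] k t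

/-- The entry `(i, j)` of the block `(p, q)` of the Goethals–Seidel array: whether it is negated,
the sequence, and the position in the sequence. -/
def blockEntry (p q : Fin 4) (i j : Fin 15) : Bool × Fin 4 × Fin 15 :=
  ![![(false, 0, j - i), (false, 1, j.rev - i), (false, 2, j.rev - i), (false, 3, j.rev - i)],
    ![(true, 1, j.rev - i), (false, 0, j - i), (true, 3, j - i.rev), (false, 2, j - i.rev)],
    ![(true, 2, j.rev - i), (false, 3, j - i.rev), (false, 0, j - i), (true, 1, j - i.rev)],
    ![(true, 3, j.rev - i), (true, 2, j - i.rev), (false, 1, j - i.rev), (false, 0, j - i)]] p q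

/-- The entry of the constructed matrix in row `r` and column `c`: whether it is negated, and its
position among all terms. -/
def entryTerm (r c : Fin 4 × Fin 15) : Bool × Fin 30 :=
  let e := blockEntry r.1 c.1 r.2 c.2
  let f := doubledTerm e.2.1 e.2.2
  (e.1 ^^ f.1, f.2)

/-- The four sequences put into the Goethals–Seidel array. -/
def doubledSeq (x : BinaryQuad 8 7) (k : Fin 4) : Fin 15 → ℤˣ :=
  ![(doubling x).A, (doubling x).B, (doubling x).C, (doubling x).D] k

theorem doubledSeq_apply (x : BinaryQuad 8 7) (k : Fin 4) (t : Fin 15) :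
    doubledSeq x k t = boolSign (doubledTerm k t).1 * terms x (doubledTerm k t).2 := by
  fin_cases k <;> fin_cases t <;>
    first
      | exact (one_mul _).symm
      | exact (neg_one_mul _).symm

/-- The circulant has the entry X (j − i), and R on the right reverses the columns. -/
theorem circ_mul_backDiag {d : ℕ} [NeZero d] (X : Fin d → ℤˣ) (i j : Fin d) :
    (circ X * backDiag d) i j = X (j.rev - i) := by
  rw [Matrix.mul_apply, Finset.sum_eq_single j.rev]
  · simp [circ, backDiag]
  · intro k _ hk
    have : j ≠ k.rev := fun h => hk (by rw [h, Fin.rev_rev])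
    simp [backDiag, this]
  · simp

theorem backDiag_mul_circ {d : ℕ} [NeZero d] (X : Fin d → ℤˣ) (i j : Fin d) :
    (backDiag d * circ X) i j = X (j - i.rev) := by
  rw [Matrix.mul_apply, Finset.sum_eq_single i.rev]
  · simp [circ, backDiag]
  · intro k _ hk
    simp [backDiag, hk]
  · simp

theorem goethalsSeidelBlocks_apply (x : BinaryQuad 8 7) (p q : Fin 4) (i j : Fin 15) :
    goethalsSeidelBlocks (circ (doubling x).A) (circ (doubling x).B) (circ (doubling x).C)
      (circ (doubling x).D) p q i j =
      ((boolSign (blockEntry p q i j).1 *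
        doubledSeq x (blockEntry p q i j).2.1 (blockEntry p q i j).2.2 : ℤˣ) : ℤ) := by
  have h0 : ∀ X : Fin 15 → ℤˣ, circ X i j = ((1 * X (j - i) : ℤˣ) : ℤ) := fun X => by
    rw [one_mul]
    rfl
  have h1 : ∀ X : Fin 15 → ℤˣ, (circ X * backDiag 15) i j = ((1 * X (j.rev - i) : ℤˣ) : ℤ) :=
    fun X => by rw [one_mul, circ_mul_backDiag]
  have h2 : ∀ X : Fin 15 → ℤˣ,
      (-(circ X * backDiag 15)) i j = ((-1 * X (j.rev - i) : ℤˣ) : ℤ) := fun X => by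
    rw [neg_one_mul, Matrix.neg_apply, circ_mul_backDiag, Units.val_neg]
  have h3 : ∀ X : Fin 15 → ℤˣ, (backDiag 15 * circ X) i j = ((1 * X (j - i.rev) : ℤˣ) : ℤ) :=
    fun X => by rw [one_mul, backDiag_mul_circ]
  have h4 : ∀ X : Fin 15 → ℤˣ,
      (-(backDiag 15 * circ X)) i j = ((-1 * X (j - i.rev) : ℤˣ) : ℤ) := fun X => by
    rw [neg_one_mul, Matrix.neg_apply, backDiag_mul_circ, Units.val_neg]
  fin_cases p <;> fin_cases q
  exacts [h0 _, h1 _, h1 _, h1 _, h2 _, h0 _, h4 _, h3 _, h2 _, h3 _, h0 _, h4 _, h2 _, h4 _, h3 _,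
    h0 _]

/-- Each entry is, up to sign, a single term of the sequences, and sign and position do not depend
on `x`. The construction is thus one fixed matrix of formal signed terms, about which statements can
be checked entry by entry once and for all. -/
theorem hadMat_apply (x : BinaryQuad 8 7) (r c : Fin 4 × Fin 15) :
    hadMat x (finProdFinEquiv r) (finProdFinEquiv c) =
      ((boolSign (entryTerm r c).1 * terms x (entryTerm r c).2 : ℤˣ) : ℤ) := by
  have h : hadMat x (finProdFinEquiv r) (finProdFinEquiv c) =
      goethalsSeidelBlocks (circ (doubling x).A) (circ (doubling x).B) (circ (doubling x).C)
        (circ (doubling x).D) r.1 c.1 r.2 c.2 := by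
    simp only [hadMat, constructedMatrix, quadToMatrix, goethalsSeidel, Matrix.reindex_apply]
    rw [Matrix.submatrix_apply, Equiv.symm_apply_apply, Equiv.symm_apply_apply, Matrix.of_apply]
  rw [h, goethalsSeidelBlocks_apply, doubledSeq_apply, ← mul_assoc, ← boolSign_xor]
  rfl

/-- `f k` holds for all `k < n`. -/
def allBelow (n : ℕ) (f : ℕ → Bool) : Bool := Nat.rec true (fun k b => f k && b) n

theorem of_allBelow {n : ℕ} {f : ℕ → Bool} (h : allBelow n f = true) {k : ℕ} (hk : k < n) :
    f k = true := by
  induction n with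
  | zero => omega
  | succ n ih =>
    obtain ⟨h1, h2⟩ := (Bool.and_eq_true _ _).mp h
    rcases Nat.lt_succ_iff_lt_or_eq.1 hk with hk | rfl
    exacts [ih h2 hk, h1]

/-- The term `t` of the `k`-th of the doubled sequences; `32` is added to the position of a negated
term. -/
def doubledCode (k t : ℕ) : ℕ :=
  bif Nat.blt t 8 then 8 * (k / 2) + t else 8 + 7 * (k / 2) + t + 32 * (k % 2)

/-- The sequence `k` in a block, the sign `s` and the kind `e` of the block, as `k + 4 * s + 8 * e`.
-/
def blockCodes : List ℕ := [0, 9, 10, 11, 13, 0, 23, 18, 14, 19, 0, 21, 15, 22, 17, 0]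

/-- The entry of the constructed matrix in row `r` and column `c`: its position among all terms, plus
`32` if it is negated. -/
def entryCode (r c : ℕ) : ℕ :=
  let b := blockCodes.getD (4 * (r / 15) + c / 15) 0
  Nat.xor (doubledCode (b % 4)
    ([15 + c % 15 - r % 15, 29 - r % 15 - c % 15, r % 15 + c % 15 + 1].getD (b / 8) 0 % 15))
    (32 * (b / 4 % 2))

/-- The term with the given code. -/
def codeTerm (x : BinaryQuad 8 7) (k : ℕ) : ℤˣ :=
  boolSign (k.testBit 5) * terms x (Fin.ofNat 30 (k % 32))

/-- The three kinds of block are Z, Z R and R Z, where the index is j − i, j.rev − i and j − i.rev.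
Modulo 15 these are 15 + j − i, 29 − i − j and i + j + 1, written so that natural subtraction is
never truncated. -/
theorem entryCode_eq : ∀ (p : Fin 4) (i : Fin 15) (q : Fin 4) (j : Fin 15),
    entryCode (i + 15 * p) (j + 15 * q) =
      (entryTerm (p, i) (q, j)).2 + bif (entryTerm (p, i) (q, j)).1 then 32 else 0 := by
  decide +kernel

theorem codeTerm_add (x : BinaryQuad 8 7) (b : Bool) (t : Fin 30) :
    codeTerm x (t + bif b then 32 else 0) = boolSign b * terms x t := by
  have h1 : (t + bif b then 32 else 0 : ℕ) % 32 = t := by cases b <;> simp <;> omega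
  have h2 : (t + bif b then 32 else 0 : ℕ).testBit 5 = b := by
    have : ∀ (b : Bool) (t : Fin 30), (t + bif b then 32 else 0 : ℕ).testBit 5 = b := by decide
    exact this b t
  rw [codeTerm, h1, h2, Fin.ofNat_eq_cast, Fin.cast_val_eq_self]

theorem hadMat_apply_eq_codeTerm (x : BinaryQuad 8 7) (r c : Fin 60) :
    hadMat x r c = (codeTerm x (entryCode r c) : ℤˣ) := by
  obtain ⟨⟨p, i⟩, rfl⟩ := (finProdFinEquiv (m := 4) (n := 15)).surjective r
  obtain ⟨⟨q, j⟩, rfl⟩ := (finProdFinEquiv (m := 4) (n := 15)).surjective c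
  rw [hadMat_apply, ← codeTerm_add, ← entryCode_eq]
  rfl

/-! ### Transformations preserving the Hadamard equivalence class -/

/-- A map of the index set of the constructed matrix, sending `i` in the block `p` to `s + a * i` in
the block `q`, where `(q, s, a)` is the `p`-th item of the list. -/
def affineIndex (l : List (ℕ × ℕ × ℕ)) (r : ℕ) : ℕ :=
  let e := l.getD (r / 15) (0, 0, 0)
  15 * e.1 + (e.2.1 + e.2.2 * (r % 15)) % 15

/-- The map `affineIndex l` is an involution of the index set. -/
def affineInvolutive (l : List (ℕ × ℕ × ℕ)) : Bool :=
  allBelow 60 fun r => Nat.blt (affineIndex l r) 60 && Nat.beq (affineIndex l (affineIndex l r)) r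

/-- The involution defined by `affineIndex l`. -/
def affinePerm (l : List (ℕ × ℕ × ℕ)) (h : affineInvolutive l = true) : Equiv.Perm (Fin 60) :=
  have h' : ∀ r : Fin 60, affineIndex l r < 60 ∧ affineIndex l (affineIndex l r) = r := fun r => by
    have := of_allBelow h r.2
    simpa [Nat.blt_eq] using this
  Function.Involutive.toPerm (fun r => ⟨affineIndex l r, (h' r).1⟩) fun r => Fin.ext (h' r).2

/-- The effect on codes of terms of a signed permutation of the terms. -/
def actCode (g : List ℕ) (k : ℕ) : ℕ := Nat.xor (g.getD (k % 32) 0) (32 * (k / 32))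

/-- The transformation `g` of the terms amounts to the transformation `π`, `ρ` of the rows and columns,
with signs `e`, `d` for the blocks. -/
def intertwines (g : List ℕ) (π ρ : List (ℕ × ℕ × ℕ)) (e d : List ℕ) : Bool :=
  allBelow 60 fun r => allBelow 60 fun c =>
    Nat.beq (actCode g (entryCode r (affineIndex ρ c)))
      (Nat.xor (entryCode (affineIndex π r) c) (32 * ((e.getD (r / 15) 0 + d.getD (c / 15) 0) % 2)))

theorem entryCode_lt {r c : ℕ} (hr : r < 60) (hc : c < 60) :
    entryCode r c % 32 < 30 ∧ entryCode r c < 64 := by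
  have h : allBelow 60 (fun r => allBelow 60 fun c =>
      Nat.blt (entryCode r c % 32) 30 && Nat.blt (entryCode r c) 64) = true := by decide +kernel
  simpa [Nat.blt_eq] using of_allBelow (of_allBelow h hr) hc

/-- The sign is bit 5 and the position is given by the bits below it, so only the parity of `s`
matters. -/
theorem codeTerm_xor (x : BinaryQuad 8 7) (k s : ℕ) :
    codeTerm x (k ^^^ (32 * s)) = boolSign (s.testBit 0) * codeTerm x k := by
  have h1 : (k ^^^ (32 * s)) % 32 = k % 32 := by
    apply Nat.eq_of_testBit_eq
    intro i
    rw [show (32 : ℕ) = 2 ^ 5 from rfl, Nat.testBit_mod_two_pow, Nat.testBit_mod_two_pow,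
      Nat.testBit_xor, Nat.testBit_two_pow_mul]
    by_cases hi : i < 5
    · simp [hi, Nat.not_le.2 hi]
    · simp [hi]
  have h2 : (k ^^^ (32 * s)).testBit 5 = (s.testBit 0 ^^ k.testBit 5) := by
    rw [Nat.testBit_xor, show (32 : ℕ) = 2 ^ 5 from rfl, Nat.testBit_two_pow_mul, Bool.xor_comm]
    simp
  rw [codeTerm, codeTerm, h1, h2, boolSign_xor, mul_assoc]

/-- If a signed relabelling of the terms changes the matrix of formal terms in the same way as
signed permutations of rows and columns do, then substituting any values for the terms gives
equivalent matrices. The finite check `intertwines` therefore serves all quadruples at once. -/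
theorem hadamardEquivalent_of_intertwines {x y : BinaryQuad 8 7} {g : List ℕ}
    (hxy : ∀ t : Fin 30, terms y t = codeTerm x (g.getD t 0)) {π ρ : List (ℕ × ℕ × ℕ)}
    {e d : List ℕ} (hπ : affineInvolutive π = true) (hρ : affineInvolutive ρ = true)
    (h : intertwines g π ρ e d = true) : HadamardEquivalent (hadMat x) (hadMat y) := by
  refine hadamardEquivalent_iff.2 ⟨affinePerm π hπ, affinePerm ρ hρ,
    fun r => boolSign ((e.getD (r / 15) 0).testBit 0),
    fun c => boolSign ((d.getD (c / 15) 0).testBit 0), fun r c => ?_⟩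
  have h1 : actCode g (entryCode r (affineIndex ρ c)) = entryCode (affineIndex π r) c ^^^
      (32 * ((e.getD (r / 15) 0 + d.getD (c / 15) 0) % 2)) :=
    Nat.eq_of_beq_eq_true (of_allBelow (of_allBelow h r.2) c.2)
  obtain ⟨hlt, hlt'⟩ := entryCode_lt r.2 (affinePerm ρ hρ c).2
  change entryCode r (affineIndex ρ c) % 32 < 30 at hlt
  change entryCode r (affineIndex ρ c) < 64 at hlt'
  have h2 : codeTerm y (entryCode r (affineIndex ρ c)) =
      codeTerm x (actCode g (entryCode r (affineIndex ρ c))) := by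
    rw [actCode]
    change _ = codeTerm x (_ ^^^ _)
    rw [codeTerm_xor, codeTerm, hxy, Nat.testBit_zero, Nat.testBit_eq_decide_div_mod_eq]
    simp only [Fin.ofNat_eq_cast, Fin.val_natCast, Nat.mod_eq_of_lt hlt]
  have h3 : ∀ a b : ℕ, ((a + b) % 2).testBit 0 = (a.testBit 0 ^^ b.testBit 0) := by
    intro a b
    simp only [Nat.testBit_zero]
    rcases Nat.mod_two_eq_zero_or_one a with ha | ha <;>
      rcases Nat.mod_two_eq_zero_or_one b with hb | hb <;> simp [Nat.add_mod, ha, hb]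
  rw [hadMat_apply_eq_codeTerm, hadMat_apply_eq_codeTerm]
  change ((codeTerm y (entryCode r (affineIndex ρ c)) : ℤˣ) : ℤ) =
    _ * ((codeTerm x (entryCode (affineIndex π r) c) : ℤˣ) : ℤ) * _
  rw [h2, h1, codeTerm_xor, h3, boolSign_xor]
  push_cast
  ring

/-- The sequences `C` and `D` are negated. -/
theorem hadamardEquivalent_negCD (a b : Fin 8 → ℤˣ) (c d : Fin 7 → ℤˣ) :
    HadamardEquivalent (hadMat ⟨a, b, c, d⟩) (hadMat ⟨a, b, -c, -d⟩) := by
  -- Negating C and D exchanges (A,C) with (A,−C) and (B,D) with (B,−D). In the lists of indices 14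
  -- stands for −1 modulo 15, so the item (q, 14, 14) reverses the order within a block.
  refine hadamardEquivalent_of_intertwines
    (g := [0, 1, 2, 3, 4, 5, 6, 7, 8, 9, 10, 11, 12, 13, 14, 15, 48, 49, 50, 51, 52, 53, 54, 55,
      56, 57, 58, 59, 60, 61])
    (fun t => ?_)
    (π := [(0, 0, 1), (1, 0, 1), (2, 14, 14), (3, 14, 14)])
    (ρ := [(1, 14, 14), (0, 14, 14), (3, 0, 1), (2, 0, 1)])
    (e := [0, 1, 1, 0]) (d := [0, 0, 0, 0])
    (by decide +kernel) (by decide +kernel) (by decide +kernel)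
  fin_cases t <;> first | exact (one_mul _).symm | exact (neg_one_mul _).symm

/-- The sequences `A` and `C` are negated. -/
theorem hadamardEquivalent_negAC (a b : Fin 8 → ℤˣ) (c d : Fin 7 → ℤˣ) :
    HadamardEquivalent (hadMat ⟨a, b, c, d⟩) (hadMat ⟨-a, b, -c, d⟩) := by
  -- The first two of the doubled sequences are negated. Their blocks are those in the upper left
  -- and lower right quarter of the array, exactly where the signs `e` and `d` multiply to −1.
  refine hadamardEquivalent_of_intertwines
    (g := [32, 33, 34, 35, 36, 37, 38, 39, 8, 9, 10, 11, 12, 13, 14, 15, 48, 49, 50, 51, 52, 53,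
      54, 23, 24, 25, 26, 27, 28, 29])
    (fun t => ?_)
    (π := [(0, 0, 1), (1, 0, 1), (2, 0, 1), (3, 0, 1)])
    (ρ := [(0, 0, 1), (1, 0, 1), (2, 0, 1), (3, 0, 1)])
    (e := [0, 0, 1, 1]) (d := [1, 1, 0, 0])
    (by decide +kernel) (by decide +kernel) (by decide +kernel)
  fin_cases t <;> first | exact (one_mul _).symm | exact (neg_one_mul _).symm

/-- The sequences `A` and `B` are negated. -/
theorem hadamardEquivalent_negAB (a b : Fin 8 → ℤˣ) (c d : Fin 7 → ℤˣ) :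
    HadamardEquivalent (hadMat ⟨a, b, c, d⟩) (hadMat ⟨-a, -b, c, d⟩) := by
  -- Since (−A,C) = −(A,−C), this is the exchange induced by negating C and D, followed by a global
  -- change of sign, which is put into `d`.
  refine hadamardEquivalent_of_intertwines
    (g := [32, 33, 34, 35, 36, 37, 38, 39, 40, 41, 42, 43, 44, 45, 46, 47, 16, 17, 18, 19, 20, 21,
      22, 23, 24, 25, 26, 27, 28, 29])
    (fun t => ?_)
    (π := [(0, 0, 1), (1, 0, 1), (2, 14, 14), (3, 14, 14)])
    (ρ := [(1, 14, 14), (0, 14, 14), (3, 0, 1), (2, 0, 1)])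
    (e := [0, 1, 1, 0]) (d := [1, 1, 1, 1])
    (by decide +kernel) (by decide +kernel) (by decide +kernel)
  fin_cases t <;> first | exact (one_mul _).symm | exact (neg_one_mul _).symm

/-- The pairs `(A, C)` and `(B, D)` are interchanged. -/
theorem hadamardEquivalent_swap (a b : Fin 8 → ℤˣ) (c d : Fin 7 → ℤˣ) :
    HadamardEquivalent (hadMat ⟨a, b, c, d⟩) (hadMat ⟨b, a, d, c⟩) := by
  -- The first doubled sequence is exchanged with the third, and the second with the fourth.
  refine hadamardEquivalent_of_intertwines
    (g := [8, 9, 10, 11, 12, 13, 14, 15, 0, 1, 2, 3, 4, 5, 6, 7, 23, 24, 25, 26, 27, 28, 29, 16,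
      17, 18, 19, 20, 21, 22])
    (fun t => ?_)
    (π := [(0, 0, 1), (1, 14, 14), (2, 0, 1), (3, 14, 14)])
    (ρ := [(2, 14, 14), (3, 0, 1), (0, 14, 14), (1, 0, 1)])
    (e := [0, 0, 1, 1]) (d := [0, 0, 0, 0])
    (by decide +kernel) (by decide +kernel) (by decide +kernel)
  fin_cases t <;> exact (one_mul _).symm

/-- The sequences `A` and `C` are reversed. -/
theorem hadamardEquivalent_revAC (a b : Fin 8 → ℤˣ) (c d : Fin 7 → ℤˣ) :
    HadamardEquivalent (hadMat ⟨a, b, c, d⟩) (hadMat ⟨revSeq a, b, revSeq c, d⟩) := by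
  -- The reversal of (A,C) is (rev C, rev A), a cyclic shift of the wanted sequence (rev A, rev C);
  -- hence offsets other than 0 and 14 occur.
  refine hadamardEquivalent_of_intertwines
    (g := [7, 6, 5, 4, 3, 2, 1, 0, 8, 9, 10, 11, 12, 13, 14, 15, 22, 21, 20, 19, 18, 17, 16, 23,
      24, 25, 26, 27, 28, 29])
    (fun t => ?_)
    (π := [(1, 7, 14), (0, 7, 14), (3, 14, 14), (2, 14, 14)])
    (ρ := [(1, 14, 14), (0, 14, 14), (3, 6, 14), (2, 6, 14)])
    (e := [0, 1, 0, 1]) (d := [1, 0, 1, 0])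
    (by decide +kernel) (by decide +kernel) (by decide +kernel)
  fin_cases t <;> exact (one_mul _).symm

/-! ### The rows of the constructed matrix as numbers -/

/-- The sequence of length `m` encoded by the first bits of `n`. -/
def seq (m n : ℕ) : Fin m → ℤˣ := fun i => bitSign n i

/-- The quadruple of sequences encoded by the first `30` bits of `n`. -/
def quad (n : ℕ) : BinaryQuad 8 7 :=
  ⟨seq 8 n, seq 8 (n >>> 8), seq 7 (n >>> 16), seq 7 (n >>> 23)⟩

theorem terms_quad (n : ℕ) (t : Fin 30) : terms (quad n) t = bitSign n t := by
  have h : ∀ k i : ℕ, bitSign (n >>> k) i = bitSign n (k + i) := by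
    simp [bitSign, Nat.testBit_shiftRight]
  have h8 : ∀ i : Fin 8, seq 8 (n >>> 8) i = bitSign n (8 + i) := fun i => h 8 i
  have h16 : ∀ i : Fin 7, seq 7 (n >>> 16) i = bitSign n (16 + i) := fun i => h 16 i
  have h23 : ∀ i : Fin 7, seq 7 (n >>> 23) i = bitSign n (23 + i) := fun i => h 23 i
  fin_cases t
  iterate 8 first | rfl
  · exact h8 0
  · exact h8 1
  · exact h8 2
  · exact h8 3
  · exact h8 4
  · exact h8 5
  · exact h8 6
  · exact h8 7
  · exact h16 0
  · exact h16 1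
  · exact h16 2
  · exact h16 3
  · exact h16 4
  · exact h16 5
  · exact h16 6
  · exact h23 0
  · exact h23 1
  · exact h23 2
  · exact h23 3
  · exact h23 4
  · exact h23 5
  · exact h23 6

/-- The positions of the negated entries of the constructed matrix. -/
def negMask : ℕ :=
  0x1fc03fffff0100001f807ffffe0300001f00fffffc0700001e01fffff80f00001c03fffff01f00001807ffffe03f0000100fffffc07f0000001fffff80ff0000003fbfff81fe0000007f3fff83fc000000fe3fff87f8000001fc3fff8ff0000003f83fff9fe0000007f03fffbfc000000fe03fffff80001fe0003f807fff003fc0003f00ffff007f80003e01ffff00ff00003c03ffff01fe00003807ffff03fc0000300fffff07f80000201fffff0ff00000003fffff0fe02000007f7fff0fc0600000fe7fff0f80e00001fc7fff0f01e00003f87fff0e03e00007f07fff0c07e0000fe07fff080fe0001fc07fff0000003fc0007f010000007f80007e03000000ff00007c07000001fe0000780f000003fc0000701f000007f80000603f00000ff00000407f00001fe0000000ff00001fc0400001fe00001f80c00003fc00001f01c00007f800001e03c0000ff000001c07c0001fe00000180fc0003fc00000101fc0007f80001fc000007f0000003f800000fe0000007f000001fc000000fe000003f8000001fc000007f0000003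f800000fe0000007f000001fc000000fe000003f8000000fc020003f0080000f8060003e0180000f00e0003c0380000e01e000380780000c03e000300f80000807e000201f8000000fe000003f8000

/-- For each term of the base sequences, the positions of its occurrences in the constructed
matrix. -/
def termMasks : List ℕ :=
  [0x8000000400000000400000080000000020000010000000001000002000000000080000400000000004000080000000000200010000000000010002000000000000800400000000000040080000000000002010000000000000102000000000000008400000000000000480000000000000030000000000000003000000000000000480000000000000084000000000000010200000000000002010000000000000400800000000000080040000000000010002000000000002000100000000000400008000000000080000400000000010000020000000002000001000000000400000080000000080000004000000000000000200000010000000010000002000000000800000400000000040000080000000002000010000000000100002000000000008000400000000000400080000000000020010000000000001002000000000000080400000000000004080000000000000210000000000000012000000000000000c000000000000000c00000000000000120000000000000021000000000000004080000000000000804000000000000100200000000000020010000000000004000800000000000800040000000000100002000000000020000100000000004000008000000000800000400000000100000020000000020000001,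
   0x20008000000008000001000000000400000200000000020000040000000001000008000000000080001000000000004000200000000000200040000000000010008000000000000801000000000000040200000000000002040000000000000108000000000000009000000000000000400040000000000040004000000000009000000000000001080000000000000204000000000000040200000000000008010000000000001000800000000000200040000000000040002000000000008000100000000001000008000000000200000400000000040000020000000008000001000000000000200080000000000000000000c000000000002000000100000000100000020000000008000004000000000400000800000000020000100000000001000020000000000080004000000000004000800000000000200100000000000010020000000000000804000000000000040800000000000002100000000000000120000000000020000001000000000000c0000000000000012000000000000002100000000000000408000000000000080400000000000010020000000000002001000000000000400080000000000080004000000000010000200000000002000010000000000400000800000000080000040000000010000002,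
   0x400100000000000020020000000008000004000000000400000800000000020000100000000001000020000000000080004000000000004000800000000000200100000000000010020000000000000804000000000000040800000000000002100000000000000100004000000000008000800000000000800080000000000100004000000000021000000000000004080000000000000804000000000000100200000000000020010000000000004000800000000000800040000000000100002000000000020000100000000004000008000000000800000400000000000020020000000000004001000000000000000000012000000000000000c000000000002000000100000000100000020000000008000004000000000400000800000000020000100000000001000020000000000080004000000000004000800000000000200100000000000010020000000000000804000000000000040800000000000002100000000000100000020000000020000001000000000000c000000000000001200000000000000210000000000000040800000000000008040000000000001002000000000000200100000000000040008000000000008000400000000001000020000000000200001000000000040000080000000008000004,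
   0x8002000000000000400400000000000020080000000008000010000000000400002000000000020000400000000001000080000000000080010000000000004002000000000000200400000000000010080000000000000810000000000000040000400000000002000080000000000100010000000000010001000000000002000080000000000400004000000000081000000000000010080000000000002004000000000000400200000000000080010000000000010000800000000002000040000000000400002000000000080000100000000000002008000000000000400400000000000080020000000000000000000210000000000000012000000000000000c000000000002000000100000000100000020000000008000004000000000400000800000000020000100000000001000020000000000080004000000000004000800000000000200100000000000010020000000000000804000000000000040800000000000800000400000000100000020000000020000001000000000000c00000000000000120000000000000021000000000000004080000000000000804000000000000100200000000000020010000000000004000800000000000800040000000000100002000000000020000100000000004000008,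
   0x100040000000000008008000000000000401000000000000020200000000008000040000000000400008000000000020001000000000001000200000000000080040000000000004008000000000000201000000000000010000040000000000800008000000000040001000000000002000200000000000200020000000000040001000000000008000080000000001000004000000000201000000000000040080000000000008004000000000001000200000000000200010000000000040000800000000008000040000000000000202000000000000040100000000000008008000000000001000400000000000000000004080000000000000210000000000000012000000000000000c000000000002000000100000000100000020000000008000004000000000400000800000000020000100000000001000020000000000080004000000000004000800000000000200100000000000010020000000000000804000000000004000008000000000800000400000000100000020000000020000001000000000000c0000000000000012000000000000002100000000000000408000000000000080400000000000010020000000000002001000000000000400080000000000080004000000000010000200000000002000010,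
   0x2000800000000000100100000000000008020000000000000404000000000000020800000000008000100000000000400020000000000020004000000000001000800000000000080100000000000004000004000000000200000800000000010000100000000000800020000000000040004000000000004000400000000000800020000000000100001000000000020000080000000004000004000000000801000000000000100080000000000020004000000000004000200000000000800010000000000000020800000000000004040000000000000802000000000000100100000000000020008000000000000000000080400000000000004080000000000000210000000000000012000000000000000c000000000002000000100000000100000020000000008000004000000000400000800000000020000100000000001000020000000000080004000000000004000800000000000200100000000000010020000000000020000100000000004000008000000000800000400000000100000020000000020000001000000000000c000000000000001200000000000000210000000000000040800000000000008040000000000001002000000000000200100000000000040008000000000008000400000000001000020,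
   0x40010000000000002002000000000000100400000000000008080000000000000410000000000000022000000000008000400000000000400080000000000020010000000000001000000400000000080000080000000004000010000000000200002000000000010000400000000000800080000000000080008000000000010000400000000002000020000000000400001000000000080000080000000010000004000000002001000000000000400080000000000080004000000000000002200000000000000410000000000000080800000000000010040000000000002002000000000000400100000000000000000001002000000000000080400000000000004080000000000000210000000000000012000000000000000c000000000002000000100000000100000020000000008000004000000000400000800000000020000100000000001000020000000000080004000000000004000800000000000200100000000000100002000000000020000100000000004000008000000000800000400000000100000020000000020000001000000000000c00000000000000120000000000000021000000000000004080000000000000804000000000000100200000000000020010000000000004000800000000000800040,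
   0x800200000000000040040000000000002008000000000000101000000000000008200000000000000440000000000000028000000000008001000000000000400000040000000020000008000000001000001000000000080000200000000004000040000000000200008000000000010001000000000001000100000000000200008000000000040000400000000008000020000000001000001000000000200000080000000040000004000000008001000000000000000280000000000000044000000000000008200000000000001010000000000000200800000000000040040000000000008002000000000000000000020010000000000001002000000000000080400000000000004080000000000000210000000000000012000000000000000c000000000002000000100000000100000020000000008000004000000000400000800000000020000100000000001000020000000000080004000000000004000800000000000800040000000000100002000000000020000100000000004000008000000000800000400000000100000020000000020000001000000000000c0000000000000012000000000000002100000000000000408000000000000080400000000000010020000000000002001000000000000400080,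
   0x800100000000000100020000000000020004000000000004000800000000000800100000000000100020000000000020004000000000004000800000000000800100000000000100020000000000020004000000000004000800000000000800100000000000100020000000000020004000000000000000800100000000000100020000000000020004000000000004000800000000000800100000000000100020000000000020004000000000004000800000000000800100000000000100020000000000020004000000000004000800000000000800100000000000100020000000000020004000000020004000000000004000800000000000800100000000000100020000000000020004000000000004000800000000000800100000000000100020000000000020004000000000004000800000000000800100000000000100020000000000020004000000000004000800000000000800100000000000000020004000000000004000800000000000800100000000000100020000000000020004000000000004000800000000000800100000000000100020000000000020004000000000004000800000000000800100000000000100020000000000020004000000000004000800000000000800100000000000,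
   0x140000000000000020001000000000004000200000000000800040000000000100008000000000020001000000000004000200000000000800040000000000100008000000000020001000000000004000200000000000800040000000000100008000000000020001000000000000000a00000000000000140000000000000020001000000000004000200000000000800040000000000100008000000000020001000000000004000200000000000800040000000000100008000000000020001000000000004000200000000000800040000000000100008000000000020001000000000000000a000000040008000000000008001000000000001000200000000000200040000000000040008000000000008001000000000001000200000000000200040000000000040008000000000008001000000000001000200000000000200040000000000040008000000000008001000000000000000200040000000080010000000000000002000400000000000400080000000000080010000000000010002000000000002000400000000000400080000000000080010000000000010002000000000002000400000000000400080000000000080010000000000010002000000000002000400000000000400080000000000,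
   0x2200000000000000440000000000000080001000000000010000200000000002000040000000000400008000000000080001000000000010000200000000002000040000000000400008000000000080001000000000010000200000000002000040000000000000088000000000000011000000000000002200000000000000440000000000000080001000000000010000200000000002000040000000000400008000000000080001000000000010000200000000002000040000000000400008000000000080001000000000010000200000000002000040000000000000088000000000000011000000080010000000000010002000000000002000400000000000400080000000000080010000000000010002000000000002000400000000000400080000000000080010000000000010002000000000002000400000000000400080000000000080010000000000000002000400000000000400080000000040008000000000008001000000000000000200040000000000040008000000000008001000000000001000200000000000200040000000000040008000000000008001000000000001000200000000000200040000000000040008000000000008001000000000001000200000000000200040000000000,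
   0x4100000000000000820000000000000104000000000000020000100000000004000020000000000800004000000000100000800000000020000100000000004000020000000000800004000000000100000800000000020000100000000000000820000000000000104000000000000020800000000000004100000000000000820000000000000104000000000000020000100000000004000020000000000800004000000000100000800000000020000100000000004000020000000000800004000000000100000800000000020000100000000000000820000000000000104000000000000020800000100020000000000020004000000000004000800000000000800100000000000100020000000000020004000000000004000800000000000800100000000000100020000000000020004000000000004000800000000000800100000000000000020004000000000004000800000000000800100000000020004000000000004000800000000000800100000000000000020004000000000004000800000000000800100000000000100020000000000020004000000000004000800000000000800100000000000100020000000000020004000000000004000800000000000800100000000000100020000000000,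
   0x8080000000000001010000000000000202000000000000040400000000000008000010000000001000002000000000200000400000000040000080000000008000010000000001000002000000000200000400000000000008080000000000001010000000000000202000000000000040400000000000008080000000000001010000000000000202000000000000040400000000000008000010000000001000002000000000200000400000000040000080000000008000010000000001000002000000000200000400000000000008080000000000001010000000000000202000000000000040400000200040000000000040008000000000008001000000000001000200000000000200040000000000040008000000000008001000000000001000200000000000200040000000000040008000000000008001000000000000000200040000000000040008000000000008001000000000001000200000000010002000000000002000400000000000400080000000000080010000000000000002000400000000000400080000000000080010000000000010002000000000002000400000000000400080000000000080010000000000010002000000000002000400000000000400080000000000080010000000000,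
   0x10040000000000002008000000000000401000000000000080200000000000010040000000000002000001000000000400000200000000080000040000000010000008000000002000001000000000000080200000000000010040000000000002008000000000000401000000000000080200000000000010040000000000002008000000000000401000000000000080200000000000010040000000000002000001000000000400000200000000080000040000000010000008000000002000001000000000000080200000000000010040000000000002008000000000000401000000000000080200000400080000000000080010000000000010002000000000002000400000000000400080000000000080010000000000010002000000000002000400000000000400080000000000080010000000000000002000400000000000400080000000000080010000000000010002000000000002000400000000008001000000000001000200000000000200040000000000040008000000000008001000000000000000200040000000000040008000000000008001000000000001000200000000000200040000000000040008000000000008001000000000001000200000000000200040000000000040008000000000,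
   0x20020000000000004004000000000000800800000000000100100000000000020020000000000004004000000000000800000100000000100000020000000020000004000000000000800800000000000100100000000000020020000000000004004000000000000800800000000000100100000000000020020000000000004004000000000000800800000000000100100000000000020020000000000004004000000000000800000100000000100000020000000020000004000000000000800800000000000100100000000000020020000000000004004000000000000800800000000000100100000800100000000000100020000000000020004000000000004000800000000000800100000000000100020000000000020004000000000004000800000000000800100000000000000020004000000000004000800000000000800100000000000100020000000000020004000000000004000800000000004000800000000000800100000000000100020000000000020004000000000004000800000000000800100000000000000020004000000000004000800000000000800100000000000100020000000000020004000000000004000800000000000800100000000000100020000000000020004000000000,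
   0x40010000000000008002000000000001000400000000000200080000000000040010000000000008002000000000001000400000000000200000010000000000008002000000000001000400000000000200080000000000040010000000000008002000000000001000400000000000200080000000000040010000000000008002000000000001000400000000000200080000000000040010000000000008002000000000001000400000000000200000010000000000008002000000000001000400000000000200080000000000040010000000000008002000000000001000400000000000200080001000200000000000200040000000000040008000000000008001000000000001000200000000000200040000000000040008000000000008001000000000000000200040000000000040008000000000008001000000000001000200000000000200040000000000040008000000000008001000000000002000400000000000400080000000000080010000000000010002000000000002000400000000000400080000000000080010000000000000002000400000000000400080000000000080010000000000010002000000000002000400000000000400080000000000080010000000000010002000000000,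
   0x10004000000000000800800000000000040100000000000002020000000000000104000000000000008800000000000000500000000000000020004000000008000000800000000400000100000000020000020000000001000004000000000080000800000000004000100000000000200020000000000020002000000000004000100000000000800008000000000100000400000000020000020000000004000001000000000800000080000000000020004000000000005000000000000000880000000000000104000000000000020200000000000004010000000000000800800000000000100040000000000000000000400080000000000020010000000000001002000000000000080400000000000004080000000000000210000000000000012000000000000000c000000000002000000100000000100000020000000008000004000000000400000800000000020000100000000001000020000000000080004000000000004000800000000000800040000000000100002000000000020000100000000004000008000000000800000400000000100000020000000020000001000000000000c000000000000001200000000000000210000000000000040800000000000008040000000000001002000000000000200100,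
   0x200080000000000010010000000000000802000000000000040400000000000002080000000000000110000000000000008000400000000000400080000000000020010000000008000002000000000400000400000000020000080000000001000010000000000080002000000000004000400000000000400040000000000080002000000000010000100000000002000008000000000400000400000000080000020000000000002001000000000000400080000000000080004000000000011000000000000002080000000000000404000000000000080200000000000010010000000000002000800000000000000000008000400000000000400080000000000020010000000000001002000000000000080400000000000004080000000000000210000000000000012000000000000000c000000000002000000100000000100000020000000008000004000000000400000800000000020000100000000001000020000000000020010000000000004000800000000000800040000000000100002000000000020000100000000004000008000000000800000400000000100000020000000020000001000000000000c00000000000000120000000000000021000000000000004080000000000000804000000000000100200,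
   0x4001000000000000200200000000000010040000000000000808000000000000041000000000000002000040000000000100008000000000008001000000000000400200000000000020040000000008000008000000000400001000000000020000200000000001000040000000000080008000000000008000800000000001000040000000000200002000000000040000100000000008000008000000000000200400000000000040020000000000008001000000000001000080000000000200004000000000041000000000000008080000000000001004000000000000200200000000000040010000000000000000000100002000000000008000400000000000400080000000000020010000000000001002000000000000080400000000000004080000000000000210000000000000012000000000000000c000000000002000000100000000100000020000000008000004000000000400000800000000020000100000000000100200000000000020010000000000004000800000000000800040000000000100002000000000020000100000000004000008000000000800000400000000100000020000000020000001000000000000c0000000000000012000000000000002100000000000000408000000000000080400,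
   0x80020000000000004004000000000000200800000000000010100000000000000800004000000000040000800000000002000100000000000100020000000000008004000000000000400800000000000020100000000008000020000000000400004000000000020000800000000001000100000000000100010000000000020000800000000004000040000000000800002000000000000020100000000000004008000000000000800400000000000100020000000000020001000000000004000080000000000800004000000000101000000000000020080000000000004004000000000000800200000000000000000002000010000000000100002000000000008000400000000000400080000000000020010000000000001002000000000000080400000000000004080000000000000210000000000000012000000000000000c000000000002000000100000000100000020000000008000004000000000400000800000000000804000000000000100200000000000020010000000000004000800000000000800040000000000100002000000000020000100000000004000008000000000800000400000000100000020000000020000001000000000000c000000000000001200000000000000210000000000000040800,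
   0x1000400000000000080080000000000004010000000000000200000400000000010000080000000000800010000000000040002000000000002000400000000000100080000000000008010000000000000402000000000000020400000000008000080000000000400010000000000020002000000000002000200000000000400010000000000080000800000000000002040000000000000402000000000000080100000000000010008000000000002000400000000000400020000000000080001000000000010000080000000002000004000000000401000000000000080080000000000010004000000000000000000040000080000000002000010000000000100002000000000008000400000000000400080000000000020010000000000001002000000000000080400000000000004080000000000000210000000000000012000000000000000c000000000002000000100000000100000020000000008000004000000000004080000000000000804000000000000100200000000000020010000000000004000800000000000800040000000000100002000000000020000100000000004000008000000000800000400000000100000020000000020000001000000000000c00000000000000120000000000000021000,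
   0x20008000000000001001000000000000080000040000000004000008000000000200001000000000010000200000000000800040000000000040008000000000002001000000000000100200000000000008040000000000000408000000000000021000000000008000200000000000400040000000000040004000000000008000200000000000000210000000000000040800000000000008040000000000001002000000000000200100000000000040008000000000008000400000000001000020000000000200001000000000040000080000000008000004000000001001000000000000200080000000000000000000800000400000000040000080000000002000010000000000100002000000000008000400000000000400080000000000020010000000000001002000000000000080400000000000004080000000000000210000000000000012000000000000000c000000000002000000100000000100000020000000000021000000000000004080000000000000804000000000000100200000000000020010000000000004000800000000000800040000000000100002000000000020000100000000004000008000000000800000400000000100000020000000020000001000000000000c0000000000000012000,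
   0x400100000000000020000004000000001000000800000000080000100000000004000020000000000200004000000000010000800000000000800100000000000040020000000000002004000000000000100800000000000008100000000000000420000000000000024000000000008000800000000000800080000000000000024000000000000004200000000000000810000000000000100800000000000020040000000000004002000000000000800100000000000100008000000000020000400000000004000020000000000800001000000000100000080000000020000004000000004001000000000000000000010000002000000000800000400000000040000080000000002000010000000000100002000000000008000400000000000400080000000000020010000000000001002000000000000080400000000000004080000000000000210000000000000012000000000000000c000000000002000000100000000000120000000000000021000000000000004080000000000000804000000000000100200000000000020010000000000004000800000000000800040000000000100002000000000020000100000000004000008000000000800000400000000100000020000000020000001000000000000c000,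
   0x800080000000000100010000000000020002000000000004000400000000000800080000000000100010000000000020002000000000000000c00000000000000100010000000000020002000000000004000400000000000800080000000000100010000000000020002000000000004000400000000000800080000000000100010000000000020002000000000004000400000000000800080000000000100010000000000020002000000000000000c0000000000000010001000000000002000200000000000400040000000000080008000000000010001000000000002000200000000000400040002000400000000000400080000000000080010000000000010002000000000002000400000000000400080000000000080010000000000000002000400000000000400080000000000080010000000000010002000000000002000400000000000400080000000000080010000000000010002000000000001000200000000000200040000000000040008000000000008001000000000001000200000000000200040000000000040008000000000008001000000000000000200040000000000040008000000000008001000000000001000200000000000200040000000000040008000000000008001000000000,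
   0x100004000000000020000800000000004000100000000000800020000000000100004000000000020000800000000000000900000000000000120000000000000024000000000000004000100000000000800020000000000100004000000000020000800000000004000100000000000800020000000000100004000000000020000800000000004000100000000000800020000000000100004000000000020000800000000000000900000000000000120000000000000024000000000000004000100000000000800020000000000100004000000000020000800000000004000100000000000800020004000800000000000800100000000000100020000000000020004000000000004000800000000000800100000000000000020004000000000004000800000000000800100000000000100020000000000020004000000000004000800000000000800100000000000100020000000000020004000000000000800100000000000100020000000000020004000000000004000800000000000800100000000000100020000000000020004000000000004000800000000000800100000000000000020004000000000004000800000000000800100000000000100020000000000020004000000000004000800000000,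
   0x200002000000000040000400000000008000080000000001000010000000000200002000000000000008400000000000001080000000000000210000000000000042000000000000008400000000000001000010000000000200002000000000040000400000000008000080000000001000010000000000200002000000000040000400000000008000080000000001000010000000000200002000000000000008400000000000001080000000000000210000000000000042000000000000008400000000000001000010000000000200002000000000040000400000000008000080000000001000010008001000000000001000200000000000200040000000000040008000000000008001000000000000000200040000000000040008000000000008001000000000001000200000000000200040000000000040008000000000008001000000000001000200000000000200040000000000040008000000000000400080000000000080010000000000010002000000000002000400000000000400080000000000080010000000000010002000000000002000400000000000400080000000000080010000000000000002000400000000000400080000000000080010000000000010002000000000002000400000000,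
   0x400001000000000080000200000000010000040000000002000008000000000000081000000000000010200000000000002040000000000000408000000000000081000000000000010200000000000002040000000000000400001000000000080000200000000010000040000000002000008000000000400001000000000080000200000000010000040000000002000008000000000000081000000000000010200000000000002040000000000000408000000000000081000000000000010200000000000002040000000000000400001000000000080000200000000010000040000000002000008010002000000000002000400000000000400080000000000080010000000000000002000400000000000400080000000000080010000000000010002000000000002000400000000000400080000000000080010000000000010002000000000002000400000000000400080000000000080010000000000000200040000000000040008000000000008001000000000001000200000000000200040000000000040008000000000008001000000000001000200000000000200040000000000040008000000000008001000000000000000200040000000000040008000000000008001000000000001000200000000,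
   0x800000800000000100000100000000020000020000000000000804000000000000100800000000000020100000000000004020000000000000804000000000000100800000000000020100000000000004020000000000000804000000000000100000100000000020000020000000004000004000000000800000800000000100000100000000020000020000000000000804000000000000100800000000000020100000000000004020000000000000804000000000000100800000000000020100000000000004020000000000000804000000000000100000100000000020000020000000004000004020004000000000004000800000000000800100000000000000020004000000000004000800000000000800100000000000100020000000000020004000000000004000800000000000800100000000000100020000000000020004000000000004000800000000000800100000000000100020000000000000100020000000000020004000000000004000800000000000800100000000000100020000000000020004000000000004000800000000000800100000000000100020000000000020004000000000004000800000000000800100000000000000020004000000000004000800000000000800100000000,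
   0x1000000400000000200000080000000000008010000000000001002000000000000200400000000000040080000000000008010000000000001002000000000000200400000000000040080000000000008010000000000001002000000000000200400000000000040000010000000008000002000000001000000400000000200000080000000000008010000000000001002000000000000200400000000000040080000000000008010000000000001002000000000000200400000000000040080000000000008010000000000001002000000000000200400000000000040000010000000008000002040008000000000008001000000000000000200040000000000040008000000000008001000000000001000200000000000200040000000000040008000000000008001000000000001000200000000000200040000000000040008000000000008001000000000001000200000000000200040000000000000080010000000000010002000000000002000400000000000400080000000000080010000000000010002000000000002000400000000000400080000000000080010000000000010002000000000002000400000000000400080000000000080010000000000000002000400000000000400080000000,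
   0x2000000200000000000080040000000000010008000000000002001000000000000400200000000000080040000000000010008000000000002001000000000000400200000000000080040000000000010008000000000002001000000000000400200000000000080040000000000010000001000000002000000200000000000080040000000000010008000000000002001000000000000400200000000000080040000000000010008000000000002001000000000000400200000000000080040000000000010008000000000002001000000000000400200000000000080040000000000010000001080010000000000000002000400000000000400080000000000080010000000000010002000000000002000400000000000400080000000000080010000000000010002000000000002000400000000000400080000000000080010000000000010002000000000002000400000000000400080000000000000040008000000000008001000000000001000200000000000200040000000000040008000000000008001000000000001000200000000000200040000000000040008000000000008001000000000001000200000000000200040000000000040008000000000008001000000000000000200040000000]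

/-- The exclusive or of those numbers in the list at whose position `n` has a bit. -/
def selectXor : List ℕ → ℕ → ℕ
  | [], _ => 0
  | m :: l, n => Nat.xor (Nat.mul (Nat.mod n 2) m) (selectXor l (Nat.div n 2))

/-- The bits of the matrix constructed from `quad n`, in lanes of length `64`. -/
def matrixBits (n : ℕ) : ℕ := Nat.xor negMask (selectXor termMasks n)

/-- The bits of a row of the matrix constructed from `quad n`. -/
def rowBits (n i : ℕ) : ℕ :=
  Nat.mod (Nat.shiftRight (matrixBits n) (Nat.mul 64 i)) 1152921504606846976

theorem rowBits_lt (n i : ℕ) : rowBits n i < 2 ^ 60 := Nat.mod_lt _ (by norm_num)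

/-- The `t`-th number of the list, and only this, has the bit `k`. -/
def onlyBit (k : ℕ) : List ℕ → ℕ → Bool
  | [], _ => false
  | m :: l, 0 => m.testBit k && l.all fun m' => !m'.testBit k
  | m :: l, t + 1 => !m.testBit k && onlyBit k l t

theorem testBit_mod_two_mul (n m k : ℕ) :
    (n % 2 * m).testBit k = (n.testBit 0 && m.testBit k) := by
  rcases Nat.mod_two_eq_zero_or_one n with h | h <;> simp [h, Nat.testBit_zero]

theorem testBit_selectXor_of_all {k : ℕ} {l : List ℕ} (h : l.all (fun m => !m.testBit k) = true)
    (n : ℕ) : (selectXor l n).testBit k = false := by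
  induction l generalizing n with
  | nil => simp [selectXor]
  | cons m l ih =>
    simp only [List.all_cons, Bool.and_eq_true, Bool.not_eq_true'] at h
    change (n % 2 * m ^^^ selectXor l (n / 2)).testBit k = _
    rw [Nat.testBit_xor, testBit_mod_two_mul, h.1, ih h.2]
    simp

theorem testBit_selectXor {k t : ℕ} {l : List ℕ} (h : onlyBit k l t = true) (n : ℕ) :
    (selectXor l n).testBit k = n.testBit t := by
  induction l generalizing n t with
  | nil => simp [onlyBit] at h
  | cons m l ih =>
    change (n % 2 * m ^^^ selectXor l (n / 2)).testBit k = _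
    rw [Nat.testBit_xor, testBit_mod_two_mul]
    cases t with
    | zero =>
      simp only [onlyBit, Bool.and_eq_true] at h
      rw [h.1, testBit_selectXor_of_all h.2]
      simp
    | succ t =>
      simp only [onlyBit, Bool.and_eq_true, Bool.not_eq_true'] at h
      rw [h.1, ih h.2, Nat.testBit_succ]
      simp

/-- Certifies the numerals `negMask` and `termMasks` against the formula for the entries. Each
position belongs to exactly one of the 30 masks, so the exclusive or of the masks selected by `n`
reads off one bit of `n` there. -/
theorem masks_spec : allBelow 60 (fun r => allBelow 60 fun c =>
    (negMask.testBit (64 * r + c) == (entryCode r c).testBit 5) &&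
      onlyBit (64 * r + c) termMasks (entryCode r c % 32)) = true := by
  decide +kernel

theorem hadMat_quad_apply (n : ℕ) (r c : Fin 60) :
    hadMat (quad n) r c = (bitSign (rowBits n r) c : ℤˣ) := by
  have h := of_allBelow (of_allBelow masks_spec r.2) c.2
  simp only [Bool.and_eq_true, beq_iff_eq] at h
  obtain ⟨h1, h2⟩ := h
  have h3 : (rowBits n r).testBit c =
      ((entryCode r c).testBit 5 ^^ n.testBit (entryCode r c % 32)) := by
    change ((matrixBits n >>> (64 * (r : ℕ))) % 2 ^ 60).testBit c = _
    rw [Nat.testBit_mod_two_pow, Nat.testBit_shiftRight, decide_eq_true c.2, Bool.true_and]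
    change (negMask ^^^ selectXor termMasks n).testBit _ = _
    rw [Nat.testBit_xor, h1, testBit_selectXor h2]
  have h4 : ∀ y k, bitSign y k = boolSign (y.testBit k) := by
    intro y k
    cases h : y.testBit k <;> simp [bitSign, boolSign, h]
  rw [hadMat_apply_eq_codeTerm, codeTerm, terms_quad, h4, h4, h3, boolSign_xor, Fin.ofNat_eq_cast,
    Fin.val_natCast, Nat.mod_eq_of_lt (entryCode_lt r.2 c.2).1]

/-! ### Base sequences in terms of aperiodic autocorrelations -/

open LaurentPolynomial in
theorem coeff_seqNorm {m : ℕ} (a : Fin m → ℤˣ) (k : ℤ) :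
    (seqNorm a).coeff k =
      ∑ i : Fin m, ∑ j : Fin m, if ((i : ℕ) : ℤ) - (j : ℕ) = k then ((a i * a j : ℤˣ) : ℤ) else 0 := by
  have h : seqNorm a = ∑ i : Fin m, ∑ j : Fin m,
      C ((a i * a j : ℤˣ) : ℤ) * T (((i : ℕ) : ℤ) - (j : ℕ)) := by
    unfold seqNorm seqPoly
    rw [map_sum, Finset.sum_mul_sum]
    refine Finset.sum_congr rfl fun i _ => Finset.sum_congr rfl fun j _ => ?_
    rw [map_mul, invert_C, invert_T, sub_eq_add_neg, T_add, Units.val_mul, map_mul]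
    ring
  rw [h]
  simp only [AddMonoidAlgebra.coeff_sum, Finset.sum_apply', ← single_eq_C_mul_T,
    AddMonoidAlgebra.coeff_single, Finsupp.single_apply]

/-- The aperiodic autocorrelation of a sequence of length `m` at distance `s`. -/
def autocorr (m : ℕ) (a : ℕ → ℤˣ) (s : ℕ) : ℤ := ∑ j ∈ Finset.range (m - s), ((a (j + s) * a j : ℤˣ) : ℤ)

theorem sum_ite_sub_eq (m : ℕ) (a : ℕ → ℤˣ) (s : ℕ) :
    (∑ i : Fin m, ∑ j : Fin m, if ((i : ℕ) : ℤ) - (j : ℕ) = s then ((a i * a j : ℤˣ) : ℤ) else 0) =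
      autocorr m a s := by
  rw [Finset.sum_comm]
  have h1 : ∀ j : Fin m, (∑ i : Fin m, if ((i : ℕ) : ℤ) - (j : ℕ) = s then ((a i * a j : ℤˣ) : ℤ) else 0)
      = if (j : ℕ) < m - s then ((a (j + s) * a j : ℤˣ) : ℤ) else 0 := by
    intro j
    split_ifs with h
    · rw [Finset.sum_eq_single (⟨j + s, by omega⟩ : Fin m)]
      · simp
      · intro i _ hi
        rw [if_neg]
        intro hij
        exact hi (Fin.ext (by dsimp only; omega))
      · simp
    · refine Finset.sum_eq_zero fun i _ => if_neg ?_
      have := i.2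
      omega
  rw [Finset.sum_congr rfl fun j _ => h1 j,
    Fin.sum_univ_eq_sum_range (fun j => if j < m - s then ((a (j + s) * a j : ℤˣ) : ℤ) else 0) m,
    ← Finset.sum_filter, autocorr]
  congr 1
  ext j
  simp only [Finset.mem_filter, Finset.mem_range]
  omega

/-- N(A) is symmetric under z ↦ z⁻¹, so only the absolute value of the exponent matters. -/
theorem coeff_seqNorm_eq_autocorr {m : ℕ} (a : ℕ → ℤˣ) (k : ℤ) :
    (seqNorm fun i : Fin m => a i).coeff k = autocorr m a k.natAbs := by
  rw [coeff_seqNorm, ← sum_ite_sub_eq]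
  rcases Int.natAbs_eq k with h | h
  · rw [← h]
  · rw [Finset.sum_comm]
    refine Finset.sum_congr rfl fun i _ => Finset.sum_congr rfl fun j _ => ?_
    rw [mul_comm (a i)]
    exact if_congr (by omega) rfl rfl

/-- The constant coefficient is 8 + 8 + 7 + 7 = 30 for all sequences, and no two terms have a
distance greater than 7; only the distances 1 to 7 impose conditions. -/
theorem isBaseSequences_iff_autocorr (a b c d : ℕ → ℤˣ) :
    IsBaseSequences (⟨fun i => a i, fun i => b i, fun i => c i, fun i => d i⟩ : BinaryQuad 8 7) ↔
      ∀ s ∈ Finset.Icc 1 7, autocorr 8 a s + autocorr 8 b s + autocorr 7 c s + autocorr 7 d s = 0 := by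
  have h0 : ∀ (m : ℕ) (a : ℕ → ℤˣ), autocorr m a 0 = m := by
    intro m a
    simp [autocorr, Int.units_mul_self]
  have h8 : ∀ (m s : ℕ) (a : ℕ → ℤˣ), m ≤ s → autocorr m a s = 0 := by
    intro m s a h
    simp [autocorr, Nat.sub_eq_zero_of_le h]
  have hk : IsBaseSequences
      (⟨fun i => a i, fun i => b i, fun i => c i, fun i => d i⟩ : BinaryQuad 8 7) ↔
      ∀ k : ℤ, autocorr 8 a k.natAbs + autocorr 8 b k.natAbs + autocorr 7 c k.natAbs +
        autocorr 7 d k.natAbs = if k = 0 then 30 else 0 := by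
    unfold IsBaseSequences
    constructor
    · intro h k
      have := congrArg (fun p : LaurentPolynomial ℤ => p.coeff k) h
      simpa [coeff_seqNorm_eq_autocorr, Finsupp.single_apply, eq_comm (a := (0 : ℤ))] using this
    · intro h
      refine LaurentPolynomial.ext fun k => ?_
      simpa [coeff_seqNorm_eq_autocorr, Finsupp.single_apply, eq_comm (a := (0 : ℤ))] using h k
  rw [hk]
  constructor
  · intro h s hs
    have hs := (Finset.mem_Icc.1 hs).1
    simpa [show s ≠ 0 by omega] using h s
  · intro h k
    split_ifs with h1
    · subst h1
      simp [h0]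
    · by_cases h2 : k.natAbs ≤ 7
      · exact h _ (Finset.mem_Icc.2 ⟨by omega, h2⟩)
      · simp [h8 8 _ _ (show 8 ≤ k.natAbs by omega), h8 7 _ _ (show 7 ≤ k.natAbs by omega)]

/-! ### Codes of binary sequences -/

/-- The number of bits set among the first `k` bits of `w`. -/
def countBits : ℕ → ℕ → ℕ
  | 0, _ => 0
  | k + 1, w => Nat.add (Nat.mod w 2) (countBits k (Nat.div w 2))

theorem countBits_le (k w : ℕ) : countBits k w ≤ k := by
  induction k generalizing w with
  | zero => exact le_rfl
  | succ k ih =>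
    have := ih (w / 2)
    change w % 2 + countBits k (w / 2) ≤ _
    omega

theorem sum_bitSign (k w : ℕ) :
    ∑ j ∈ Finset.range k, ((bitSign w j : ℤˣ) : ℤ) = k - 2 * countBits k w := by
  induction k generalizing w with
  | zero => simp [countBits]
  | succ k ih =>
    have h : countBits (k + 1) w = w % 2 + countBits k (w / 2) := rfl
    rw [Finset.sum_range_succ', h]
    have h1 : ∀ j, bitSign w (j + 1) = bitSign (w / 2) j := by
      intro j
      simp [bitSign, Nat.testBit_succ]
    simp only [h1]
    rw [ih]
    rcases Nat.mod_two_eq_zero_or_one w with h2 | h2 <;> simp [bitSign, Nat.testBit_zero, h2] <;> ring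

/-- The number of pairs of different terms at distance `s` in `seq m n`. -/
def disagree (m n s : ℕ) : ℕ := countBits (Nat.sub m s) (Nat.xor n (Nat.shiftRight n s))

theorem autocorr_bitSign (m s n : ℕ) :
    autocorr m (bitSign n) s = (m - s : ℕ) - 2 * (disagree m n s : ℤ) := by
  unfold autocorr disagree
  change _ = ((m - s : ℕ) : ℤ) - 2 * (countBits (m - s) (n ^^^ n >>> s) : ℤ)
  rw [← sum_bitSign]
  refine Finset.sum_congr rfl fun j _ => ?_
  rw [bitSign_xor, mul_comm]
  congr 2
  simp [bitSign, Nat.testBit_shiftRight, add_comm]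

/-- The numbers `disagree m n s` for `s = 1, …, 7`, as digits to the base `64`. -/
def profile (m n : ℕ) : ℕ :=
  Nat.add (disagree m n 1) (Nat.mul 64 (Nat.add (disagree m n 2) (Nat.mul 64 (Nat.add (disagree m n 3)
    (Nat.mul 64 (Nat.add (disagree m n 4) (Nat.mul 64 (Nat.add (disagree m n 5)
      (Nat.mul 64 (Nat.add (disagree m n 6) (Nat.mul 64 (disagree m n 7))))))))))))

/-- The quadruple of sequences with the given codes. -/
def mkq (a b c d : ℕ) : BinaryQuad 8 7 := ⟨seq 8 a, seq 8 b, seq 7 c, seq 7 d⟩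

/-- The sum of the profiles of base sequences. -/
def profileTotal : ℕ := 13 + 64 * (11 + 64 * (9 + 64 * (7 + 64 * (5 + 64 * (3 + 64 * 1)))))

/-- At distance s there are 2(8 − s) + 2(7 − s) = 30 − 4s products, so they cancel exactly if 15 −
2s of them are −1. These are the digits 13, 11, …, 1 of `profileTotal`. Four counts add up to at
most 32, so there are no carries to the base 64, and one equation of numbers expresses seven
equations. -/
theorem isBaseSequences_mkq (a b c d : ℕ) : IsBaseSequences (mkq a b c d) ↔
    profile 8 a + profile 8 b + profile 7 c + profile 7 d = profileTotal := by
  have h := isBaseSequences_iff_autocorr (bitSign a) (bitSign b) (bitSign c) (bitSign d)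
  have h1 : ∀ s ∈ Finset.Icc 1 7, autocorr 8 (bitSign a) s + autocorr 8 (bitSign b) s +
      autocorr 7 (bitSign c) s + autocorr 7 (bitSign d) s = 0 ↔
      disagree 8 a s + disagree 8 b s + disagree 7 c s + disagree 7 d s + 2 * s = 15 := by
    intro s hs
    have hs := Finset.mem_Icc.1 hs
    rw [autocorr_bitSign, autocorr_bitSign, autocorr_bitSign,
      autocorr_bitSign]
    omega
  have h2 : ∀ m ≤ 8, ∀ n s, disagree m n s ≤ 8 := fun m hm n s =>
    (countBits_le _ _).trans ((Nat.sub_le m s).trans hm)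
  have h3 : ∀ s, disagree 8 a s + disagree 8 b s + disagree 7 c s + disagree 7 d s < 64 := by
    intro s
    have := h2 8 le_rfl a s
    have := h2 8 le_rfl b s
    have := h2 7 (by norm_num) c s
    have := h2 7 (by norm_num) d s
    omega
  have h4 : ∀ {u t P Q : ℕ}, u < 64 → t < 64 → (u + 64 * P = t + 64 * Q ↔ u = t ∧ P = Q) := by
    omega
  have hp : profile 8 a + profile 8 b + profile 7 c + profile 7 d =
      (fun f : ℕ → ℕ => f 1 + 64 * (f 2 + 64 * (f 3 + 64 * (f 4 + 64 * (f 5 + 64 * (f 6 + 64 * f 7))))))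
        fun s => disagree 8 a s + disagree 8 b s + disagree 7 c s + disagree 7 d s := by
    have hp : ∀ m n, profile m n = disagree m n 1 + 64 * (disagree m n 2 + 64 * (disagree m n 3 +
      64 * (disagree m n 4 + 64 * (disagree m n 5 + 64 * (disagree m n 6 + 64 * disagree m n 7))))) :=
      fun _ _ => rfl
    rw [hp, hp, hp, hp]
    ring
  rw [hp, profileTotal]
  refine h.trans ((forall₂_congr h1).trans ?_)
  generalize hf : (fun s => disagree 8 a s + disagree 8 b s + disagree 7 c s + disagree 7 d s) = f
  have hf' : ∀ s, disagree 8 a s + disagree 8 b s + disagree 7 c s + disagree 7 d s = f s :=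
    fun s => congrFun hf s
  simp only [hf'] at h3 ⊢
  rw [h4 (h3 1) (by norm_num), h4 (h3 2) (by norm_num), h4 (h3 3) (by norm_num),
    h4 (h3 4) (by norm_num), h4 (h3 5) (by norm_num), h4 (h3 6) (by norm_num)]
  constructor
  · intro H
    have H1 := H 1 (by simp)
    have H2 := H 2 (by simp)
    have H3 := H 3 (by simp)
    have H4 := H 4 (by simp)
    have H5 := H 5 (by simp)
    have H6 := H 6 (by simp)
    have H7 := H 7 (by simp)
    omega
  · rintro ⟨H1, H2, H3, H4, H5, H6, H7⟩ s hs
    obtain ⟨hs1, hs2⟩ := Finset.mem_Icc.1 hs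
    interval_cases s <;> omega

/-- The code of the negated sequence. -/
def negCode (m n : ℕ) : ℕ := Nat.xor n (Nat.sub (Nat.pow 2 m) 1)

/-- The code of the reversed sequence. -/
def revCode : ℕ → ℕ → ℕ
  | 0, _ => 0
  | m + 1, n => Nat.add (Nat.mul (Nat.pow 2 m) (Nat.mod n 2)) (revCode m (Nat.div n 2))

/-- The code of the alternated sequence, for lengths up to `8`. -/
def altCode (m n : ℕ) : ℕ := Nat.xor n (Nat.mod 170 (Nat.pow 2 m))

/-- The positions in the quads `[+ -; - +]` and `[- +; + -]` of `(seq m c; seq m d)`. -/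
def diagMask (m c d : ℕ) : ℕ :=
  Nat.land (Nat.land (Nat.xor c (revCode m c)) (Nat.xor c d))
    (Nat.xor (Nat.xor c (revCode m d)) (Nat.sub (Nat.pow 2 m) 1))

theorem revCode_lt (m n : ℕ) : revCode m n < 2 ^ m := by
  induction m generalizing n with
  | zero => simp [revCode]
  | succ m ih =>
    have h := ih (n / 2)
    change 2 ^ m * (n % 2) + revCode m (n / 2) < _
    rcases Nat.mod_two_eq_zero_or_one n with h1 | h1 <;> rw [h1, pow_succ] <;> omega

theorem testBit_revCode (m n i : ℕ) :
    (revCode m n).testBit i = (decide (i < m) && n.testBit (m - 1 - i)) := by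
  induction m generalizing n with
  | zero => simp [revCode]
  | succ m ih =>
    change (2 ^ m * (n % 2) + revCode m (n / 2)).testBit i = _
    rw [Nat.testBit_two_pow_mul_add _ (revCode_lt _ _), ih]
    by_cases h : i < m
    · rw [if_pos h, show m + 1 - 1 - i = (m - 1 - i) + 1 by omega, Nat.testBit_succ]
      simp [h, show i < m + 1 by omega]
    · rw [if_neg h]
      rcases Nat.lt_or_eq_of_le (Nat.le_of_not_lt h) with h1 | h1
      · have h2 : (n % 2).testBit (i - m) = false :=
          Nat.testBit_lt_two_pow (lt_of_lt_of_le (Nat.mod_lt _ two_pos)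
            (Nat.le_self_pow (by omega) 2))
        simp [h2, show ¬ i < m + 1 by omega]
      · subst h1
        simp [Nat.testBit_zero]

theorem seq_negCode (m n : ℕ) : seq m (negCode m n) = -seq m n := by
  ext1 i
  change bitSign (n ^^^ (2 ^ m - 1)) i = -bitSign n i
  rw [bitSign_xor]
  simp [bitSign, Nat.testBit_two_pow_sub_one]

theorem seq_revCode (m n : ℕ) : seq m (revCode m n) = revSeq (seq m n) := by
  ext1 i
  change bitSign (revCode m n) i = bitSign n (i.rev : Fin m)
  simp only [bitSign, testBit_revCode, i.2, Fin.val_rev, decide_true, Bool.true_and]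
  rw [show m - 1 - (i : ℕ) = m - (i + 1) by omega]

/-- The binary expansion of 170 is 10101010, with ones at the odd positions counted from 0. -/
theorem seq_altCode {m : ℕ} (hm : m ≤ 8) (n : ℕ) : seq m (altCode m n) = altSeq (seq m n) := by
  ext1 i
  change bitSign (n ^^^ (170 % 2 ^ m)) i = (-1) ^ (i : ℕ) * bitSign n i
  rw [bitSign_xor, mul_comm]
  congr 1
  have h := i.2
  unfold bitSign
  rw [Nat.testBit_mod_two_pow, decide_eq_true h, Bool.true_and]
  have h8 : (i : ℕ) < 8 := by omega
  revert h8
  generalize (i : ℕ) = j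
  intro h8
  interval_cases j <;> decide

/-- The three factors of `diagMask` mark the positions where c differs from its reversal, where c
differs from d, and where c agrees with the reversal of d. -/
theorem isDiagQuad_seq (m c d : ℕ) (i : Fin m) :
    IsDiagQuad (seq m c) (seq m d) i ↔ (diagMask m c d).testBit i = true := by
  have h1 := congrFun (seq_revCode m c) i
  have h2 := congrFun (seq_revCode m d) i
  unfold IsDiagQuad
  change seq m c i.rev = _ ∧ _ ∧ seq m d i.rev = _ ↔ _
  change _ = seq m c i.rev at h1
  change _ = seq m d i.rev at h2
  rw [← h1, ← h2]
  change bitSign _ _ = - bitSign _ _ ∧ bitSign _ _ = -bitSign _ _ ∧ bitSign _ _ = bitSign _ _ ↔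
    (((c ^^^ revCode m c) &&& (c ^^^ d)) &&& ((c ^^^ revCode m d) ^^^ (2 ^ m - 1))).testBit i = true
  simp only [Nat.testBit_and, Nat.testBit_xor, Nat.testBit_two_pow_sub_one, i.2, bitSign]
  generalize c.testBit i = x
  generalize d.testBit i = y
  generalize (revCode m c).testBit i = z
  generalize (revCode m d).testBit i = w
  cases x <;> cases y <;> cases z <;> cases w <;> decide

theorem seq_quadSwap (m c d s : ℕ) :
    seq m (Nat.xor s (diagMask m c d)) = quadSwap (seq m c) (seq m d) (seq m s) := by
  ext1 i
  have h0 : seq m (Nat.xor s (diagMask m c d)) i = bitSign s i * bitSign (diagMask m c d) i :=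
    bitSign_xor _ _ _
  have h1 := isDiagQuad_seq m c d i
  rw [h0, quadSwap]
  split_ifs with h
  · simp [bitSign, seq, h1.1 h]
  · simp [bitSign, seq, Bool.eq_false_iff.2 (mt h1.2 h)]

/-- The code of a sequence. -/
def codeOf {m : ℕ} (a : Fin m → ℤˣ) : ℕ := Nat.ofBits fun i => decide (a i = -1)

theorem codeOf_lt {m : ℕ} (a : Fin m → ℤˣ) : codeOf a < 2 ^ m := Nat.ofBits_lt_two_pow _

theorem seq_codeOf {m : ℕ} (a : Fin m → ℤˣ) : seq m (codeOf a) = a := by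
  ext1 i
  change (if (codeOf a).testBit i then (-1 : ℤˣ) else 1) = a i
  rw [codeOf, Nat.testBit_ofBits_lt _ _ i.2]
  rcases Int.units_eq_one_or (a i) with h | h <;> simp [h]

theorem seq_injOn {m k n : ℕ} (hk : k < 2 ^ m) (hn : n < 2 ^ m) (h : seq m k = seq m n) : k = n := by
  refine Nat.eq_of_testBit_eq fun i => ?_
  by_cases hi : i < m
  · have h1 : bitSign k i = bitSign n i := congrFun h ⟨i, hi⟩
    unfold bitSign at h1
    cases h2 : k.testBit i <;> cases h3 : n.testBit i <;> simp [h2, h3] at h1 ⊢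
  · rw [Nat.testBit_lt_two_pow (lt_of_lt_of_le hk (Nat.pow_le_pow_right two_pos (not_lt.1 hi))),
      Nat.testBit_lt_two_pow (lt_of_lt_of_le hn (Nat.pow_le_pow_right two_pos (not_lt.1 hi)))]

/-! ### The classification of `BS(8, 7)` -/

/-- The least code of the sequences obtained from `seq m n` by negation and reversal. -/
def canon (m n : ℕ) : ℕ :=
  Nat.min (Nat.min n (negCode m n)) (Nat.min (revCode m n) (negCode m (revCode m n)))

/-- The codes of the sequences obtained from `seq m n` by negation and reversal. -/
def orbit (m n : ℕ) : List ℕ := [n, negCode m n, revCode m n, negCode m (revCode m n)]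

theorem canon_mem_orbit (m n : ℕ) : canon m n ∈ orbit m n := by
  have h : ∀ a b : ℕ, Nat.min a b = a ∨ Nat.min a b = b := fun a b => by
    rcases le_total a b with h | h
    · exact Or.inl (min_eq_left h)
    · exact Or.inr (min_eq_right h)
  unfold canon orbit
  rcases h (Nat.min n (negCode m n)) (Nat.min (revCode m n) (negCode m (revCode m n))) with e | e <;>
    rw [e]
  · rcases h n (negCode m n) with e | e <;> rw [e] <;> simp
  · rcases h (revCode m n) (negCode m (revCode m n)) with e | e <;> rw [e] <;> simp

/-- The canonical codes for length `8`, with their profiles. -/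
def canonProfiles₈ : List (ℕ × ℕ) := [
  (0, 0), (1, 69810262081), (2, 1090785346), (3, 70901047425), (4, 17043586), (5, 69827305539),
  (6, 1107828930), (7, 70918090881), (8, 270466), (9, 69810524355), (10, 1091055684),
  (11, 70901309571), (12, 17314050), (13, 69827567811), (14, 1108099266), (15, 70918353025),
  (17, 69810008259), (18, 1091047620), (19, 70900785411), (20, 17313924), (21, 69827051589),
  (22, 1108091076), (23, 70917828739), (24, 540930), (25, 69810270531), (26, 1091317956),
  (27, 70901047555), (28, 17584386), (29, 69827313859), (30, 1108361410), (33, 69793751235),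
  (34, 1107304644), (35, 70884012291), (36, 34078980), (37, 69810786501), (38, 1124340036),
  (41, 69794013381), (42, 1107574854), (43, 70884274309), (44, 34349316), (45, 69811048645),
  (46, 1124610244), (49, 69793497411), (50, 1107566916), (51, 70883750275), (53, 69810532549),
  (54, 1124602180), (57, 69793759555), (58, 1107837124), (60, 34619650), (61, 69810794691),
  (62, 1124872386), (65, 68753563779), (66, 2148016260), (69, 68770082949), (70, 2164535556),
  (73, 68753817861), (74, 2148278406), (77, 68770337029), (78, 2164797700), (81, 68753309829),
  (85, 68769828871), (86, 2164797574), (89, 68753563909), (90, 2148540550), (94, 2165059716),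
  (97, 68737052931), (102, 2181046660), (105, 68737306885), (110, 2181308676),
  (113, 68736798979), (126, 2181570690)]

/-- The canonical codes for length `7`, with their profiles. -/
def canonProfiles₇ : List (ℕ × ℕ) := [
  (0, 0), (1, 1090785345), (2, 17043522), (3, 1107828865), (4, 266370), (5, 1091051587),
  (6, 17309890), (7, 1108095105), (8, 8322), (9, 1090785475), (10, 17051716), (11, 1107828867),
  (12, 274690), (13, 1091051715), (14, 17318082), (17, 1090527427), (18, 17301700),
  (19, 1107562755), (20, 532612), (21, 1090793541), (22, 17567940), (25, 1090527555),
  (26, 17309892), (28, 540930), (29, 1090793667), (30, 17576130), (33, 1074274435),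
  (34, 33562756), (37, 1074532485), (38, 33820932), (41, 1074274437), (42, 33570822),
  (46, 33828996), (49, 1074016515), (54, 34078980), (62, 34087042)]

/-- The properties of the canonical code of `seq m n` that the classification uses. -/
def canonCheck (m : ℕ) (l : List (ℕ × ℕ)) (n : ℕ) : Bool :=
  Nat.beq (profile m (negCode m n)) (profile m n) && (Nat.beq (profile m (revCode m n)) (profile m n) &&
  (Nat.beq (canon m (negCode m n)) (canon m n) && (Nat.beq (canon m (revCode m n)) (canon m n) &&
  (Nat.beq (canon m (altCode m n)) (canon m (altCode m (canon m n))) &&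
  ((orbit m (canon m n)).any (fun k => Nat.beq n k) &&
  l.any fun e => Nat.beq (canon m n) e.1 && Nat.beq (profile m n) e.2)))))

/-- What is used about negation, reversal, alternation and profiles is checked on all 256 sequences
instead of being derived from their symmetries. The check also shows that the list of canonical
codes is complete. -/
theorem canonCheck_eight : allBelow 256 (canonCheck 8 canonProfiles₈) = true := by decide +kernel

theorem canonCheck_seven : allBelow 128 (canonCheck 7 canonProfiles₇) = true := by decide +kernel

/-- `m` is `8` or `7`, and `l` is the list of the canonical codes for length `m`. -/
def IsProfileList (m : ℕ) (l : List (ℕ × ℕ)) : Prop :=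
  m ≤ 8 ∧ ∀ n < 2 ^ m, canonCheck m l n = true

theorem isProfileList_eight : IsProfileList 8 canonProfiles₈ :=
  ⟨le_rfl, fun _ h => of_allBelow canonCheck_eight h⟩

theorem isProfileList_seven : IsProfileList 7 canonProfiles₇ :=
  ⟨by norm_num, fun _ h => of_allBelow canonCheck_seven h⟩

/-! ### Orbits of sequences under negation and reversal -/

section canon

variable {m n : ℕ} {l : List (ℕ × ℕ)}

theorem IsProfileList.spec (h : IsProfileList m l) (hn : n < 2 ^ m) :
    profile m (negCode m n) = profile m n ∧ profile m (revCode m n) = profile m n ∧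
    canon m (negCode m n) = canon m n ∧ canon m (revCode m n) = canon m n ∧
    canon m (altCode m n) = canon m (altCode m (canon m n)) ∧
    n ∈ orbit m (canon m n) ∧ (canon m n, profile m n) ∈ l := by
  have := h.2 n hn
  simpa only [canonCheck, Bool.and_eq_true, Nat.beq_eq, List.any_eq_true, exists_eq_right',
    Prod.exists, ← Prod.mk.injEq, exists_eq_right, Nat.beq_eq_true_eq, ← exists_and_left,
    and_left_comm, exists_eq_left'] using this

theorem negCode_lt (hn : n < 2 ^ m) : negCode m n < 2 ^ m :=
  Nat.xor_lt_two_pow hn (Nat.sub_lt (Nat.two_pow_pos m) one_pos)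

theorem altCode_lt (hn : n < 2 ^ m) : altCode m n < 2 ^ m :=
  Nat.xor_lt_two_pow hn (Nat.mod_lt _ (Nat.two_pow_pos m))

theorem diagMask_lt {c : ℕ} (hc : c < 2 ^ m) (d : ℕ) : diagMask m c d < 2 ^ m :=
  Nat.and_lt_two_pow _ (Nat.xor_lt_two_pow (Nat.xor_lt_two_pow hc (revCode_lt _ _))
    (Nat.sub_lt (Nat.two_pow_pos m) one_pos))

theorem orbit_lt (hn : n < 2 ^ m) {k : ℕ} (hk : k ∈ orbit m n) : k < 2 ^ m := by
  simp only [orbit, List.mem_cons, List.not_mem_nil, or_false] at hk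
  rcases hk with rfl | rfl | rfl | rfl
  exacts [hn, negCode_lt hn, revCode_lt _ _, negCode_lt (revCode_lt _ _)]

theorem canon_lt (hn : n < 2 ^ m) : canon m n < 2 ^ m := orbit_lt hn (canon_mem_orbit m n)

theorem IsProfileList.canon_orbit (h : IsProfileList m l) (hn : n < 2 ^ m) {k : ℕ}
    (hk : k ∈ orbit m n) : canon m k = canon m n := by
  have h1 := h.spec hn
  have h2 := h.spec (revCode_lt m n)
  simp only [orbit, List.mem_cons, List.not_mem_nil, or_false] at hk
  rcases hk with rfl | rfl | rfl | rfl
  exacts [rfl, h1.2.2.1, h1.2.2.2.1, h2.2.2.1.trans h1.2.2.2.1]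

theorem IsProfileList.profile_orbit (h : IsProfileList m l) (hn : n < 2 ^ m) {k : ℕ}
    (hk : k ∈ orbit m n) : profile m k = profile m n := by
  have h1 := h.spec hn
  have h2 := h.spec (revCode_lt m n)
  simp only [orbit, List.mem_cons, List.not_mem_nil, or_false] at hk
  rcases hk with rfl | rfl | rfl | rfl
  exacts [rfl, h1.1, h1.2.1, h2.1.trans h1.2.1]

end canon

/-- A pair of codes, the smaller first. -/
def sortPair (a b : ℕ) : ℕ × ℕ := bif Nat.ble a b then (a, b) else (b, a)

theorem sortPair_comm (a b : ℕ) : sortPair a b = sortPair b a := by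
  unfold sortPair
  rcases lt_trichotomy a b with h | rfl | h
  · simp [Bool.cond_eq_ite, h.le, not_le.2 h]
  · rfl
  · simp [Bool.cond_eq_ite, h.le, not_le.2 h]

theorem sortPair_eq {a b p q : ℕ} (h : sortPair a b = (p, q)) : a = p ∧ b = q ∨ a = q ∧ b = p := by
  unfold sortPair at h
  cases h1 : Nat.ble a b <;> rw [h1] at h <;> simp only [cond_true, cond_false, Prod.mk.injEq] at h <;>
    simp [h]

/-- The base sequences whose codes, up to negation and reversal, are `p₁ < p₂` for `A` and `B` and
`q₁ < q₂` for `C` and `D`, the row of the table of their class, and a list of elementary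
transformations which leads to the representative of the class. -/
structure KeyEntry where
  p₁ : ℕ
  p₂ : ℕ
  q₁ : ℕ
  q₂ : ℕ
  cls : ℕ
  word : List ℕ

/-- All base sequences in `BS(8, 7)` up to negation, reversal and interchange. -/
def keyTable : List KeyEntry := [
  ⟨13, 20, 9, 29, 0, [8, 7, 6, 5, 4]⟩,
  ⟨26, 65, 9, 29, 0, [5, 11, 9, 8, 3, 2]⟩,
  ⟨13, 20, 5, 25, 1, [8, 7, 6, 5, 4]⟩,
  ⟨13, 20, 13, 17, 1, [3, 10, 9, 8, 5, 4, 2]⟩,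
  ⟨26, 65, 5, 25, 1, [5, 11, 8, 3, 2]⟩,
  ⟨26, 65, 13, 17, 1, [5, 11, 10, 9, 8, 3, 2]⟩,
  ⟨12, 13, 9, 21, 2, [7, 6, 5, 4]⟩,
  ⟨26, 89, 1, 29, 2, [5, 11, 9, 8, 3, 2]⟩,
  ⟨17, 44, 5, 13, 3, [8, 7, 6, 5]⟩,
  ⟨34, 97, 5, 13, 3, [5, 11, 8, 3, 2]⟩,
  ⟨17, 44, 3, 41, 4, [8, 7, 6, 5]⟩,
  ⟨17, 44, 11, 33, 4, [3, 10, 9, 8, 5, 2]⟩,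
  ⟨34, 97, 3, 41, 4, [5, 11, 9, 8, 7, 6]⟩,
  ⟨34, 97, 11, 33, 4, [5, 11, 2, 10, 8, 2]⟩,
  ⟨6, 97, 9, 21, 5, [5, 11, 9, 8, 3, 2]⟩,
  ⟨44, 53, 1, 29, 5, [7, 6, 5]⟩,
  ⟨18, 19, 10, 30, 6, [7, 6, 5, 4]⟩,
  ⟨29, 70, 2, 22, 6, [5, 11, 0]⟩,
  ⟨5, 70, 6, 26, 7, [5, 11, 9, 0]⟩,
  ⟨5, 70, 14, 18, 7, [5, 11, 10, 0]⟩,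
  ⟨10, 19, 6, 26, 7, [7, 6, 5, 4]⟩,
  ⟨10, 19, 14, 18, 7, [3, 10, 9, 5, 4, 2]⟩,
  ⟨11, 18, 12, 46, 8, [8, 7, 6, 5, 4]⟩,
  ⟨29, 94, 4, 38, 8, [5, 11, 9, 7, 6, 0]⟩,
  ⟨11, 18, 28, 34, 9, [8, 5, 4]⟩,
  ⟨29, 94, 8, 54, 9, [5, 11, 9, 0]⟩,
  ⟨5, 94, 12, 38, 10, [5, 11, 9, 7, 6, 0]⟩,
  ⟨10, 11, 12, 38, 10, [7, 6, 5, 4]⟩,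
  ⟨13, 78, 4, 46, 11, [5, 11, 9, 7, 6, 0]⟩,
  ⟨26, 27, 4, 46, 11, [7, 6, 5, 4]⟩,
  ⟨25, 126, 10, 22, 12, [11, 0]⟩,
  ⟨43, 50, 2, 30, 12, [8, 7, 6, 4, 1]⟩,
  ⟨9, 110, 10, 30, 13, [5, 11, 0]⟩,
  ⟨35, 58, 2, 22, 13, [8, 7, 6, 4, 1]⟩,
  ⟨6, 35, 10, 22, 14, [7, 6, 5, 4]⟩,
  ⟨53, 110, 2, 30, 14, [11, 0]⟩,
  ⟨14, 43, 8, 54, 15, [4, 1]⟩,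
  ⟨37, 126, 28, 34, 15, [11, 9, 0]⟩,
  ⟨14, 43, 4, 38, 16, [7, 6, 4, 1]⟩,
  ⟨37, 126, 12, 46, 16, [11, 9, 7, 6, 0]⟩]

/-- The class in the list of the given pairs of canonical codes, `17` if there is none. -/
def findClass : List KeyEntry → ℕ × ℕ → ℕ × ℕ → ℕ
  | [], _, _ => 17
  | e :: l, P, Q =>
    bif (Nat.beq e.p₁ P.1 && Nat.beq e.p₂ P.2) && (Nat.beq e.q₁ Q.1 && Nat.beq e.q₂ Q.2) then e.cls
    else findClass l P Q

theorem exists_of_findClass_lt {l : List KeyEntry} {P Q : ℕ × ℕ} (h : findClass l P Q < 17) :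
    ∃ e ∈ l, P = (e.p₁, e.p₂) ∧ Q = (e.q₁, e.q₂) ∧ e.cls = findClass l P Q := by
  induction l with
  | nil => exact absurd h (lt_irrefl _)
  | cons e l ih =>
    unfold findClass at h ⊢
    cases hb : (Nat.beq e.p₁ P.1 && Nat.beq e.p₂ P.2) && (Nat.beq e.q₁ Q.1 && Nat.beq e.q₂ Q.2)
    · rw [hb, cond_false] at h
      obtain ⟨f, hf, hh⟩ := ih h
      exact ⟨f, List.mem_cons_of_mem _ hf, hh⟩
    · simp only [Bool.and_eq_true, Nat.beq_eq] at hb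
      obtain ⟨⟨h1, h2⟩, h3, h4⟩ := hb
      exact ⟨e, List.mem_cons_self, Prod.ext h1.symm h2.symm, Prod.ext h3.symm h4.symm, rfl⟩

/-- The row of the table for the class of `mkq a b c d`, or `17`. -/
def classOf (a b c d : ℕ) : ℕ :=
  findClass keyTable (sortPair (canon 8 a) (canon 8 b)) (sortPair (canon 7 c) (canon 7 d))

/-- The residues modulo `7425` of the sums of two profiles of canonical codes for length `7`, as the
positions of the bits of a number. -/
def pairResidues : ℕ :=
  0x5008000140000020080000140000020150000000000000200800001502a00a80140000000000000200000050008002000004000000a050001402000000000000000400a4008000005400000004000000001000100080000100000000040000008000000000000001000000200100100020000000800000001004002800005000000800000100a0004415022800d0000040020000054000002000000000000001402a00280140000008000000200000001000002a0040100000020000004020000000000000000008000a00000140280000000000000100000008010005c00000001000000800000020a0010000000002004000000a000000200000000500000a8054014000000000000000000000400a000801000020a00000140080020000000800000001008000801400000280000000000000000000028055008000a00000000000000000200a04140000000020040024028000000000000000000000805400340080000100000000040008028004001000000005400000a00000000000000040000028054004002800000000000000000000020000150208020000004000000005000a001041401280000001502800280000000010000000228000051088002a0000000000000000000000111000000200004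00a000800000000000000000000000140024008010000000000000002000800000100200000140000020000000000004004000800000000000a8050000000000500080000a005005028a00000000000800000100000064150008808000005028010801400000000000008200020150a800080100000000000000000000041002002a0040000a00000000000000004000000800004000000805400000000000020000000040008028001004000000005000000a00140028220000050000028040000000000000000000a00100000aa0040010000000000000000010000000200800040100a0100014020002c000000801000101022000a05400000000000020000000040020028014000020000000008000000000800240000000080000140020000000000800000005000a0080150000000000010000002005000880800000500000080540000020000000000000104000000a0040050008000000200000040401400a8040014000000100004020000800000a0010004010020002014088002a000000000000004000001201400000000000000a000000002a00040000000080000040020000000000000000001002a00000400000200000000000000040000008000401200000000400001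

/-- A sieve for the search: a pair (A,B) can be completed only if the residue of the missing profile
sum is marked. Only this inclusion is needed, so any modulus would be sound; the choice affects only
how many pairs survive. -/
theorem pairResidues_spec : (canonProfiles₇.all fun e => canonProfiles₇.all fun f =>
    Nat.testBit pairResidues (Nat.mod (Nat.add e.2 f.2) 7425)) = true := by
  decide +kernel

/-- Every quadruple of canonical codes whose profiles add up to `profileTotal` is listed. -/
def tableComplete : Bool :=
  canonProfiles₈.all fun e => canonProfiles₈.all fun f =>
    bif Nat.ble e.1 f.1 then
      bif Nat.ble (Nat.add e.2 f.2) profileTotal && Nat.testBit pairResidues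
          (Nat.mod (Nat.sub profileTotal (Nat.add e.2 f.2)) 7425) then
        canonProfiles₇.all fun g => canonProfiles₇.all fun h =>
          bif Nat.beq (Nat.add (Nat.add e.2 f.2) (Nat.add g.2 h.2)) profileTotal && Nat.ble g.1 h.1 then
            Nat.blt (findClass keyTable (e.1, f.1) (g.1, h.1)) 17
          else true
      else true
    else true

theorem tableComplete_eq : tableComplete = true := by decide +kernel

/-- The codes of the four sequences of a quadruple. -/
structure Code where
  a : ℕ
  b : ℕ
  c : ℕ
  d : ℕ

/-- The codes of the quadruple with the key of the given entry. -/
def KeyEntry.code (e : KeyEntry) : Code := ⟨e.p₁, e.p₂, e.q₁, e.q₂⟩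

/-- The properties of an entry of the table that the classification uses. -/
def entryCheck (e : KeyEntry) : Bool :=
  (Nat.blt e.p₁ e.p₂ && Nat.blt e.p₂ 256) && (Nat.blt e.q₁ e.q₂ && Nat.blt e.q₂ 128) &&
  (Nat.blt e.cls 17 && Nat.beq (findClass keyTable (e.p₁, e.p₂) (e.q₁, e.q₂)) e.cls) &&
  Nat.beq (findClass keyTable (sortPair (canon 8 (altCode 8 e.p₁)) (canon 8 (altCode 8 e.p₂)))
    (sortPair (canon 7 (altCode 7 e.q₁)) (canon 7 (altCode 7 e.q₂)))) e.cls &&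
  ((orbit 7 e.q₁).all fun c => (orbit 7 e.q₂).all fun d =>
    Nat.beq (findClass keyTable (e.p₁, e.p₂) (sortPair (canon 7 (Nat.xor c (diagMask 7 c d)))
      (canon 7 (Nat.xor d (diagMask 7 c d))))) e.cls &&
    Nat.beq (findClass keyTable (e.p₁, e.p₂) (sortPair (canon 7 (Nat.xor d (diagMask 7 d c)))
      (canon 7 (Nat.xor c (diagMask 7 d c))))) e.cls)

/-- Alternation commutes with negation, and with reversal up to sign, so it is enough to test it on
canonical codes. The exchange of quads relates C and D and is not compatible with changing one of
them alone, so it is tested on all members of the two orbits and in both orders. -/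
theorem entryCheck_keyTable : keyTable.all entryCheck = true := by decide +kernel

theorem keyTable_spec {e : KeyEntry} (he : e ∈ keyTable) :
    (((e.p₁ < e.p₂ ∧ e.p₂ < 256) ∧ e.q₁ < e.q₂ ∧ e.q₂ < 128) ∧
    e.cls < 17 ∧ findClass keyTable (e.p₁, e.p₂) (e.q₁, e.q₂) = e.cls) ∧
    findClass keyTable (sortPair (canon 8 (altCode 8 e.p₁)) (canon 8 (altCode 8 e.p₂)))
      (sortPair (canon 7 (altCode 7 e.q₁)) (canon 7 (altCode 7 e.q₂))) = e.cls := by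
  have h := (List.all_eq_true.1 entryCheck_keyTable) e he
  unfold entryCheck at h
  rw [Bool.and_eq_true] at h
  have h := h.1
  simp only [Bool.and_eq_true, Nat.beq_eq, Nat.blt_eq] at h
  exact h

theorem findClass_quads {e : KeyEntry} (he : e ∈ keyTable) {c d : ℕ}
    (h : c ∈ orbit 7 e.q₁ ∧ d ∈ orbit 7 e.q₂ ∨ c ∈ orbit 7 e.q₂ ∧ d ∈ orbit 7 e.q₁) :
    findClass keyTable (e.p₁, e.p₂) (sortPair (canon 7 (Nat.xor c (diagMask 7 c d)))
      (canon 7 (Nat.xor d (diagMask 7 c d)))) = e.cls := by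
  have h1 := (List.all_eq_true.1 entryCheck_keyTable) e he
  unfold entryCheck at h1
  rw [Bool.and_eq_true] at h1
  have h1 := h1.2
  simp only [List.all_eq_true, Bool.and_eq_true, Nat.beq_eq] at h1
  rcases h with ⟨hc, hd⟩ | ⟨hc, hd⟩
  · exact (h1 c hc d hd).1
  · exact (h1 d hd c hc).2

/-! ### The elementary transformations on codes, and the row number as a complete invariant -/

namespace Code

/-- The quadruple with the given codes. -/
def toQuad (t : Code) : BinaryQuad 8 7 := mkq t.a t.b t.c t.d

/-- The row of the table for the class of `t.toQuad`, or `17`. -/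
def cls (t : Code) : ℕ := classOf t.a t.b t.c t.d

/-- The codes have at most `8, 8, 7, 7` digits. -/
def InRange (t : Code) : Prop := t.a < 2 ^ 8 ∧ t.b < 2 ^ 8 ∧ t.c < 2 ^ 7 ∧ t.d < 2 ^ 7

/-- The codes of a given quadruple. -/
def ofQuad (x : BinaryQuad 8 7) : Code := ⟨codeOf x.A, codeOf x.B, codeOf x.C, codeOf x.D⟩

theorem inRange_ofQuad (x : BinaryQuad 8 7) : (ofQuad x).InRange :=
  ⟨codeOf_lt _, codeOf_lt _, codeOf_lt _, codeOf_lt _⟩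

theorem toQuad_ofQuad (x : BinaryQuad 8 7) : (ofQuad x).toQuad = x := by
  simp [toQuad, mkq, ofQuad, seq_codeOf]

theorem ofQuad_toQuad {t : Code} (h : t.InRange) : ofQuad t.toQuad = t := by
  have h1 : ∀ {m k : ℕ}, k < 2 ^ m → codeOf (seq m k) = k := fun hk =>
    seq_injOn (codeOf_lt _) hk (seq_codeOf _)
  obtain ⟨ha, hb, hc, hd⟩ := h
  simp [toQuad, mkq, ofQuad, h1 ha, h1 hb, h1 hc, h1 hd]

/-- The sum of the profiles of the four sequences. -/
def profileSum (t : Code) : ℕ :=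
  Nat.add (Nat.add (profile 8 t.a) (profile 8 t.b)) (Nat.add (profile 7 t.c) (profile 7 t.d))

theorem isBaseSequences_toQuad (t : Code) :
    IsBaseSequences t.toQuad ↔ t.profileSum = profileTotal := by
  rw [toQuad, isBaseSequences_mkq, add_assoc (_ + _)]
  exact Iff.rfl

/-- The elementary transformations on codes. -/
def step : ℕ → Code → Code
  | 0, ⟨a, b, c, d⟩ => ⟨negCode 8 a, b, c, d⟩
  | 1, ⟨a, b, c, d⟩ => ⟨a, negCode 8 b, c, d⟩
  | 2, ⟨a, b, c, d⟩ => ⟨a, b, negCode 7 c, d⟩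
  | 3, ⟨a, b, c, d⟩ => ⟨a, b, c, negCode 7 d⟩
  | 4, ⟨a, b, c, d⟩ => ⟨revCode 8 a, b, c, d⟩
  | 5, ⟨a, b, c, d⟩ => ⟨a, revCode 8 b, c, d⟩
  | 6, ⟨a, b, c, d⟩ => ⟨a, b, revCode 7 c, d⟩
  | 7, ⟨a, b, c, d⟩ => ⟨a, b, c, revCode 7 d⟩
  | 8, ⟨a, b, c, d⟩ => ⟨b, a, c, d⟩
  | 9, ⟨a, b, c, d⟩ => ⟨a, b, d, c⟩
  | 10, ⟨a, b, c, d⟩ => ⟨a, b, Nat.xor c (diagMask 7 c d), Nat.xor d (diagMask 7 c d)⟩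
  | _, ⟨a, b, c, d⟩ => ⟨altCode 8 a, altCode 8 b, altCode 7 c, altCode 7 d⟩

theorem elementary_step (o : ℕ) (t : Code) :
    Elementary (n := 7) t.toQuad (step o t).toQuad := by
  obtain ⟨a, b, c, d⟩ := t
  match o with
  | 0 => simpa only [toQuad, mkq, step, seq_negCode] using Elementary.negA _ _ _ _
  | 1 => simpa only [toQuad, mkq, step, seq_negCode] using Elementary.negB _ _ _ _
  | 2 => simpa only [toQuad, mkq, step, seq_negCode] using Elementary.negC _ _ _ _
  | 3 => simpa only [toQuad, mkq, step, seq_negCode] using Elementary.negD _ _ _ _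
  | 4 => simpa only [toQuad, mkq, step, seq_revCode] using Elementary.revA _ _ _ _
  | 5 => simpa only [toQuad, mkq, step, seq_revCode] using Elementary.revB _ _ _ _
  | 6 => simpa only [toQuad, mkq, step, seq_revCode] using Elementary.revC _ _ _ _
  | 7 => simpa only [toQuad, mkq, step, seq_revCode] using Elementary.revD _ _ _ _
  | 8 => exact Elementary.swapAB _ _ _ _
  | 9 => exact Elementary.swapCD _ _ _ _
  | 10 => simpa only [toQuad, mkq, step, seq_quadSwap] using Elementary.quads _ _ _ _
  | _ + 11 =>
    simpa only [toQuad, mkq, step, seq_altCode le_rfl, seq_altCode (show 7 ≤ 8 by norm_num)] using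
      Elementary.alt _ _ _ _

theorem exists_step_of_elementary {x y : BinaryQuad 8 7} (h : Elementary (n := 7) x y) :
    ∃ o, y = (step o (ofQuad x)).toQuad := by
  cases h
  · exact ⟨0, by simp only [toQuad, mkq, step, ofQuad, seq_negCode, seq_codeOf]⟩
  · exact ⟨1, by simp only [toQuad, mkq, step, ofQuad, seq_negCode, seq_codeOf]⟩
  · exact ⟨2, by simp only [toQuad, mkq, step, ofQuad, seq_negCode, seq_codeOf]⟩
  · exact ⟨3, by simp only [toQuad, mkq, step, ofQuad, seq_negCode, seq_codeOf]⟩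
  · exact ⟨4, by simp only [toQuad, mkq, step, ofQuad, seq_revCode, seq_codeOf]⟩
  · exact ⟨5, by simp only [toQuad, mkq, step, ofQuad, seq_revCode, seq_codeOf]⟩
  · exact ⟨6, by simp only [toQuad, mkq, step, ofQuad, seq_revCode, seq_codeOf]⟩
  · exact ⟨7, by simp only [toQuad, mkq, step, ofQuad, seq_revCode, seq_codeOf]⟩
  · exact ⟨8, by simp only [toQuad, mkq, step, ofQuad, seq_codeOf]⟩
  · exact ⟨9, by simp only [toQuad, mkq, step, ofQuad, seq_codeOf]⟩
  · exact ⟨10, by simp only [toQuad, mkq, step, ofQuad, seq_quadSwap, seq_codeOf]⟩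
  · exact ⟨11, by simp only [toQuad, mkq, step, ofQuad, seq_altCode le_rfl,
      seq_altCode (show 7 ≤ 8 by norm_num), seq_codeOf]⟩

theorem inRange_step {t : Code} (h : t.InRange) (o : ℕ) : (step o t).InRange := by
  obtain ⟨a, b, c, d⟩ := t
  obtain ⟨ha, hb, hc, hd⟩ := h
  match o with
  | 0 => exact ⟨negCode_lt ha, hb, hc, hd⟩
  | 1 => exact ⟨ha, negCode_lt hb, hc, hd⟩
  | 2 => exact ⟨ha, hb, negCode_lt hc, hd⟩
  | 3 => exact ⟨ha, hb, hc, negCode_lt hd⟩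
  | 4 => exact ⟨revCode_lt _ _, hb, hc, hd⟩
  | 5 => exact ⟨ha, revCode_lt _ _, hc, hd⟩
  | 6 => exact ⟨ha, hb, revCode_lt _ _, hd⟩
  | 7 => exact ⟨ha, hb, hc, revCode_lt _ _⟩
  | 8 => exact ⟨hb, ha, hc, hd⟩
  | 9 => exact ⟨ha, hb, hd, hc⟩
  | 10 => exact ⟨ha, hb, Nat.xor_lt_two_pow hc (diagMask_lt hc d), Nat.xor_lt_two_pow hd (diagMask_lt hc d)⟩
  | _ + 11 => exact ⟨altCode_lt ha, altCode_lt hb, altCode_lt hc, altCode_lt hd⟩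

theorem exists_of_cls_lt {t : Code} (h : t.cls < 17) : ∃ e ∈ keyTable,
    sortPair (canon 8 t.a) (canon 8 t.b) = (e.p₁, e.p₂) ∧
    sortPair (canon 7 t.c) (canon 7 t.d) = (e.q₁, e.q₂) ∧ e.cls = t.cls :=
  exists_of_findClass_lt h

/-- Negations and reversals keep the canonical codes, and interchanges keep the sorted pairs. Only
the exchange of quads and the alternation can change the key, and for these the table has been
checked. That the new quadruple consists of base sequences need not be assumed. -/
theorem cls_step {t : Code} (ht : t.InRange) (h : t.cls < 17) (o : ℕ) : (step o t).cls = t.cls := by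
  obtain ⟨e, he, h1, h2, h3⟩ := exists_of_cls_lt h
  obtain ⟨a, b, c, d⟩ := t
  obtain ⟨ha, hb, hc, hd⟩ := ht
  have sa := isProfileList_eight.spec ha
  have sb := isProfileList_eight.spec hb
  have sc := isProfileList_seven.spec hc
  have sd := isProfileList_seven.spec hd
  match o with
  | 0 => simp only [cls, step, classOf, sa.2.2.1]
  | 1 => simp only [cls, step, classOf, sb.2.2.1]
  | 2 => simp only [cls, step, classOf, sc.2.2.1]
  | 3 => simp only [cls, step, classOf, sd.2.2.1]
  | 4 => simp only [cls, step, classOf, sa.2.2.2.1]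
  | 5 => simp only [cls, step, classOf, sb.2.2.2.1]
  | 6 => simp only [cls, step, classOf, sc.2.2.2.1]
  | 7 => simp only [cls, step, classOf, sd.2.2.2.1]
  | 8 => simp only [cls, step, classOf, sortPair_comm (canon 8 b)]
  | 9 => simp only [cls, step, classOf, sortPair_comm (canon 7 d)]
  | 10 =>
    rw [← h3, ← findClass_quads he (c := c) (d := d)]
    · simp only [cls, step, classOf]
      rw [← h1]
    · have oc := sc.2.2.2.2.2.1
      have od := sd.2.2.2.2.2.1
      rcases sortPair_eq h2 with ⟨h4, h5⟩ | ⟨h4, h5⟩ <;> dsimp only at h4 h5 <;> rw [h4] at oc <;>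
        rw [h5] at od
      · exact Or.inl ⟨oc, od⟩
      · exact Or.inr ⟨oc, od⟩
  | _ + 11 =>
    rw [← h3, ← (keyTable_spec he).2]
    simp only [cls, step, classOf]
    rw [sa.2.2.2.2.1, sb.2.2.2.2.1, sc.2.2.2.2.1, sd.2.2.2.2.1]
    rcases sortPair_eq h1 with ⟨h4, h5⟩ | ⟨h4, h5⟩ <;> rcases sortPair_eq h2 with ⟨h6, h7⟩ | ⟨h6, h7⟩ <;>
      dsimp only at h4 h5 h6 h7 <;> rw [h4, h5, h6, h7]
    · rw [sortPair_comm (canon 7 (altCode 7 e.q₂))]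
    · rw [sortPair_comm (canon 8 (altCode 8 e.p₂))]
    · rw [sortPair_comm (canon 7 (altCode 7 e.q₂)), sortPair_comm (canon 8 (altCode 8 e.p₂))]

/-- A code enters the condition only through its profile, which is listed with its canonical code.
So the search through canonical codes, each pair sorted, sees every quadruple of base sequences. -/
theorem cls_lt_of_isBaseSequences {t : Code} (ht : t.InRange) (h : IsBaseSequences t.toQuad) :
    t.cls < 17 := by
  rw [isBaseSequences_toQuad] at h
  obtain ⟨a, b, c, d⟩ := t
  obtain ⟨ha, hb, hc, hd⟩ := ht
  have la := (isProfileList_eight.spec ha).2.2.2.2.2.2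
  have lb := (isProfileList_eight.spec hb).2.2.2.2.2.2
  have lc := (isProfileList_seven.spec hc).2.2.2.2.2.2
  have ld := (isProfileList_seven.spec hd).2.2.2.2.2.2
  have key : ∀ e ∈ canonProfiles₈, ∀ f ∈ canonProfiles₈, ∀ g ∈ canonProfiles₇, ∀ k ∈ canonProfiles₇,
      e.1 ≤ f.1 → g.1 ≤ k.1 → e.2 + f.2 + (g.2 + k.2) = profileTotal →
      findClass keyTable (sortPair e.1 f.1) (sortPair g.1 k.1) < 17 := by
    intro e he f hf g hg k hk h1 h2 h3
    have H := List.all_eq_true.1 (List.all_eq_true.1 tableComplete_eq e he) f hf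
    have r := List.all_eq_true.1 (List.all_eq_true.1 pairResidues_spec g hg) k hk
    have h4 : e.2 + f.2 ≤ profileTotal := by omega
    have h5 : profileTotal - (e.2 + f.2) = g.2 + k.2 := by omega
    change (bif Nat.ble e.1 f.1 then bif Nat.ble (e.2 + f.2) profileTotal && Nat.testBit pairResidues
      ((profileTotal - (e.2 + f.2)) % 7425) then _ else _ else _) = true at H
    change pairResidues.testBit ((g.2 + k.2) % 7425) = true at r
    have b1 := Nat.ble_eq_true_of_le h1
    have b2 := Nat.ble_eq_true_of_le h2
    rw [b1, cond_true, Nat.ble_eq_true_of_le h4, h5, r, Bool.true_and, cond_true] at H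
    have H := List.all_eq_true.1 (List.all_eq_true.1 H g hg) k hk
    change (bif Nat.beq (e.2 + f.2 + (g.2 + k.2)) profileTotal && _ then _ else _) = true at H
    rw [h3, Nat.beq_refl, b2, Bool.true_and, cond_true, Nat.blt_eq] at H
    unfold sortPair
    rwa [b1, b2]
  -- The order of the two sequences of length 7 is removed first, the order of the other two at the
  -- end.
  have key2 : ∀ e ∈ canonProfiles₈, ∀ f ∈ canonProfiles₈, ∀ g ∈ canonProfiles₇, ∀ k ∈ canonProfiles₇,
      e.1 ≤ f.1 → e.2 + f.2 + (g.2 + k.2) = profileTotal →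
      findClass keyTable (sortPair e.1 f.1) (sortPair g.1 k.1) < 17 := by
    intro e he f hf g hg k hk h1 h3
    rcases le_total g.1 k.1 with h2 | h2
    · exact key e he f hf g hg k hk h1 h2 h3
    · rw [sortPair_comm g.1]
      exact key e he f hf k hk g hg h1 h2 (by omega)
  rcases le_total (canon 8 a) (canon 8 b) with h1 | h1
  · exact key2 (canon 8 a, profile 8 a) la (canon 8 b, profile 8 b) lb (canon 7 c, profile 7 c) lc
      (canon 7 d, profile 7 d) ld h1 h
  · have h2 := key2 (canon 8 b, profile 8 b) lb (canon 8 a, profile 8 a) la (canon 7 c, profile 7 c) lc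
      (canon 7 d, profile 7 d) ld h1 ((congrArg (· + (profile 7 c + profile 7 d)) (add_comm (profile 8 b) (profile 8 a))).trans h)
    rwa [sortPair_comm] at h2

/-- `y` is equivalent to the base sequences `x`. -/
def Linked (x y : BinaryQuad 8 7) : Prop :=
  ∀ hx : IsBaseSequences x, ∃ hy : IsBaseSequences y, (baseSetoid 7).r ⟨x, hx⟩ ⟨y, hy⟩

theorem Linked.refl (x : BinaryQuad 8 7) : Linked x x := fun hx => ⟨hx, (baseSetoid 7).refl _⟩

theorem Linked.trans {x y z : BinaryQuad 8 7} (h1 : Linked x y) (h2 : Linked y z) : Linked x z := by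
  intro hx
  obtain ⟨hy, h1⟩ := h1 hx
  obtain ⟨hz, h2⟩ := h2 hy
  exact ⟨hz, (baseSetoid 7).trans h1 h2⟩

theorem linked_step {o : ℕ} {t : Code}
    (h : t.profileSum = profileTotal → (step o t).profileSum = profileTotal) :
    Linked t.toQuad (step o t).toQuad := fun hx =>
  ⟨(isBaseSequences_toQuad _).2 (h ((isBaseSequences_toQuad _).1 hx)),
    Relation.EqvGen.rel _ _ (elementary_step o t)⟩

/-- Steps 10 and 11, the exchange of quads and the alternation, are left out. Where they are needed,
`follow` verifies membership in BS(8,7) after each step. -/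
theorem profileSum_step {t : Code} (ht : t.InRange) {o : ℕ} (ho : o < 10) :
    (step o t).profileSum = t.profileSum := by
  obtain ⟨a, b, c, d⟩ := t
  obtain ⟨ha, hb, hc, hd⟩ := ht
  have sa := isProfileList_eight.spec ha
  have sb := isProfileList_eight.spec hb
  have sc := isProfileList_seven.spec hc
  have sd := isProfileList_seven.spec hd
  match o with
  | 0 => simp only [profileSum, step, sa.1]
  | 1 => simp only [profileSum, step, sb.1]
  | 2 => simp only [profileSum, step, sc.1]
  | 3 => simp only [profileSum, step, sd.1]
  | 4 => simp only [profileSum, step, sa.2.1]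
  | 5 => simp only [profileSum, step, sb.2.1]
  | 6 => simp only [profileSum, step, sc.2.1]
  | 7 => simp only [profileSum, step, sd.2.1]
  | 8 => exact congrArg (· + (profile 7 c + profile 7 d)) (add_comm (profile 8 b) (profile 8 a))
  | 9 => exact congrArg (profile 8 a + profile 8 b + ·) (add_comm (profile 7 d) (profile 7 c))
  | _ + 10 => omega

theorem linked_of_steps (l : List ℕ) (hl : ∀ o ∈ l, o < 10) {t : Code} (ht : t.InRange) :
    Linked t.toQuad (l.foldl (fun t o => step o t) t).toQuad := by
  induction l generalizing t with
  | nil => exact Linked.refl _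
  | cons o l ih =>
    exact (linked_step fun h => (profileSum_step ht (hl o List.mem_cons_self)).trans h).trans
      (ih (fun o ho => hl o (List.mem_cons_of_mem _ ho)) (inRange_step ht o))

theorem exists_steps_orbit {m n k : ℕ} (h : k ∈ orbit m n) (i j : ℕ) (f : ℕ → Code)
    (hi : ∀ n, step i (f n) = f (negCode m n)) (hj : ∀ n, step j (f n) = f (revCode m n)) :
    ∃ l : List ℕ, (∀ o ∈ l, o = i ∨ o = j) ∧ l.foldl (fun t o => step o t) (f n) = f k := by
  simp only [orbit, List.mem_cons, List.not_mem_nil, or_false] at h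
  rcases h with rfl | rfl | rfl | rfl
  · exact ⟨[], by simp⟩
  · exact ⟨[i], by simp [hi]⟩
  · exact ⟨[j], by simp [hj]⟩
  · exact ⟨[j, i], by simp [hi, hj]⟩

theorem linked_canon {t : Code} (ht : t.InRange) :
    Linked t.toQuad (Code.mk (canon 8 t.a) (canon 8 t.b) (canon 7 t.c) (canon 7 t.d)).toQuad := by
  obtain ⟨a, b, c, d⟩ := t
  obtain ⟨l1, h1, e1⟩ := exists_steps_orbit (canon_mem_orbit 8 a) 0 4 (fun n => ⟨n, b, c, d⟩)
    (fun _ => rfl) (fun _ => rfl)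
  obtain ⟨l2, h2, e2⟩ := exists_steps_orbit (canon_mem_orbit 8 b) 1 5 (fun n => ⟨canon 8 a, n, c, d⟩)
    (fun _ => rfl) (fun _ => rfl)
  obtain ⟨l3, h3, e3⟩ := exists_steps_orbit (canon_mem_orbit 7 c) 2 6
    (fun n => ⟨canon 8 a, canon 8 b, n, d⟩) (fun _ => rfl) (fun _ => rfl)
  obtain ⟨l4, h4, e4⟩ := exists_steps_orbit (canon_mem_orbit 7 d) 3 7
    (fun n => ⟨canon 8 a, canon 8 b, canon 7 c, n⟩) (fun _ => rfl) (fun _ => rfl)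
  have h := linked_of_steps (l1 ++ (l2 ++ (l3 ++ l4))) (t := ⟨a, b, c, d⟩) (fun o ho => by
    simp only [List.mem_append] at ho
    rcases ho with ho | ho | ho | ho
    · rcases h1 o ho with rfl | rfl <;> norm_num
    · rcases h2 o ho with rfl | rfl <;> norm_num
    · rcases h3 o ho with rfl | rfl <;> norm_num
    · rcases h4 o ho with rfl | rfl <;> norm_num) ht
  rw [List.foldl_append, List.foldl_append, List.foldl_append, e1, e2, e3, e4] at h
  exact h

/-- The codes of the representatives in the table. -/
def representatives : List Code := [
  ⟨40, 176, 72, 92⟩, ⟨40, 176, 80, 76⟩, ⟨48, 176, 72, 84⟩, ⟨44, 136, 80, 88⟩,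
  ⟨44, 136, 96, 74⟩, ⟨44, 172, 64, 92⟩, ⟨72, 200, 40, 60⟩, ⟨80, 200, 48, 44⟩,
  ⟨72, 208, 24, 58⟩, ⟨72, 208, 28, 34⟩, ⟨80, 208, 24, 50⟩, ⟨88, 216, 16, 58⟩,
  ⟨76, 212, 32, 60⟩, ⟨92, 220, 32, 52⟩, ⟨96, 196, 40, 52⟩, ⟨112, 212, 8, 54⟩,
  ⟨112, 212, 16, 50⟩]

/-- The codes of a representative in the table. -/
def representative (k : ℕ) : Code := representatives.getD k ⟨0, 0, 0, 0⟩

/-- The list of elementary transformations leads from `t` to `r` inside `BS(8, 7)`. -/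
def follow : List ℕ → Code → Code → Bool
  | [], t, r => (Nat.beq t.a r.a && Nat.beq t.b r.b) && (Nat.beq t.c r.c && Nat.beq t.d r.d)
  | o :: w, t, r => Nat.beq (step o t).profileSum profileTotal && follow w (step o t) r

theorem linked_of_follow {w : List ℕ} {t r : Code} (h : follow w t r = true) :
    Linked t.toQuad r.toQuad := by
  induction w generalizing t with
  | nil =>
    obtain ⟨a, b, c, d⟩ := t
    obtain ⟨a', b', c', d'⟩ := r
    simp only [follow, Bool.and_eq_true, Nat.beq_eq] at h
    obtain ⟨⟨rfl, rfl⟩, rfl, rfl⟩ := h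
    exact Linked.refl _
  | cons o w ih =>
    rw [follow, Bool.and_eq_true, Nat.beq_eq] at h
    exact (linked_step fun _ => h.1).trans (ih h.2)

theorem keyTable_links : (keyTable.all fun e => Nat.beq e.code.profileSum profileTotal &&
    ((Nat.beq (canon 8 e.p₁) e.p₁ && Nat.beq (canon 8 e.p₂) e.p₂) &&
      (Nat.beq (canon 7 e.q₁) e.q₁ && Nat.beq (canon 7 e.q₂) e.q₂)) &&
    follow e.word e.code (representative e.cls)) = true := by
  decide +kernel

theorem representative_cls : allBelow 17 (fun k => Nat.beq (representative k).cls k) = true := by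
  decide +kernel

theorem toQuad_representative :
    ∀ k : Fin 17, (representative k).toQuad = decode (table k).AB (table k).CD := by
  have h : ∀ k : Fin 17, ((∀ i, seq 8 (representative k).a i = decodeAB (table k).AB 0 i) ∧
      (∀ i, seq 8 (representative k).b i = decodeAB (table k).AB 1 i)) ∧
      (∀ i, seq 7 (representative k).c i = decodeCD (table k).CD 0 i) ∧
      (∀ i, seq 7 (representative k).d i = decodeCD (table k).CD 1 i) := by
    decide +kernel
  intro k
  obtain ⟨⟨h1, h2⟩, h3, h4⟩ := h k
  exact BinaryQuad.ext (funext h1) (funext h2) (funext h3) (funext h4)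

theorem exists_entry {t : Code} (h : t.cls < 17) :
    ∃ e ∈ keyTable, e.cls = t.cls ∧
      ∃ l : List ℕ, (∀ o ∈ l, o < 10) ∧ l.foldl (fun t o => step o t)
        (Code.mk (canon 8 t.a) (canon 8 t.b) (canon 7 t.c) (canon 7 t.d)) = e.code := by
  obtain ⟨e, he, h1, h2, h3⟩ := exists_of_cls_lt h
  refine ⟨e, he, h3, ?_⟩
  rcases sortPair_eq h1 with ⟨h4, h5⟩ | ⟨h4, h5⟩ <;> rcases sortPair_eq h2 with ⟨h6, h7⟩ | ⟨h6, h7⟩ <;>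
    rw [h4, h5, h6, h7]
  · exact ⟨[], by simp, rfl⟩
  · exact ⟨[9], by simp, rfl⟩
  · exact ⟨[8], by simp, rfl⟩
  · exact ⟨[8, 9], by simp, rfl⟩

/-- The chain has three pieces: negations and reversals to the canonical codes, interchanges that
sort the two pairs, and the word stored with the key. -/
theorem linked_representative {t : Code} (ht : t.InRange) (h : t.cls < 17) :
    Linked t.toQuad (representative t.cls).toQuad := by
  obtain ⟨e, he, h3, l, hl, h4⟩ := exists_entry h
  have h5 := List.all_eq_true.1 keyTable_links e he
  rw [Bool.and_eq_true] at h5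
  have h6 := linked_of_follow h5.2
  rw [h3, ← h4] at h6
  exact ((linked_canon ht).trans (linked_of_steps l hl (t := ⟨_, _, _, _⟩) ⟨canon_lt ht.1,
    canon_lt ht.2.1, canon_lt ht.2.2.1, canon_lt ht.2.2.2⟩)).trans h6

/-- The sum of the profiles is determined by the key, and it is correct for each key of the table.
-/
theorem isBaseSequences_of_cls_lt {t : Code} (ht : t.InRange) (h : t.cls < 17) :
    IsBaseSequences t.toQuad := by
  obtain ⟨e, he, h3, l, hl, h4⟩ := exists_entry h
  have h5 := List.all_eq_true.1 keyTable_links e he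
  simp only [Bool.and_eq_true, Nat.beq_eq] at h5
  have h6 : ∀ (l : List ℕ) (t : Code), t.InRange → (∀ o ∈ l, o < 10) →
      (l.foldl (fun t o => step o t) t).profileSum = t.profileSum := by
    intro l
    induction l with
    | nil => exact fun _ _ _ => rfl
    | cons o l ih =>
      intro t ht hl
      exact (ih _ (inRange_step ht o) fun o ho => hl o (List.mem_cons_of_mem _ ho)).trans
        (profileSum_step ht (hl o List.mem_cons_self))
  have h7 := h6 l ⟨canon 8 t.a, canon 8 t.b, canon 7 t.c, canon 7 t.d⟩ ⟨canon_lt ht.1, canon_lt ht.2.1, canon_lt ht.2.2.1, canon_lt ht.2.2.2⟩ hl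
  rw [h4, h5.1.1] at h7
  rw [isBaseSequences_toQuad, h7, profileSum, profileSum]
  dsimp only
  rw [isProfileList_eight.profile_orbit ht.1 (canon_mem_orbit _ _),
    isProfileList_eight.profile_orbit ht.2.1 (canon_mem_orbit _ _),
    isProfileList_seven.profile_orbit ht.2.2.1 (canon_mem_orbit _ _),
    isProfileList_seven.profile_orbit ht.2.2.2 (canon_mem_orbit _ _)]

end Code

/-- The row of the table for the class of the given base sequences. -/
def rowOf (x : BS 8 7) : ℕ := (Code.ofQuad x.1).cls

theorem rowOf_lt (x : BS 8 7) : rowOf x < 17 :=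
  Code.cls_lt_of_isBaseSequences (Code.inRange_ofQuad _) (by rw [Code.toQuad_ofQuad]; exact x.2)

theorem rowOf_eq_of_rel {x y : BS 8 7} (h : (baseSetoid 7).r x y) : rowOf x = rowOf y := by
  induction h with
  | rel x y h =>
    obtain ⟨o, h1⟩ := Code.exists_step_of_elementary h
    have hr := Code.inRange_ofQuad x.1
    unfold rowOf
    rw [h1, Code.ofQuad_toQuad (Code.inRange_step hr o), Code.cls_step hr (rowOf_lt x)]
  | refl x => rfl
  | symm x y _ h => exact h.symm
  | trans x y z _ _ h1 h2 => exact h1.trans h2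

/-- The row number is constant on equivalence classes, and all base sequences with the same row
number are linked to the same representative; hence the fibres of `rowOf` are the equivalence
classes. -/
theorem exists_representative : ∃ rep : Fin 17 → BS 8 7,
    (∀ k, (rep k).1 = decode (table k).AB (table k).CD) ∧
    ∀ x k, (baseSetoid 7).r (rep k) x ↔ rowOf x = k := by
  have hc : ∀ k : Fin 17, (Code.representative k).cls = k := fun k =>
    Nat.eq_of_beq_eq_true (of_allBelow Code.representative_cls k.2)
  have hr : ∀ k : Fin 17, (Code.representative k).InRange := by
    have h : allBelow 17 (fun k => (Nat.blt (Code.representative k).a 256 &&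
      Nat.blt (Code.representative k).b 256) && (Nat.blt (Code.representative k).c 128 &&
      Nat.blt (Code.representative k).d 128)) = true := by decide +kernel
    intro k
    have h1 := of_allBelow h k.2
    simp only [Bool.and_eq_true, Nat.blt_eq] at h1
    exact ⟨h1.1.1, h1.1.2, h1.2.1, h1.2.2⟩
  let rep : Fin 17 → BS 8 7 := fun k =>
    ⟨(Code.representative k).toQuad, Code.isBaseSequences_of_cls_lt (hr k) ((hc k).trans_lt k.2)⟩
  have hrow : ∀ k, rowOf (rep k) = k := fun k =>
    (congrArg Code.cls (Code.ofQuad_toQuad (hr k))).trans (hc k)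
  refine ⟨rep, Code.toQuad_representative, fun x k => ⟨fun h => ?_, fun h => ?_⟩⟩
  · rw [← rowOf_eq_of_rel h, hrow]
  · have h1 := Code.linked_representative (Code.inRange_ofQuad x.1) (rowOf_lt x)
    rw [Code.toQuad_ofQuad] at h1
    obtain ⟨h4, h2⟩ := h1 x.2
    have h3 : (Code.ofQuad x.1).cls = k := h
    rw [show rep k = ⟨_, h4⟩ from
      Subtype.ext (congrArg (fun k => (Code.representative k).toQuad) h3.symm)]
    exact (baseSetoid 7).symm h2

/-! ### The sizes of the classes -/

/-- The pairs of codes with the given pair of canonical codes. -/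
def pairsWith (m : ℕ) (P : ℕ × ℕ) : Finset (ℕ × ℕ) :=
  (Finset.range (2 ^ m) ×ˢ Finset.range (2 ^ m)).filter fun x =>
    sortPair (canon m x.1) (canon m x.2) = P

/-- As p and q are different canonical codes, their orbits are disjoint, and the two orders
contribute separately. Orbits are counted without repetition, since symmetric and skew sequences
have fewer than four images. -/
theorem card_pairsWith {m : ℕ} {l : List (ℕ × ℕ)} (h : IsProfileList m l) {p q : ℕ} (hpq : p < q)
    (hq : q < 2 ^ m) (hp' : canon m p = p) (hq' : canon m q = q) :
    (pairsWith m (p, q)).card = 2 * ((orbit m p).toFinset.card * (orbit m q).toFinset.card) := by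
  have ho : ∀ {p}, p < 2 ^ m → canon m p = p →
      ∀ n, n ∈ (orbit m p).toFinset ↔ n < 2 ^ m ∧ canon m n = p := by
    intro p hp hp' n
    rw [List.mem_toFinset]
    constructor
    · intro hn
      exact ⟨orbit_lt hp hn, (h.canon_orbit hp hn).trans hp'⟩
    · rintro ⟨hn, rfl⟩
      exact (h.spec hn).2.2.2.2.2.1
  have h1 := ho (hpq.trans hq) hp'
  have h2 := ho hq hq'
  have h3 : pairsWith m (p, q) = ((orbit m p).toFinset ×ˢ (orbit m q).toFinset) ∪
      ((orbit m q).toFinset ×ˢ (orbit m p).toFinset) := by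
    ext ⟨x, y⟩
    rw [pairsWith, Finset.mem_filter, Finset.mem_product, Finset.mem_union, Finset.mem_product,
      Finset.mem_product, Finset.mem_range, Finset.mem_range, h1, h2, h1, h2]
    dsimp only
    constructor
    · rintro ⟨⟨hx, hy⟩, hs⟩
      rcases sortPair_eq hs with ⟨h4, h5⟩ | ⟨h4, h5⟩
      · exact Or.inl ⟨⟨hx, h4⟩, hy, h5⟩
      · exact Or.inr ⟨⟨hx, h4⟩, hy, h5⟩
    · have h6 : sortPair p q = (p, q) := by
        rw [sortPair, Nat.ble_eq_true_of_le hpq.le, cond_true]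
      rintro (⟨⟨hx, h4⟩, hy, h5⟩ | ⟨⟨hx, h4⟩, hy, h5⟩)
      · exact ⟨⟨hx, hy⟩, by rw [h4, h5, h6]⟩
      · exact ⟨⟨hx, hy⟩, by rw [h4, h5, sortPair_comm, h6]⟩
  rw [h3, Finset.card_union_of_disjoint, Finset.card_product, Finset.card_product]
  · ring
  · rw [Finset.disjoint_left]
    rintro ⟨x, y⟩ h4 h5
    rw [Finset.mem_product, h1, h2] at h4
    rw [Finset.mem_product, h1, h2] at h5
    exact hpq.ne (h4.1.2.symm.trans h5.1.2)

/-- The keys of the class in the given row of the table. -/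
def keysOf (k : ℕ) : Finset ((ℕ × ℕ) × ℕ × ℕ) :=
  ((keyTable.filter fun e => Nat.beq e.cls k).map fun e => ((e.p₁, e.p₂), e.q₁, e.q₂)).toFinset

theorem sum_keysOf : ∀ k : Fin 17, (∑ K ∈ keysOf k,
    2 * ((orbit 8 K.1.1).toFinset.card * (orbit 8 K.1.2).toFinset.card) *
      (2 * ((orbit 7 K.2.1).toFinset.card * (orbit 7 K.2.2).toFinset.card))) = (table k).size := by
  decide +kernel

-- The codes embed the class into quadruples of numbers, and the image is a disjoint union, over the
-- keys with this label, of products of pairs of orbits.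
set_option linter.constructorNameAsVariable false in
theorem ncard_rowOf_eq (k : Fin 17) : {x : BS 8 7 | rowOf x = k}.ncard = (table k).size := by
  let f : BS 8 7 → (ℕ × ℕ) × ℕ × ℕ := fun x =>
    ((codeOf x.1.A, codeOf x.1.B), codeOf x.1.C, codeOf x.1.D)
  have hf : Function.Injective f := by
    intro x y h
    simp only [f, Prod.mk.injEq] at h
    have h1 : Code.ofQuad x.1 = Code.ofQuad y.1 := by
      simp only [Code.ofQuad, h.1.1, h.1.2, h.2.1, h.2.2]
    exact Subtype.ext (by rw [← Code.toQuad_ofQuad x.1, h1, Code.toQuad_ofQuad])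
  have hm : ∀ K, K ∈ keysOf k ↔
      ∃ e ∈ keyTable, e.cls = k ∧ ((e.p₁, e.p₂), e.q₁, e.q₂) = K := by
    intro K
    simp [keysOf, and_assoc]
  have himg : f '' {x : BS 8 7 | rowOf x = k} =
      (((keysOf k).biUnion fun K => pairsWith 8 K.1 ×ˢ pairsWith 7 K.2 : Finset _) : Set _) := by
    ext ⟨⟨a, b⟩, c, d⟩
    rw [Finset.mem_coe, Finset.mem_biUnion]
    constructor
    · rintro ⟨x, hx, h⟩
      simp only [f, Prod.mk.injEq] at h
      obtain ⟨⟨rfl, rfl⟩, rfl, rfl⟩ := h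
      obtain ⟨e, he, h1, h2, h3⟩ := Code.exists_of_cls_lt (rowOf_lt x)
      refine ⟨_, (hm _).2 ⟨e, he, h3.trans hx, rfl⟩, ?_⟩
      simp only [pairsWith, Finset.mem_product, Finset.mem_filter, Finset.mem_range]
      exact ⟨⟨⟨codeOf_lt _, codeOf_lt _⟩, h1⟩, ⟨codeOf_lt _, codeOf_lt _⟩, h2⟩
    · rintro ⟨K, hK, h⟩
      obtain ⟨e, he, h1, rfl⟩ := (hm _).1 hK
      simp only [pairsWith, Finset.mem_product, Finset.mem_filter, Finset.mem_range] at h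
      obtain ⟨⟨⟨ha, hb⟩, h2⟩, ⟨hc, hd⟩, h3⟩ := h
      have ht : (Code.mk a b c d).InRange := ⟨ha, hb, hc, hd⟩
      have h4 : (Code.mk a b c d).cls = k := by
        simp only [Code.cls, classOf, h2, h3]
        exact (keyTable_spec he).1.2.2.trans h1
      have h5 := Code.ofQuad_toQuad ht
      refine ⟨⟨_, Code.isBaseSequences_of_cls_lt ht (h4.trans_lt k.2)⟩, ?_, ?_⟩
      · exact (congrArg Code.cls h5).trans h4
      · simp only [Code.ofQuad, Code.mk.injEq] at h5
        simp only [f, h5]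
  rw [← Set.ncard_image_of_injective _ hf, himg, Set.ncard_coe_finset, Finset.card_biUnion,
    ← sum_keysOf]
  · refine Finset.sum_congr rfl fun K hK => ?_
    obtain ⟨e, he, h1, rfl⟩ := (hm _).1 hK
    have h2 := (keyTable_spec he).1.1
    have h3 := List.all_eq_true.1 Code.keyTable_links e he
    simp only [Bool.and_eq_true, Nat.beq_eq] at h3
    have h4 := h3.1.2
    rw [Finset.card_product, card_pairsWith isProfileList_eight h2.1.1 h2.1.2 h4.1.1 h4.1.2,
      card_pairsWith isProfileList_seven h2.2.1 h2.2.2 h4.2.1 h4.2.2]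
  · intro K _ L _ hKL
    refine Finset.disjoint_left.2 fun x hx hy => ?_
    simp only [pairsWith, Finset.mem_product, Finset.mem_filter] at hx hy
    exact hKL (Prod.ext (hx.1.2.symm.trans hy.1.2) (hx.2.2.symm.trans hy.2.2))

/-! ### Representatives of the constructed Hadamard matrices -/

/-- For each row of the table, the codes of base sequences whose Hadamard matrices represent the
classes constructed from it, with the scores of these matrices. -/
def hadTable : List (List (ℕ × ℕ)) := [
  [(243864589, 3944157161604), (294196237, 3946078149696), (772346893, 3945750994404),
   (822678541, 3944668866112), (246879245, 3944987631656), (297210893, 3945180569700),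
   (775361549, 3945298010180), (825693197, 3945868434444), (77403149, 3941506366668),
   (463279117, 3940675898472), (605885453, 3940592012680), (991761421, 3942328449324),
   (77796365, 3941581862600), (463672333, 3938780074064), (606278669, 3939266612992),
   (992154637, 3941514753944), (243876122, 3940013197812), (294207770, 3943351857924),
   (772358426, 3942924039360), (822690074, 3938696187976), (246890778, 3943536406476),
   (297222426, 3943226027016), (775373082, 3943720954156), (825704730, 3942915650228),
   (77414682, 3939040121228), (463290650, 3943779675368), (605896986, 3942999535932),
   (991772954, 3938117375492), (77807898, 3944014554208), (463683866, 3944853415680),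
   (606290202, 3945683886852), (992166170, 3943116974076)],
  [(210048013, 3939300170904), (428151821, 3944727587036), (637867021, 3944559815076),
   (855970829, 3939216284872), (212800525, 3943049868668), (430904333, 3939098841224),
   (640619533, 3939509882516), (858723341, 3943460909944), (43586573, 3942160679316),
   (395908109, 3943645456304), (672732173, 3943393798344), (1025053709, 3942320062688),
   (45290509, 3941967738240), (397612045, 3943377023152), (674436109, 3942848541468),
   (1026757645, 3942882095452), (143463437, 3944140384252), (495784973, 3944333322136),
   (571282445, 3944064887008), (923603981, 3943729342936), (145167373, 3945683884388),
   (497488909, 3936263499728), (572986381, 3936833924352), (925307917, 3945667107212),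
   (110171149, 3939660880460), (328274957, 3944073275028), (739316749, 3943905502916),
   (957420557, 3940734620964), (112923661, 3942848542580), (331027469, 3942068405752),
   (742069261, 3942101960112), (960173069, 3943058257528), (210059546, 3941607028900),
   (428163354, 3939988040264), (637878554, 3940852065908), (855982362, 3941447645456),
   (212812058, 3943150529484), (430915866, 3941162434072), (640631066, 3940558454976),
   (858734874, 3943393798592), (43598106, 3943796451072), (395919642, 3942227785396),
   (672743706, 3942991147776), (1025065242, 3943645456096), (45302042, 3944710807764),
   (397623578, 3944249435160), (674447642, 3943989388660), (1026769178, 3944165549352),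
   (143474970, 3939845424716), (495796506, 3941867076016), (571293978, 3941523143388),
   (923615514, 3940080305436), (145178906, 3939769930696), (497500442, 3943402186596),
   (572997914, 3943184083028), (925319450, 3939560215676), (110182682, 3942353613336),
   (328286490, 3942932427356), (739328282, 3942814986740), (957432090, 3942252949936),
   (112935194, 3939425996420), (331039002, 3942328448044), (742080794, 3942471054040),
   (960184602, 3940566845204)],
  [(176753932, 3944811470828), (361303308, 3943309914704), (705236236, 3943813230544),
   (889785612, 3945616776204), (179768588, 3943259581224), (364317964, 3942982759124),
   (708250892, 3942345225636), (892800268, 3943502850372), (76877068, 3945264454748),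
   (462753036, 3940633953004), (605359372, 3941212766296), (991235340, 3946724070820),
   (78318860, 3944173939868), (464194828, 3944735974176), (606801164, 3943922280148),
   (992677132, 3943460909048), (243357978, 3943611901648), (293689626, 3944484314384),
   (771840282, 3944375263020), (822171930, 3942798207748), (247421210, 3944350098464),
   (297752858, 3944140384540), (775903514, 3943158918256), (826235162, 3944450761680),
   (10311962, 3941892239556), (530405658, 3943318300460), (538794266, 3944945688188),
   (1058887962, 3943276357944), (10705178, 3945977485952), (530798874, 3945532890188),
   (539187482, 3945818102724), (1059281178, 3943519627132)],
  [(109390865, 3942957592936), (327494673, 3944912133668), (738536465, 3945096682836),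
   (956640273, 3944031333520), (112143377, 3943964222344), (330247185, 3944559813300),
   (741288977, 3943989388908), (959392785, 3944484315400), (42806289, 3945298008636),
   (395127825, 3943980999120), (671951889, 3944433983552), (1024273425, 3944979241828),
   (44510225, 3943452518252), (396831761, 3945021187240), (673655825, 3944618534624),
   (1025977361, 3944350098336), (109404450, 3939543436156), (327508258, 3942521385416),
   (738550050, 3942521385416), (956653858, 3940801725916), (112156962, 3945130236508),
   (330260770, 3945012799324), (741302562, 3943611903408), (959406370, 3944593366428),
   (42819874, 3944996020516), (395141410, 3941959351292), (671965474, 3941531532744),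
   (1024287010, 3945541279280), (44523810, 3944408818468), (396845346, 3943863560680),
   (673669410, 3944090052820), (1025990946, 3944593367500)],
  [(344140817, 3940885610028), (444804113, 3942831764636), (620964881, 3941942573364),
   (721628177, 3940893998608), (345975825, 3942227785684), (446639121, 3942949206204),
   (622799889, 3942110346452), (723463185, 3942018070752), (27864081, 3942512997604),
   (262745105, 3945818102492), (808004625, 3944903745552), (1042885649, 3941791577844),
   (28650513, 3943259581168), (263531537, 3942982756556), (808791057, 3943200859924),
   (1043672081, 3943905503356), (277556241, 3943393799640), (512437265, 3943184083372),
   (554380305, 3943267969428), (789261329, 3943729343648), (278342673, 3941195988032),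
   (513223697, 3942294892804), (555166737, 3941883851816), (790047761, 3941959350180),
   (94448657, 3943259581064), (195111953, 3941372147220), (874589201, 3941221152476),
   (975252497, 3943830005624), (96283665, 3936531932544), (196946961, 3939669269784),
   (876424209, 3940340357624), (977087505, 3937974771360), (344154402, 3943410576184),
   (444817698, 3945490949288), (620978466, 3945130239564), (721641762, 3942672379624),
   (345989410, 3942705935032), (446652706, 3939451166320), (622813474, 3939249839968),
   (723476770, 3942496219996), (27877666, 3939476328060), (262758690, 3943502851660),
   (808018210, 3945205737168), (1042899234, 3940894001024), (28664098, 3941950963008),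
   (263545122, 3941254710012), (808804642, 3941900632048), (1043685666, 3941162434816),
   (277569826, 3939358890204), (512450850, 3941909019756), (554393890, 3942261340796),
   (789274914, 3938629081840), (278356258, 3941615416936), (513237282, 3943133754988),
   (555180322, 3943511241872), (790061346, 3941523142236), (94462242, 3940097083740),
   (195125538, 3939182728008), (874602786, 3939493106164), (975266082, 3939283389664),
   (96297250, 3942789819024), (196960546, 3939568601592), (876437794, 3939929311212),
   (977101090, 3943796450760)],
  [(176775430, 3940516514732), (361324806, 3945180569452), (705257734, 3945180569412),
   (889807110, 3939820261048), (179790086, 3942672380448), (364339462, 3940088693184),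
   (708272390, 3940533288612), (892821766, 3942194230284), (76898566, 3943821617684),
   (462774534, 3944517870488), (605380870, 3943511238832), (991256838, 3942814986036),
   (78340358, 3942462666124), (464216326, 3943452519796), (606822662, 3942781431900),
   (992698630, 3944299768568), (243348780, 3940491348072), (293680428, 3944299768392),
   (771831084, 3944652089264), (822162732, 3940910778008), (247412012, 3944635310480),
   (297743660, 3942034847648), (775894316, 3941447645696), (826225964, 3944257823660),
   (10302764, 3944090053212), (530396460, 3943444132096), (538785068, 3943360246136),
   (1058878764, 3944098441808), (10695980, 3945298009436), (530789676, 3937404346032),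
   (539178284, 3937739889912), (1059271980, 3945860045312)],
  [(252318482, 3942118733016), (503976722, 3940281631052), (562696978, 3940147413484),
   (814355218, 3942580105956), (254284562, 3943427353632), (505942802, 3941439258284),
   (564663058, 3939686041704), (816321298, 3942890483432), (85857042, 3943335079348),
   (337515282, 3945155403288), (731779858, 3945700661940), (983438098, 3944408819948),
   (87823122, 3943871949380), (339481362, 3942236172960), (733745938, 3942403945112),
   (985404178, 3944551425320), (184698397, 3942328446748), (436356637, 3941867074560),
   (629294621, 3942840151640), (880952861, 3941976125188), (186664477, 3940340352464),
   (438322717, 3943267969996), (631260701, 3943385410324), (882918941, 3940793336768),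
   (18236957, 3943318301644), (269895197, 3942705935520), (798377501, 3942412334620),
   (1050035741, 3943981000992), (20203037, 3944375264436), (271861277, 3944039719964),
   (800343581, 3943377020632), (1052001821, 3943687399596)],
  [(218514949, 3941212768360), (369509893, 3939501495440), (696665605, 3939526661476),
   (847660549, 3941221156876), (221267461, 3941841909836), (372262405, 3940633952612),
   (699418117, 3941279874608), (850413061, 3942043236148), (52053509, 3944668866184),
   (404375045, 3941934187592), (664421893, 3941799969832), (1016743429, 3943595125624),
   (53233157, 3942412333924), (405554693, 3943309914504), (665601541, 3944056499356),
   (1017923077, 3942127121388), (151930373, 3940868837940), (302925317, 3943150529228),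
   (764298757, 3943343466808), (915293701, 3940726231720), (154682885, 3939904149320),
   (305677829, 3943494462496), (767051269, 3943284747524), (918046213, 3939241450068),
   (118638085, 3942143901668), (470959621, 3941640585636), (596788741, 3941237932772),
   (949110277, 3942362005244), (119817733, 3940290021560), (472139269, 3945272844288),
   (597968389, 3945012797364), (950289925, 3939719596712), (218501898, 3941716081728),
   (369496842, 3941858687548), (696652554, 3940835278532), (847647498, 3941271486044),
   (221254410, 3943695788552), (372249354, 3944140383212), (699405066, 3943150528652),
   (850400010, 3943049866548), (52040458, 3940575237352), (404361994, 3943796452872),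
   (664408842, 3944039722268), (1016730378, 3937404347208), (53220106, 3944652088016),
   (405541642, 3941766411448), (665588490, 3943234416188), (1017910026, 3944652087976),
   (151917322, 3944811472020), (302912266, 3941523143468), (764285706, 3942269728520),
   (915280650, 3944710808652), (154669834, 3940902387020), (305664778, 3943628681008),
   (767038218, 3944215882920), (918033162, 3942001293440), (118625034, 3942940816544),
   (470946570, 3943192474352), (596775690, 3943301526092), (949097226, 3942252951584),
   (119804682, 3944308155108), (472126218, 3939300166824), (597955338, 3938520027140),
   (950276874, 3945029574372)],
  [(386667019, 3944131995400), (487330315, 3944291378412), (579605003, 3943175695312),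
   (680268299, 3943133752356), (387453451, 3941749634312), (488116747, 3943075032864),
   (580391435, 3941833520440), (681054731, 3941607028244), (103682571, 3942135510184),
   (204345867, 3942512998804), (867045899, 3940642341496), (967709195, 3943024701448),
   (104469003, 3944081663520), (205132299, 3941103713148), (867832331, 3940726226360),
   (968495627, 3943955834524), (319053341, 3942521384416), (419716637, 3940575231504),
   (646209053, 3940893998376), (746872349, 3942747876556), (319839773, 3944492704644),
   (420503069, 3941086935716), (646995485, 3942672380528), (747658781, 3944073274788),
   (36068893, 3944215881672), (136732189, 3946052982020), (933649949, 3946321417116),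
   (1034313245, 3943511239480), (36855325, 3941212766344), (137518621, 3943637068436),
   (934436381, 3943326690320), (1035099677, 3941204377444)],
  [(287052299, 3943586737084), (781980171, 3943754509084), (237113867, 3941758024132),
   (832705035, 3942370391736), (453533213, 3945113460196), (612916765, 3944417206552),
   (70671901, 3943821616988), (1001807389, 3943788062684)],
  [(319577605, 3942437500664), (420240901, 3940994662184), (646733317, 3939702818256),
   (747396613, 3941791578604), (320364037, 3944173938492), (421027333, 3942622046592),
   (647519749, 3943863559248), (748183045, 3942596882084), (103177733, 3943838393444),
   (203841029, 3943133752900), (866541061, 3943184084836), (967204357, 3944182325960),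
   (103964165, 3942085178112), (204627461, 3941388924860), (867327493, 3941221152900),
   (967990789, 3942236172896), (319556362, 3941934182384), (420219658, 3939476326516),
   (646712074, 3940231300156), (747375370, 3941271483268), (320342794, 3942680768524),
   (421006090, 3942143900676), (647498506, 3942630439308), (748161802, 3942714323036),
   (103156490, 3943192473768), (203819786, 3941774800740), (866519818, 3941917406896),
   (967183114, 3942236173368), (103942922, 3942596884668), (204606218, 3940281631868),
   (867306250, 3940474569456), (967969546, 3941095326032)],
  [(386158093, 3936917808680), (486821389, 3942814986868), (579096077, 3943830007256),
   (679759373, 3936196389272), (386944525, 3944274601028), (487607821, 3944635309432),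
   (579882509, 3943830004384), (680545805, 3944719196640), (36589069, 3943435740868),
   (137252365, 3942756264944), (934170125, 3942596881668), (1034833421, 3942932425236),
   (37375501, 3944014554936), (138038797, 3942596883732), (934956557, 3942814987332),
   (1035619853, 3944417207696), (386145050, 3944425596516), (486808346, 3944568202824),
   (579083034, 3943192472856), (679746330, 3944148772712), (386931482, 3941749635856),
   (487594778, 3944425595004), (579869466, 3944593366964), (680532762, 3942143899596),
   (36576026, 3945801325988), (137239322, 3946388526900), (934157082, 3945901988268),
   (1034820378, 3946749237592), (37362458, 3939291779028), (138025754, 3944392043196),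
   (934943514, 3944710810292), (1035606810, 3939182727344)],
  [(185237017, 3941925795428), (629833241, 3942747877900), (187203097, 3942177455132),
   (631799321, 3942546553212), (85360153, 3940541677800), (731282969, 3940952719212),
   (87326233, 3942261339404), (733249049, 3942957592848), (251802155, 3941657360388),
   (503460395, 3939878979924), (562180651, 3938998177320), (813838891, 3941607028788),
   (18756139, 3943343469496), (270414379, 3943779675064), (798896683, 3944383654312),
   (1050554923, 3943460909888)],
  [(252341769, 3940642341680), (504000009, 3946078150360), (562720265, 3945440617000),
   (814378505, 3940273243560), (254307849, 3944333321440), (505966089, 3941229542272),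
   (564686345, 3941380537008), (816344585, 3943871948820), (85880329, 3942076788060),
   (337538569, 3944014555400), (731803145, 3943041477992), (983461385, 3943343466232),
   (87846409, 3942991144744), (339504649, 3943259580424), (733769225, 3942940813720),
   (985427465, 3944190714308), (184695331, 3946724069684), (436353571, 3947177053588),
   (629291555, 3947588094912), (880949795, 3946388525700), (186661411, 3944165548272),
   (438319651, 3944006165156), (631257635, 3944685641688), (882915875, 3944584978304),
   (18233891, 3943427353440), (269892131, 3942244561044), (798374435, 3942747876732),
   (1050032675, 3942412333156), (20199971, 3943049867692), (271858211, 3944954076568),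
   (800340515, 3945625164192), (1051998755, 3942982758564)],
  [(185213702, 3942462665412), (436871942, 3942336837352), (629809926, 3942177454052),
   (881468166, 3942202618904), (187179782, 3944677252900), (438838022, 3942294892724),
   (631776006, 3941799965392), (883434246, 3944224268596), (85336838, 3946841509580),
   (336995078, 3946279474576), (731259654, 3946262697648), (982917894, 3945918763724),
   (87302918, 3941279875576), (338961158, 3943192472456), (733225734, 3943385410180),
   (984883974, 3940617176284), (251817525, 3943158917832), (503475765, 3943368634956),
   (562196021, 3943184085676), (813854261, 3943326689808), (253783605, 3944031333880),
   (505441845, 3945096684356), (564162101, 3944140384172), (815820341, 3943460908888),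
   (18771509, 3943091808880), (270429749, 3942974370008), (798912053, 3942328447836),
   (1050570293, 3942613658484), (20737589, 3944652087088), (272395829, 3942018070096),
   (800878133, 3941950961120), (1052536373, 3944257822572)],
  [(453520142, 3936968144720), (70658830, 3936322215196), (287079973, 3941942571660),
   (782007845, 3943939058004), (237141541, 3943058258720), (832732709, 3944803087184)],
  [(319040270, 3943360245544), (419703566, 3942798209684), (319826702, 3942924040016),
   (420489998, 3943259583984), (36055822, 3943133752436), (136719118, 3943226026672),
   (36842254, 3945021185304), (137505550, 3943528014792), (386694693, 3944534646408),
   (579632677, 3945725827392), (387481125, 3944526260580), (580419109, 3944635312272),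
   (103710245, 3942261340244), (867073573, 3941497977720), (104496677, 3941162434952),
   (867860005, 3940273243400)]]

/-- The representatives for a row of the table. -/
def hadList (k : ℕ) : List (ℕ × ℕ) := hadTable.getD k []

/-- The matrix constructed from `quad r.1` is a Hadamard matrix with score `r.2`. -/
def hadCheck (r : ℕ × ℕ) : Bool :=
  (weightsDvd (rowBits r.1) 60 && pairsBalanced (rowBits r.1) 60) &&
    Nat.beq (totalScore (rowBits r.1) 60) r.2

/-- The numbers `16 j, …, 16 j + 15` of the representatives pass the check. -/
def blockCheck (j : ℕ) : Bool := ((hadTable.flatten.drop (16 * j)).take 16).all hadCheck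

/-- As 558 = 34 · 16 + 14, the 35 blocks cover the list; the last one is shorter. -/
theorem blockCheck_eq {j : ℕ} (hj : j < 35) : blockCheck j = true := by
  interval_cases j <;> decide +kernel

theorem hadCheck_eq {r : ℕ × ℕ} (hr : r ∈ hadTable.flatten) : hadCheck r = true := by
  obtain ⟨i, hi, rfl⟩ := List.mem_iff_getElem.1 hr
  have hl : hadTable.flatten.length = 558 := by decide +kernel
  have h := blockCheck_eq (show i / 16 < 35 by omega)
  refine List.all_eq_true.1 h _ (List.mem_iff_getElem.2 ⟨i % 16, ?_, ?_⟩)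
  · rw [List.length_take, List.length_drop]
    omega
  · rw [List.getElem_take, List.getElem_drop]
    congr 1
    omega

/-! ### Equivalence of Hadamard matrices -/

theorem hadamardEquivalent_refl {N : ℕ} (A : Matrix (Fin N) (Fin N) ℤ) : HadamardEquivalent A A :=
  hadamardEquivalent_iff.2 ⟨1, 1, 1, 1, by simp⟩

theorem hadamardEquivalent_symm {N : ℕ} {A B : Matrix (Fin N) (Fin N) ℤ}
    (h : HadamardEquivalent A B) : HadamardEquivalent B A := by
  obtain ⟨P, Q, hP, hQ, rfl⟩ := h
  obtain ⟨P', hP', h1, -⟩ := hP.exists_inv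
  obtain ⟨Q', hQ', -, h2⟩ := hQ.exists_inv
  refine ⟨P', Q', hP', hQ', ?_⟩
  calc A = (P' * P) * A * (Q * Q') := by rw [h1, h2]; simp
    _ = P' * (P * A * Q) * Q' := by simp only [Matrix.mul_assoc]

theorem hadamardEquivalent_trans {N : ℕ} {A B C : Matrix (Fin N) (Fin N) ℤ}
    (h : HadamardEquivalent A B) (h' : HadamardEquivalent B C) : HadamardEquivalent A C := by
  obtain ⟨P, Q, hP, hQ, rfl⟩ := h
  obtain ⟨P', Q', hP', hQ', rfl⟩ := h'
  exact ⟨P' * P, Q * Q', hP'.mul hP, hQ.mul hQ', by simp only [Matrix.mul_assoc]⟩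

/-- Signed permutations keep the entries ±1 and the orthogonality of the rows. -/
theorem isHadamard_of_hadamardEquivalent {N : ℕ} [NeZero N] {A B : Matrix (Fin N) (Fin N) ℤ}
    (h : HadamardEquivalent A B) (hA : A.IsHadamard) : B.IsHadamard := by
  obtain ⟨σ, τ, ε, δ, h⟩ := hadamardEquivalent_iff.1 h
  have hu : ∀ u : ℤˣ, ((u : ℤˣ) : ℤ) * u = 1 := fun u => by
    rw [← Units.val_mul, Int.units_mul_self, Units.val_one]
  have hA' := hA.mul_conjTranspose
  refine Matrix.IsHadamard.of_mul_conjTranspose ?_ ?_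
    (IsRegular.of_ne_zero (by simp [NeZero.ne N]))
  · intro i j
    obtain ⟨j, rfl⟩ := τ.surjective j
    have h1 := hA.apply_mem (σ i) j
    rw [Unitary.mem_iff_eq_one_or_eq_neg_one] at h1 ⊢
    rw [h]
    rcases Int.units_eq_one_or (ε i) with h2 | h2 <;> rcases Int.units_eq_one_or (δ j) with h3 | h3 <;>
      rcases h1 with h1 | h1 <;> simp [h1, h2, h3]
  · ext i k
    have h1 := congrFun (congrFun hA' (σ i)) (σ k)
    simp only [Matrix.mul_apply, Matrix.conjTranspose_apply, star_trivial, Matrix.smul_apply,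
      Matrix.one_apply, EmbeddingLike.apply_eq_iff_eq] at h1 ⊢
    rw [← Equiv.sum_comp τ]
    have h2 : ∀ j, B i (τ j) * B k (τ j) = ε i * ε k * (A (σ i) j * A (σ k) j) := by
      intro j
      rw [h, h]
      linear_combination (((ε i : ℤˣ) : ℤ) * ε k * (A (σ i) j * A (σ k) j)) * hu (δ j)
    rw [Finset.sum_congr rfl fun j _ => h2 j, ← Finset.mul_sum, h1]
    split_ifs with h3
    · rw [h3, hu, one_mul]
    · simp

/-- The rows `r` with the rows `j` and `59` interchanged. -/
def swapRows (r : ℕ → ℕ) (j i : ℕ) : ℕ := bif Nat.beq i j then r 59 else bif Nat.beq i 59 then r j else r i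

/-- The lane computation gives the local score of the last row only. Interchanging the row `j` with
the last row is an equivalence that carries the one local score to the other. -/
theorem localScore_eq_quadScore {H : Matrix (Fin 60) (Fin 60) ℤ} {r : ℕ → ℕ}
    (hr : ∀ i, r i < 2 ^ 60) (hH : ∀ i j : Fin 60, H i j = (bitSign (r i) j : ℤˣ)) (j : Fin 60)
    (hd : lanesDvd (tripleCount 59) (quadWeights (swapRows r j) 59) = true) :
    localScore H j = quadScore (swapRows r j) 59 := by
  have hs : ∀ i, swapRows r j i < 2 ^ 60 := by
    intro i
    unfold swapRows
    cases Nat.beq i j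
    · cases Nat.beq i 59
      · exact hr i
      · exact hr j
    · exact hr 59
  have h1 : ∀ i : Fin 60, swapRows r j i = r (Equiv.swap j (Fin.last 59) i : Fin 60) := by
    intro i
    unfold swapRows
    rw [Equiv.swap_apply_def]
    by_cases h2 : i = j
    · subst h2
      rw [if_pos rfl, Nat.beq_refl]
      rfl
    · have h3 : Nat.beq i j = false := by
        rw [Bool.eq_false_iff, ne_eq, Nat.beq_eq]
        exact fun h => h2 (Fin.ext h)
      rw [if_neg h2, h3, cond_false]
      by_cases h4 : i = Fin.last 59
      · subst h4
        rw [if_pos rfl]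
        rfl
      · have h5 : Nat.beq i 59 = false := by
          rw [Bool.eq_false_iff, ne_eq, Nat.beq_eq]
          exact fun h => h4 (Fin.ext h)
        rw [if_neg h4, h5, cond_false]
  have h2 := localScore_last_eq (H := H.submatrix (Equiv.swap j (Fin.last 59)) id) hs
    (fun i k => by rw [Matrix.submatrix_apply, hH, ← h1]; rfl) hd
  have h3 := localScore_apply (A := H) (B := H.submatrix (Equiv.swap j (Fin.last 59)) id)
    (σ := Equiv.swap j (Fin.last 59)) (τ := 1) (ε := 1) (δ := 1) (by simp) (Fin.last 59)
  rw [Equiv.swap_apply_right] at h3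
  exact h3.symm.trans h2

/-- No local score of the rows `r` is `v`. -/
def avoidsScore (r : ℕ → ℕ) (v : ℕ) : Bool := allBelow 60 fun j =>
  lanesDvd (tripleCount 59) (quadWeights (swapRows r j) 59) &&
    !Nat.beq (quadScore (swapRows r j) 59) v

/-- An equivalence would match the row `i` of the second matrix with a row of the first having the
same local score `v`, and there is none. -/
theorem not_hadamardEquivalent_of_avoidsScore {m n v i : ℕ} (hm : avoidsScore (rowBits m) v = true)
    (hi : i < 60) (hd : lanesDvd (tripleCount 59) (quadWeights (swapRows (rowBits n) i) 59) = true)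
    (hn : quadScore (swapRows (rowBits n) i) 59 = v) :
    ¬HadamardEquivalent (hadMat (quad m)) (hadMat (quad n)) := by
  intro h
  obtain ⟨σ, h⟩ := localScore_eq_of_hadamardEquivalent h
  have h1 := h ⟨i, hi⟩
  have h2 := of_allBelow hm (σ ⟨i, hi⟩).2
  rw [Bool.and_eq_true, Bool.not_eq_true', Bool.eq_false_iff, ne_eq, Nat.beq_eq] at h2
  rw [localScore_eq_quadScore (rowBits_lt n) (hadMat_quad_apply n) ⟨i, hi⟩ hd, hn,
    localScore_eq_quadScore (rowBits_lt m) (hadMat_quad_apply m) _ h2.1] at h1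
  exact h2.2 h1

/-! ### Reaching the representatives -/

/-! ### Transformations of codes that preserve the Hadamard class -/

namespace Code

/-- Transformations of codes which preserve the class of the constructed matrix. -/
def turn : ℕ → Code → Code
  | 0, ⟨a, b, c, d⟩ => ⟨a, b, negCode 7 c, negCode 7 d⟩
  | 1, ⟨a, b, c, d⟩ => ⟨negCode 8 a, b, negCode 7 c, d⟩
  | 2, ⟨a, b, c, d⟩ => ⟨negCode 8 a, negCode 8 b, c, d⟩
  | 3, ⟨a, b, c, d⟩ => ⟨b, a, d, c⟩
  | _, ⟨a, b, c, d⟩ => ⟨revCode 8 a, b, revCode 7 c, d⟩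

/-- The result of several such transformations. -/
def turns (w : List ℕ) (t : Code) : Code := w.foldl (fun t o => turn o t) t

theorem turns_append (w w' : List ℕ) (t : Code) : turns (w ++ w') t = turns w' (turns w t) :=
  List.foldl_append

theorem hadamardEquivalent_turn (o : ℕ) (t : Code) :
    HadamardEquivalent (hadMat t.toQuad) (hadMat (turn o t).toQuad) := by
  obtain ⟨a, b, c, d⟩ := t
  match o with
  | 0 => simpa only [toQuad, mkq, turn, seq_negCode] using hadamardEquivalent_negCD _ _ _ _
  | 1 => simpa only [toQuad, mkq, turn, seq_negCode] using hadamardEquivalent_negAC _ _ _ _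
  | 2 => simpa only [toQuad, mkq, turn, seq_negCode] using hadamardEquivalent_negAB _ _ _ _
  | 3 => exact hadamardEquivalent_swap _ _ _ _
  | _ + 4 => simpa only [toQuad, mkq, turn, seq_revCode] using hadamardEquivalent_revAC _ _ _ _

theorem hadamardEquivalent_turns (w : List ℕ) (t : Code) :
    HadamardEquivalent (hadMat t.toQuad) (hadMat (turns w t).toQuad) := by
  induction w generalizing t with
  | nil => exact hadamardEquivalent_refl _
  | cons o w ih => exact hadamardEquivalent_trans (hadamardEquivalent_turn o t) (ih _)

theorem inRange_turn {t : Code} (h : t.InRange) (o : ℕ) : (turn o t).InRange := by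
  obtain ⟨a, b, c, d⟩ := t
  obtain ⟨ha, hb, hc, hd⟩ := h
  match o with
  | 0 => exact ⟨ha, hb, negCode_lt hc, negCode_lt hd⟩
  | 1 => exact ⟨negCode_lt ha, hb, negCode_lt hc, hd⟩
  | 2 => exact ⟨negCode_lt ha, negCode_lt hb, hc, hd⟩
  | 3 => exact ⟨hb, ha, hd, hc⟩
  | _ + 4 => exact ⟨revCode_lt _ _, hb, revCode_lt _ _, hd⟩

theorem inRange_turns {t : Code} (h : t.InRange) (w : List ℕ) : (turns w t).InRange := by
  induction w generalizing t with
  | nil => exact h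
  | cons o w ih => exact ih (inRange_turn h o)

/-- A may be negated or reversed if the same is done to C. So A can be made canonical, and C moves
within its orbit. -/
theorem exists_turns_canon₁ (a b c d : ℕ) :
    ∃ w, ∃ c' ∈ orbit 7 c, turns w ⟨a, b, c, d⟩ = ⟨canon 8 a, b, c', d⟩ := by
  have h := canon_mem_orbit 8 a
  simp only [orbit, List.mem_cons, List.not_mem_nil, or_false] at h
  rcases h with h | h | h | h <;> rw [h]
  · exact ⟨[], c, by simp [orbit], rfl⟩
  · exact ⟨[1], negCode 7 c, by simp [orbit], rfl⟩
  · exact ⟨[4], revCode 7 c, by simp [orbit], rfl⟩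
  · exact ⟨[4, 1], negCode 7 (revCode 7 c), by simp [orbit], rfl⟩

theorem exists_turns_canon (a b c d : ℕ) : ∃ w, ∃ c' ∈ orbit 7 c, ∃ d' ∈ orbit 7 d,
    turns w ⟨a, b, c, d⟩ = ⟨canon 8 a, canon 8 b, c', d'⟩ := by
  obtain ⟨w, c', hc, h⟩ := exists_turns_canon₁ a b c d
  obtain ⟨w', d', hd, h'⟩ := exists_turns_canon₁ b (canon 8 a) d c'
  -- The pairs (A,C) and (B,D) are interchanged, B is made canonical as A was before, and the pairs
  -- are interchanged back.
  refine ⟨w ++ ([3] ++ (w' ++ [3])), c', hc, d', hd, ?_⟩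
  rw [turns_append, h, turns_append, turns_append]
  change turn 3 (turns w' ⟨b, canon 8 a, d, c'⟩) = _
  rw [h']
  rfl

/-- All codes as a single number. -/
def pack (t : Code) : ℕ :=
  Nat.add (Nat.add t.a (Nat.mul 256 t.b)) (Nat.add (Nat.mul 65536 t.c) (Nat.mul 8388608 t.d))

/-- The codes given by a single number. -/
def unpack (n : ℕ) : Code :=
  ⟨Nat.mod n 256, Nat.mod (Nat.div n 256) 256, Nat.mod (Nat.div n 65536) 128,
    Nat.mod (Nat.div n 8388608) 128⟩

theorem inRange_unpack (n : ℕ) : (unpack n).InRange :=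
  ⟨Nat.mod_lt _ (by norm_num), Nat.mod_lt _ (by norm_num), Nat.mod_lt _ (by norm_num),
    Nat.mod_lt _ (by norm_num)⟩

theorem unpack_pack {t : Code} (h : t.InRange) : unpack (pack t) = t := by
  obtain ⟨a, b, c, d⟩ := t
  obtain ⟨ha, hb, hc, hd⟩ := h
  dsimp only at ha hb hc hd
  change Code.mk ((a + 256 * b + (65536 * c + 8388608 * d)) % 256)
    ((a + 256 * b + (65536 * c + 8388608 * d)) / 256 % 256)
    ((a + 256 * b + (65536 * c + 8388608 * d)) / 65536 % 128)
    ((a + 256 * b + (65536 * c + 8388608 * d)) / 8388608 % 128) = _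
  rw [Code.mk.injEq]
  refine ⟨?_, ?_, ?_, ?_⟩ <;> omega

theorem toQuad_unpack (n : ℕ) : (unpack n).toQuad = quad n := by
  have h : ∀ m k, seq m (k % 2 ^ m) = seq m k := by
    intro m k
    ext1 i
    simp [seq, bitSign, Nat.testBit_mod_two_pow]
  have h1 : (unpack n).toQuad = mkq (n % 2 ^ 8) (n / 2 ^ 8 % 2 ^ 8) (n / 2 ^ 16 % 2 ^ 7)
    (n / 2 ^ 23 % 2 ^ 7) := rfl
  rw [h1, mkq, h, h, h, h]
  simp only [← Nat.shiftRight_eq_div_pow]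
  rfl

end Code

/-- Transformations by which the representatives are reached. -/
def turnWords : List (List ℕ) := [[], [0], [3, 4, 3], [0, 3, 4, 3], [3, 1, 4, 3], [0, 3, 1, 4, 3], [0, 1, 4], [1, 4]]

/-- The base sequences with codes `e.p₁, e.p₂, c, d` are turned into a representative. -/
def reaches (e : KeyEntry) (c d : ℕ) : Bool := turnWords.any fun w =>
  (hadList e.cls).any fun r => Nat.beq r.1 (Code.turns w ⟨e.p₁, e.p₂, c, d⟩).pack

/-- Once A and B are canonical and sorted, what remains for each key is finite: C and D run through
two orbits, in either order. Each of these quadruples is led to the list by one of eight words. -/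
theorem reaches_keyTable : (keyTable.all fun e => (orbit 7 e.q₁).all fun c => (orbit 7 e.q₂).all fun d =>
    reaches e c d && reaches e d c) = true := by
  decide +kernel

theorem cls_hadTable : allBelow 17 (fun k => (hadList k).all fun r =>
    Nat.beq (Code.unpack r.1).cls k) = true := by
  decide +kernel

theorem length_hadList : ∀ k : Fin 17, (hadList k).length = (table k).had := by decide +kernel

/-- The upper bound: the matrices constructed from one class meet no equivalence classes other than
those of the listed matrices in the same row. -/
theorem exists_hadList (x : BS 8 7) :
    ∃ r ∈ hadList (rowOf x), HadamardEquivalent (hadMat x.1) (hadMat (quad r.1)) := by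
  obtain ⟨e, he, h1, h2, h3⟩ := Code.exists_of_cls_lt (rowOf_lt x)
  have hx := Code.inRange_ofQuad x.1
  obtain ⟨w, c, hc, d, hd, h4⟩ := Code.exists_turns_canon (Code.ofQuad x.1).a (Code.ofQuad x.1).b
    (Code.ofQuad x.1).c (Code.ofQuad x.1).d
  -- The check refers to the orbits of the canonical codes, whereas `c` and `d` were found in the
  -- orbits of the original ones.
  have hself : ∀ {n k : ℕ}, n < 2 ^ 7 → k ∈ orbit 7 n → k ∈ orbit 7 (canon 7 n) := by
    intro n k hn hk
    rw [← isProfileList_seven.canon_orbit hn hk]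
    exact (isProfileList_seven.spec (orbit_lt hn hk)).2.2.2.2.2.1
  have hc' := hself hx.2.2.1 hc
  have hd' := hself hx.2.2.2 hd
  -- If A and B come in the wrong order, turn 3 sorts them, but it interchanges C and D as well.
  -- This is why both orders of C and D were checked.
  have h5 : ∃ w c d, Code.turns w (Code.ofQuad x.1) = ⟨e.p₁, e.p₂, c, d⟩ ∧
      (c ∈ orbit 7 e.q₁ ∧ d ∈ orbit 7 e.q₂ ∨ c ∈ orbit 7 e.q₂ ∧ d ∈ orbit 7 e.q₁) := by
    rcases sortPair_eq h1 with ⟨ha, hb⟩ | ⟨ha, hb⟩ <;> rcases sortPair_eq h2 with ⟨h6, h7⟩ | ⟨h6, h7⟩ <;>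
      rw [ha, hb] at h4 <;> rw [h6] at hc' <;> rw [h7] at hd'
    · exact ⟨w, c, d, h4, Or.inl ⟨hc', hd'⟩⟩
    · exact ⟨w, c, d, h4, Or.inr ⟨hc', hd'⟩⟩
    · exact ⟨w ++ [3], d, c, (Code.turns_append _ _ _).trans (congrArg (Code.turns [3]) h4),
        Or.inr ⟨hd', hc'⟩⟩
    · exact ⟨w ++ [3], d, c, (Code.turns_append _ _ _).trans (congrArg (Code.turns [3]) h4),
        Or.inl ⟨hd', hc'⟩⟩
  obtain ⟨w, c, d, h5, hcd⟩ := h5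
  have h6 : reaches e c d = true := by
    have h := List.all_eq_true.1 reaches_keyTable e he
    simp only [List.all_eq_true, Bool.and_eq_true] at h
    rcases hcd with ⟨hc, hd⟩ | ⟨hc, hd⟩
    · exact (h c hc d hd).1
    · exact (h d hd c hc).2
  simp only [reaches, List.any_eq_true, Nat.beq_eq] at h6
  obtain ⟨w', -, r, hr, h7⟩ := h6
  refine ⟨r, by rw [h3] at hr; exact hr, ?_⟩
  rw [h7, ← Code.toQuad_unpack, Code.unpack_pack, ← h5, ← Code.turns_append]
  · have h := Code.hadamardEquivalent_turns (w ++ w') (Code.ofQuad x.1)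
    rwa [Code.toQuad_ofQuad] at h
  · rw [← h5]
    exact Code.inRange_turns (Code.inRange_turns hx w) w'

/-! ### Counting the constructed classes -/

theorem hadList_subset_flatten (k : Fin 17) : (hadList k).Sublist hadTable.flatten := by
  refine List.sublist_flatten_of_mem ?_
  have hl : hadTable.length = 17 := by decide +kernel
  rw [hadList, List.getD_eq_getElem _ _ (by rw [hl]; exact k.2)]
  exact List.getElem_mem _

theorem isHadamard_quad {r : ℕ × ℕ} (hr : r ∈ hadTable.flatten) : (hadMat (quad r.1)).IsHadamard := by
  have h := hadCheck_eq hr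
  rw [hadCheck, Bool.and_eq_true, Bool.and_eq_true] at h
  exact isHadamard_of_pairsBalanced (rowBits_lt r.1) (hadMat_quad_apply r.1) h.1.2

theorem fourScore_quad {r : ℕ × ℕ} (hr : r ∈ hadTable.flatten) : fourScore (hadMat (quad r.1)) = r.2 := by
  have h := hadCheck_eq hr
  rw [hadCheck, Bool.and_eq_true, Bool.and_eq_true, Nat.beq_eq] at h
  rw [fourScore_eq (rowBits_lt r.1) (hadMat_quad_apply r.1) h.1.1, h.2]

/-- The two quadruples belong to the fourth row of the table and share the score 3942521385416. The
number `v` is the local score of the row with index 2 of the second matrix, and no row of the first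
matrix has it. -/
theorem not_hadamardEquivalent_pair :
    ¬HadamardEquivalent (hadMat (quad 327508258)) (hadMat (quad 738550050)) :=
  not_hadamardEquivalent_of_avoidsScore (v := 263301724028) (i := 2) (by decide +kernel)
    (by norm_num) (by decide +kernel) (by decide +kernel)

/-- The second components in the list are different, with the exception of a single pair. -/
def scoresDiffer : List (ℕ × ℕ) → Bool
  | [] => true
  | r :: l => (l.all fun s => !Nat.beq r.2 s.2 || (Nat.beq r.1 327508258 && Nat.beq s.1 738550050)) &&
    scoresDiffer l

theorem pairwise_of_scoresDiffer {l : List (ℕ × ℕ)} (h : scoresDiffer l = true) :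
    l.Pairwise fun r s => r.2 ≠ s.2 ∨ r.1 = 327508258 ∧ s.1 = 738550050 := by
  induction l with
  | nil => exact List.Pairwise.nil
  | cons r l ih =>
    rw [scoresDiffer, Bool.and_eq_true] at h
    refine List.Pairwise.cons (fun s hs => ?_) (ih h.2)
    have h1 := List.all_eq_true.1 h.1 s hs
    rw [Bool.or_eq_true, Bool.not_eq_true', Bool.eq_false_iff, ne_eq, Nat.beq_eq, Bool.and_eq_true,
      Nat.beq_eq, Nat.beq_eq] at h1
    exact h1

theorem scoresDiffer_hadTable : scoresDiffer hadTable.flatten = true := by decide +kernel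

/-- The lower bound. The comparison runs over the concatenated list, so matrices from different rows
of the table are separated too. -/
theorem pairwise_not_hadamardEquivalent : hadTable.flatten.Pairwise fun r s =>
    ¬HadamardEquivalent (hadMat (quad r.1)) (hadMat (quad s.1)) := by
  refine (pairwise_of_scoresDiffer scoresDiffer_hadTable).imp_of_mem ?_
  intro r s hr hs h heq
  rcases h with h | ⟨h1, h2⟩
  · rw [← fourScore_quad hr, ← fourScore_quad hs] at h
    exact h (fourScore_eq_of_hadamardEquivalent heq)
  · rw [h1, h2] at heq
    exact not_hadamardEquivalent_pair heq

theorem eq_of_hadamardEquivalent {r s : ℕ × ℕ} (hr : r ∈ hadTable.flatten) (hs : s ∈ hadTable.flatten)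
    (h : HadamardEquivalent (hadMat (quad r.1)) (hadMat (quad s.1))) : r = s := by
  by_contra hne
  have : Std.Symm fun r s : ℕ × ℕ => ¬HadamardEquivalent (hadMat (quad r.1)) (hadMat (quad s.1)) :=
    ⟨fun _ _ h h' => h (hadamardEquivalent_symm h')⟩
  exact pairwise_not_hadamardEquivalent.forall hr hs hne h

theorem nodup_flatten : hadTable.flatten.Nodup :=
  pairwise_not_hadamardEquivalent.imp fun {r s} h (he : r = s) =>
    h (by rw [he]; exact hadamardEquivalent_refl _)

/-- Orthogonality has been computed for the listed matrices, and every constructed matrix is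
equivalent to one of these. -/
theorem isHadamard_hadMat (x : BS 8 7) : (hadMat x.1).IsHadamard := by
  obtain ⟨r, hr, h⟩ := exists_hadList x
  exact isHadamard_of_hadamardEquivalent (hadamardEquivalent_symm h)
    (isHadamard_quad ((hadList_subset_flatten ⟨_, rowOf_lt x⟩).subset hr))

theorem exists_of_mem_hadList {k : Fin 17} {r : ℕ × ℕ} (hr : r ∈ hadList k) :
    ∃ x : BS 8 7, x.1 = quad r.1 ∧ rowOf x = k := by
  have h := List.all_eq_true.1 (of_allBelow cls_hadTable k.2) r hr
  rw [Nat.beq_eq] at h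
  have hu := Code.inRange_unpack r.1
  refine ⟨⟨_, Code.isBaseSequences_of_cls_lt hu (h.trans_lt k.2)⟩, Code.toQuad_unpack r.1, ?_⟩
  exact (congrArg Code.cls (Code.ofQuad_toQuad hu)).trans h

/-- A sublist counts the classes for `S` if it is reached from all of `S` and comes from `S`. This
is applied to the whole list for all of BS(8,7), and to one row for one class. -/
theorem ncard_constructedClasses {S : Set (BS 8 7)} {l : List (ℕ × ℕ)}
    (hl : l.Sublist hadTable.flatten)
    (h1 : ∀ x ∈ S, ∃ r ∈ l, HadamardEquivalent (hadMat x.1) (hadMat (quad r.1)))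
    (h2 : ∀ r ∈ l, ∃ x ∈ S, x.1 = quad r.1) : (constructedClasses S).ncard = l.length := by
  have hn : l.Nodup := hl.nodup nodup_flatten
  let f : {r // r ∈ l.toFinset} → Quotient (hadamardSetoid (4 * (8 + 7))) := fun r =>
    Quotient.mk (hadamardSetoid (4 * (8 + 7)))
      ⟨hadMat (quad r.1.1), isHadamard_quad (hl.subset (List.mem_toFinset.1 r.2))⟩
  have hf : Function.Injective f := fun r s h => Subtype.ext (eq_of_hadamardEquivalent
    (hl.subset (List.mem_toFinset.1 r.2)) (hl.subset (List.mem_toFinset.1 s.2)) (Quotient.exact h))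
  have hrange : constructedClasses S = f '' Set.univ := by
    rw [Set.image_univ]
    ext c
    constructor
    · rintro ⟨x, hx, H, hH, rfl⟩
      obtain ⟨r, hr, h⟩ := h1 x hx
      refine ⟨⟨r, List.mem_toFinset.2 hr⟩, Quotient.sound (s := hadamardSetoid (4 * (8 + 7))) ?_⟩
      change HadamardEquivalent (hadMat (quad r.1)) H.1
      rw [hH]
      exact hadamardEquivalent_symm h
    · rintro ⟨r, rfl⟩
      obtain ⟨x, hx, h⟩ := h2 r.1 (List.mem_toFinset.1 r.2)
      exact ⟨x, hx, _, congrArg hadMat h.symm, rfl⟩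
  rw [hrange, Set.ncard_image_of_injective _ hf, Set.ncard_univ, Nat.card_eq_fintype_card,
    Fintype.card_coe, List.toFinset_card_of_nodup hn]

/-- Both matrices are equivalent to listed ones, which must coincide because listed matrices are
pairwise nonequivalent. The common listed quadruple is itself a member of BS(8,7) and has only one
row number. -/
theorem rowOf_eq_of_hadamardEquivalent {x y : BS 8 7}
    (h : HadamardEquivalent (hadMat x.1) (hadMat y.1)) : rowOf x = rowOf y := by
  obtain ⟨r, hr, h1⟩ := exists_hadList x
  obtain ⟨s, hs, h2⟩ := exists_hadList y
  have hrs := eq_of_hadamardEquivalent ((hadList_subset_flatten ⟨_, rowOf_lt x⟩).subset hr)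
    ((hadList_subset_flatten ⟨_, rowOf_lt y⟩).subset hs)
    (hadamardEquivalent_trans (hadamardEquivalent_symm h1) (hadamardEquivalent_trans h h2))
  subst hrs
  obtain ⟨z, hz, h3⟩ := exists_of_mem_hadList (k := ⟨_, rowOf_lt x⟩) hr
  obtain ⟨z', hz', h4⟩ := exists_of_mem_hadList (k := ⟨_, rowOf_lt y⟩) hs
  rw [Subtype.ext (hz.trans hz'.symm), h4] at h3
  exact h3.symm

end BaseSeq

theorem mainTheorem2 :
    -- The construction sends `BS(8, 7)` into `H(60)`.
    (∀ x : BS 8 7, (constructedMatrix x.1).IsHadamard) ∧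
    -- `BS(8, 7)` has 17 equivalence classes.
    Nat.card (Quotient (baseSetoid 7)) = 17 ∧
    -- The construction yields exactly 558 equivalence classes of `H(60)`.
    (constructedClasses (Set.univ : Set (BS 8 7))).ncard = 558 ∧
    -- Nonequivalent base sequences give nonequivalent Hadamard matrices.
    (∀ x y : BS 8 7, ¬ (baseSetoid 7).r x y →
      ¬ HadamardEquivalent (constructedMatrix x.1) (constructedMatrix y.1)) ∧
    -- The table: its rows represent the equivalence classes of `BS(8, 7)`, each exactly once,
    -- with the stated size and number of constructed classes of `H(60)`.
    ∃ rep : Fin 17 → BS 8 7,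
      (∀ k, (rep k).1 = decode (table k).AB (table k).CD) ∧
      (∀ x : BS 8 7, ∃! k, (baseSetoid 7).r (rep k) x) ∧
      (∀ k, {x : BS 8 7 | (baseSetoid 7).r (rep k) x}.ncard = (table k).size) ∧
      (∀ k, (constructedClasses {x : BS 8 7 | (baseSetoid 7).r (rep k) x}).ncard =
        (table k).had) := by
  obtain ⟨rep, hrep, hr⟩ := BaseSeq.exists_representative
  have hself : ∀ k, BaseSeq.rowOf (rep k) = k := fun k => (hr _ _).1 ((baseSetoid 7).refl _)
  have hsub := fun x : BS 8 7 => BaseSeq.hadList_subset_flatten ⟨_, BaseSeq.rowOf_lt x⟩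
  refine ⟨BaseSeq.isHadamard_hadMat, ?_, ?_, ?_, rep, hrep, ?_, ?_, ?_⟩
  -- The 17 representatives form a transversal of the equivalence classes.
  · have hb : Function.Bijective fun k => Quotient.mk (baseSetoid 7) (rep k) := by
      constructor
      · intro k l h
        have h1 := (hr _ _).1 (Quotient.exact (s := baseSetoid 7) h)
        rw [hself] at h1
        exact (Fin.ext h1).symm
      · intro q
        obtain ⟨x, rfl⟩ := Quotient.exists_rep q
        exact ⟨⟨_, BaseSeq.rowOf_lt x⟩, Quotient.sound (s := baseSetoid 7) ((hr _ _).2 rfl)⟩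
    rw [← Nat.card_congr (Equiv.ofBijective _ hb), Nat.card_eq_fintype_card, Fintype.card_fin]
  · rw [BaseSeq.ncard_constructedClasses (List.Sublist.refl _)]
    · decide +kernel
    · intro x _
      obtain ⟨r, hr, h⟩ := BaseSeq.exists_hadList x
      exact ⟨r, (hsub x).subset hr, h⟩
    · intro r h
      obtain ⟨l, hl, h1⟩ := List.mem_flatten.1 h
      obtain ⟨k, hk, rfl⟩ := List.mem_iff_getElem.1 hl
      have hlen : BaseSeq.hadTable.length = 17 := by decide +kernel
      obtain ⟨x, hx, -⟩ := BaseSeq.exists_of_mem_hadList (k := ⟨k, hlen ▸ hk⟩) (r := r)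
        (by rw [BaseSeq.hadList, List.getD_eq_getElem _ _ hk]; exact h1)
      exact ⟨x, Set.mem_univ _, hx⟩
  · intro x y h h'
    -- Equivalent matrices force equal row numbers, so both quadruples are equivalent to the same
    -- representative.
    have h1 := BaseSeq.rowOf_eq_of_hadamardEquivalent h'
    have h2 := (hr x ⟨_, BaseSeq.rowOf_lt x⟩).2 rfl
    have h3 := (hr y ⟨_, BaseSeq.rowOf_lt x⟩).2 h1.symm
    exact h ((baseSetoid 7).trans ((baseSetoid 7).symm h2) h3)
  · intro x
    exact ⟨⟨_, BaseSeq.rowOf_lt x⟩, (hr _ _).2 rfl, fun k hk => Fin.ext ((hr _ _).1 hk).symm⟩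
  · intro k
    simp only [hr]
    exact BaseSeq.ncard_rowOf_eq k
  · intro k
    simp only [hr]
    rw [BaseSeq.ncard_constructedClasses (BaseSeq.hadList_subset_flatten k), BaseSeq.length_hadList]
    · intro x hx
      obtain ⟨r, hr, h⟩ := BaseSeq.exists_hadList x
      rw [show BaseSeq.rowOf x = k from hx] at hr
      exact ⟨r, hr, h⟩
    · intro r h
      obtain ⟨x, hx, hk⟩ := BaseSeq.exists_of_mem_hadList h
      exact ⟨x, hk, hx⟩
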